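/- Let $\mathcal E$ be a locally cartesian closed category with a terminal object. For $f\colon B\to A$ write $\Sigma_f\dashv f^*\dashv \Pi_f$ for dependent sum, pullback and dependent product between $\mathcal E/B$ and $\mathcal E/A$. A functor $F\colon\mathcal E/I\to\mathcal E/J$ with a tensorial strength (with respect to the tensors $K\otimes(X\to I)=(K\times X\to X\to I)$, $K\in\mathcal E$) is *polynomial* if it is isomorphic, by a strong natural isomorphism, to $\Sigma_t\Pi_f s^*$, with its canonical strength, for some diagram $I\xleftarrow{s}B\xrightarrow{f}A\xrightarrow{t}J$. A *polynomial monad* on $\mathcal E/I$ is a monad $T$ on $\mathcal E/I$ whose underlying functor is polynomial and whose unit and multiplication are cartesian (all naturality squares are pullbacks) and strong. Let $\mathbf{PolyMnd}$ be the category of pairs $(I,T)$ with $I\in\mathcal E$ and $T$ a polynomial monad on $\mathcal E/I$. A map $(I',T')\to(I,T)$ is a pair of a map $u\colon I'\to I$ and a cartesian strong natural transformation $\varphi\colon \Sigma_uT'\Rightarrow T\Sigma_u$ such that $\varphi\circ\Sigma_u\eta'=\eta\Sigma_u$ and $\varphi\circ\Sigma_u\mu'=\mu\Sigma_u\circ T\varphi\circ\varphi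 T'$. For a fixed object $I$ let $\mathbf{PolyMnd}(1)$ be the fibre of $\mathbf{PolyMnd}\to\mathcal E$ over $I$ (here $1$ stands for the terminal object $\mathrm{id}_I$ of $\mathcal E/I$): its objects are the polynomial monads on $\mathcal E/I$, its maps the cartesian strong monad morphisms. Let $P$ be a polynomial monad on $\mathcal E/I$. A *$P$-multicategory* is a monad in the double category of $P$-spans in $\mathcal E/I$, that is, a span $PC\xleftarrow{d}N\xrightarrow{c}C$ in $\mathcal E/I$ with maps of $P$-spans $C\to N$ (from the identity span $PC\xleftarrow{\eta}C=C$) and $PN\times_{PC}N\to N$ (from the composite span, with legs $PN\times_{PC}N\to PN\xrightarrow{Pd}PPC\xrightarrow{\mu}PC$ and $PN\times_{PC}N\to N\xrightarrow{c}C$) which satisfy the unit laws and the associativity law. The morphisms of $P$-multicategories are the pairs of maps $C\to C'$, $N\to N'$ compatible with all the structure. A *$P$-operad* is a $P$-multicategory for which $C$ is terminal in $\mathcal E/I$. Then there are equivalences of categories $$P\text{-}\mathbf{Multicat}\simeq\mathbf{PolyMnd}/(I,P),\qquad P\text{-}\mathbf{Operad}\simeq\mathbf{PolyMnd}(1)/P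 .$$ They are natural in the sense that, up to natural isomorphism, they send an object $(u,\varphi)\colon(J,T)\to(I,P)$ of the right-hand side (with $u=\mathrm{id}_I$ in the second case) to the $P$-span $$P(\Sigma_u1)\xleftarrow{\ \varphi_1\ }\Sigma_uT1\longrightarrow\Sigma_u1,$$ where $1$ is the terminal object of $\mathcal E/J$, with the unit and the multiplication induced by those of $T$ (using $P(\Sigma_uT1)\times_{P(\Sigma_u1)}\Sigma_uT1\cong\Sigma_uTT1$, which holds since $\varphi$ is cartesian). Moreover, for $\mathcal E=\mathbf{Set}$ and $I=1$, the free-monoid monad $M$ and the identity monad $\mathrm{Id}$ on $\mathbf{Set}=\mathbf{Set}/1$ are polynomial monads, and there are equivalences of categories $$\mathbf{Multicat}\simeq\mathbf{PolyMnd}/M,\quad \mathbf{PlainOperad}\simeq\mathbf{PolyMnd}(1)/M,\quad \mathbf{Cat}\simeq\mathbf{PolyMnd}/\mathrm{Id},\quad \mathbf{Monoid}\simeq\mathbf{PolyMnd}(1)/\mathrm{Id},$$ where the left-hand sides are the categories of small (Lambek) multicategories, plain (nonsymmetric) operads, small categories and monoids. These equivalences are natural in the same sense: up to natural isomorphism,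 the $M$- respectively $\mathrm{Id}$-span with unit and multiplication, formed as above from the object corresponding to a multicategory, operad, category or monoid, consists of its set of objects (one object for operads and monoids), its set of operations (arrows, elements), the source and target maps, the identities and the composition. -/

import Mathlib

open CategoryTheory CategoryTheory.Limits

universe w v u

namespace PolyMonads

open MonoidalCategory CartesianMonoidalCategory

/-- A category with pullbacks is locally cartesian closed if every pullback functor between its
slices has a right adjoint. -/
class LocallyCartesianClosed (E : Type u) [Category.{v} E] [HasPullbacks E] : Prop where
  isLeftAdjoint_pullback {B A : E} (f : B ⟶ A) : (Over.pullback f).IsLeftAdjoint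

attribute [instance] LocallyCartesianClosed.isLeftAdjoint_pullback

section Pullback

variable {E : Type u} [Category.{v} E] [HasPullbacks E] {I J : E}

/-- The projection `X ×_I J → X`. -/
noncomputable def pbFst (s : J ⟶ I) (X : Over I) :
    ((Over.pullback s).obj X).left ⟶ X.left := pullback.fst X.hom s

/-- Maps into `X ×_I J` in the slice over `J`. -/
noncomputable def pbLift (s : J ⟶ I) {X : Over I} {W : Over J} (g : W.left ⟶ X.left)
    (h : g ≫ X.hom = W.hom ≫ s) : W ⟶ (Over.pullback s).obj X :=
  Over.homMk (pullback.lift g W.hom h) (pullback.lift_snd _ _ _)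

lemma pbFst_w (s : J ⟶ I) (X : Over I) :
    pbFst s X ≫ X.hom = ((Over.pullback s).obj X).hom ≫ s := pullback.condition

@[simp]
lemma pbLift_fst (s : J ⟶ I) {X : Over I} {W : Over J} (g : W.left ⟶ X.left)
    (h : g ≫ X.hom = W.hom ≫ s) : (pbLift s g h).left ≫ pbFst s X = g :=
  pullback.lift_fst _ _ _

@[simp]
lemma pbLift_fst_assoc (s : J ⟶ I) {X : Over I} {W : Over J} (g : W.left ⟶ X.left)
    (h : g ≫ X.hom = W.hom ≫ s) {Z : E} (k : X.left ⟶ Z) :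
    (pbLift s g h).left ≫ pbFst s X ≫ k = g ≫ k := by
  rw [← Category.assoc, pbLift_fst]

@[simp]
lemma pbMap_fst (s : J ⟶ I) {X Y : Over I} (f : X ⟶ Y) :
    ((Over.pullback s).map f).left ≫ pbFst s Y = pbFst s X ≫ f.left :=
  pullback.lift_fst _ _ _

@[simp]
lemma pbMap_fst_assoc (s : J ⟶ I) {X Y : Over I} (f : X ⟶ Y) {Z : E} (k : Y.left ⟶ Z) :
    ((Over.pullback s).map f).left ≫ pbFst s Y ≫ k = pbFst s X ≫ f.left ≫ k := by
  rw [← Category.assoc, pbMap_fst, Category.assoc]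

lemma pb_ext (s : J ⟶ I) {X : Over I} {W : Over J} {a b : W ⟶ (Over.pullback s).obj X}
    (h : a.left ≫ pbFst s X = b.left ≫ pbFst s X) : a = b := by
  ext1
  exact pullback.hom_ext h ((Over.w a).trans (Over.w b).symm)

end Pullback

section Tensor

variable {E : Type u} [Category.{v} E] [CartesianMonoidalCategory E] {I J L : E}

/-- The tensor `K ⊗ X` of an object `X → I` of the slice over `I` with an object `K`,
namely `K × X → X → I`. -/
abbrev tensor (K : E) (X : Over I) : Over I := Over.mk (snd K X.left ≫ X.hom)

/-- Functoriality of `tensor` in both variables. -/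
abbrev tensorMap {K K' : E} (k : K ⟶ K') {X Y : Over I} (f : X ⟶ Y) : tensor K X ⟶ tensor K' Y :=
  Over.homMk (k ⊗ₘ f.left) (by simp)

/-- The canonical map `1 ⊗ X → X` (an isomorphism). -/
abbrev tensorUnit (X : Over I) : tensor (𝟙_ E) X ⟶ X :=
  Over.homMk (snd (𝟙_ E) X.left) (by simp)

/-- The canonical map `(K ⊗ K') ⊗ X → K ⊗ (K' ⊗ X)` (an isomorphism). -/
abbrev tensorAssoc (K K' : E) (X : Over I) : tensor (K ⊗ K') X ⟶ tensor K (tensor K' X) :=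
  Over.homMk (α_ K K' X.left).hom (by simp)

lemma tensorMap_id (K : E) (X : Over I) : tensorMap (𝟙 K) (𝟙 X) = 𝟙 (tensor K X) := by
  ext; simp

lemma tensorMap_comp {K K' K'' : E} (k : K ⟶ K') (k' : K' ⟶ K'') {X Y Z : Over I} (f : X ⟶ Y)
    (g : Y ⟶ Z) : tensorMap k f ≫ tensorMap k' g = tensorMap (k ≫ k') (f ≫ g) := by
  ext; simp

lemma tensorUnit_naturality {X Y : Over I} (f : X ⟶ Y) :
    tensorMap (𝟙 (𝟙_ E)) f ≫ tensorUnit Y = tensorUnit X ≫ f := by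
  ext; simp [leftUnitor_hom]

lemma tensorAssoc_naturality (K K' : E) {X Y : Over I} (f : X ⟶ Y) :
    tensorMap (𝟙 (K ⊗ K')) f ≫ tensorAssoc K K' Y =
      tensorAssoc K K' X ≫ tensorMap (𝟙 K) (tensorMap (𝟙 K') f) := by
  ext; simp

/-- A tensorial strength on a functor between slices. -/
structure Strength (F : Over I ⥤ Over J) where
  app (K : E) (X : Over I) : tensor K (F.obj X) ⟶ F.obj (tensor K X)
  naturality {K K' : E} (k : K ⟶ K') {X Y : Over I} (f : X ⟶ Y) :
    tensorMap k (F.map f) ≫ app K' Y = app K X ≫ F.map (tensorMap k f)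
  unit (X : Over I) : app (𝟙_ E) X ≫ F.map (tensorUnit X) = tensorUnit (F.obj X)
  assoc (K K' : E) (X : Over I) :
    tensorAssoc K K' (F.obj X) ≫ tensorMap (𝟙 K) (app K' X) ≫ app K (tensor K' X) =
      app (K ⊗ K') X ≫ F.map (tensorAssoc K K' X)

/-- A natural transformation between functors with strength is strong if it is compatible with the
strengths. -/
def IsStrong {F G : Over I ⥤ Over J} (σ : Strength F) (τ : Strength G) (φ : F ⟶ G) : Prop :=
  ∀ (K : E) (X : Over I),
    σ.app K X ≫ φ.app (tensor K X) = tensorMap (𝟙 K) (φ.app X) ≫ τ.app K X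

/-- The strength of the identity functor. -/
def Strength.id (I : E) : Strength (𝟭 (Over I)) where
  app K X := 𝟙 _
  naturality _ _ _ _ := by simp
  unit _ := by simp
  assoc _ _ _ := by ext; simp

/-- The strength of a composite functor. -/
def Strength.comp {F : Over I ⥤ Over J} {G : Over J ⥤ Over L} (σ : Strength F) (τ : Strength G) :
    Strength (F ⋙ G) where
  app K X := τ.app K (F.obj X) ≫ G.map (σ.app K X)
  naturality k _ _ f := by
    have := τ.naturality k (F.map f)
    simp only [Functor.comp_map, Functor.comp_obj, Category.assoc, ← G.map_comp, ← σ.naturality]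
    rw [G.map_comp, reassoc_of% this]
  unit X := by
    simp only [Functor.comp_map, Functor.comp_obj, Category.assoc, ← G.map_comp, σ.unit, τ.unit]
  assoc K K' X := by
    have h := τ.assoc K K' (F.obj X)
    have h2 := τ.naturality (𝟙 K) (σ.app K' X)
    have h3 : tensorMap (𝟙 K) (τ.app K' (F.obj X) ≫ G.map (σ.app K' X)) =
      tensorMap (𝟙 K) (τ.app K' (F.obj X)) ≫ tensorMap (𝟙 K) (G.map (σ.app K' X)) := by
        ext; simp
    simp only [Functor.comp_map, Functor.comp_obj, Category.assoc, ← G.map_comp, ← σ.assoc, h3]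
    rw [reassoc_of% h2, reassoc_of% h]
    simp

/-- The strength of the dependent sum functor `Over.map u`: the canonical identification of
`K ⊗ ∑ᵤ X` with `∑ᵤ (K ⊗ X)`. -/
def Strength.map (u : I ⟶ J) : Strength (Over.map u) where
  app K X := Over.homMk (𝟙 _) (by simp)
  naturality _ _ _ _ := by ext; simp
  unit _ := by ext; simp
  assoc _ _ _ := by ext; simp

variable [HasPullbacks E]

/-- The strength of the pullback functor: the canonical map (an isomorphism)
`K × (X ×_I J) → (K × X) ×_I J`. -/
noncomputable def Strength.pullback (s : J ⟶ I) : Strength (Over.pullback s) where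
  app K X := pbLift s (K ◁ pbFst s X) (by
    simp only [Over.mk_hom, Over.mk_left, whiskerLeft_snd_assoc, pbFst_w, Category.assoc])
  naturality k X Y f := by
    apply pb_ext
    simp [← id_tensorHom, -Over.pullback_obj_left, -Over.pullback_obj_hom, -Over.pullback_map_left,
      tensorHom_comp_tensorHom]
  unit X := by
    apply pb_ext
    simp [-Over.pullback_obj_left, -Over.pullback_obj_hom, -Over.pullback_map_left,
      leftUnitor_hom]
  assoc _ _ _ := by
    apply pb_ext
    simp [-Over.pullback_obj_left, -Over.pullback_obj_hom, -Over.pullback_map_left,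
      ← whiskerLeft_comp]

/-- The canonical map `(K × X) ×_I J → K × (X ×_I J)`, inverse to the strength of pullback. -/
noncomputable def pullbackTensor (s : J ⟶ I) (K : E) (X : Over I) :
    (Over.pullback s).obj (tensor K X) ⟶ tensor K ((Over.pullback s).obj X) :=
  Over.homMk (lift (pbFst s (tensor K X) ≫ fst K X.left)
    (pbLift s (W := (Over.pullback s).obj (tensor K X)) (pbFst s (tensor K X) ≫ snd K X.left)
      (by simpa using pbFst_w s (tensor K X))).left)
    (by simp [-Over.pullback_obj_left, -Over.pullback_obj_hom])

lemma pullbackTensor_naturality (s : J ⟶ I) {K K' : E} (k : K ⟶ K') {X Y : Over I} (f : X ⟶ Y) :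
    (Over.pullback s).map (tensorMap k f) ≫ pullbackTensor s K' Y =
      pullbackTensor s K X ≫ tensorMap k ((Over.pullback s).map f) := by
  ext1
  apply CartesianMonoidalCategory.hom_ext
  · simp [pullbackTensor, -Over.pullback_obj_left, -Over.pullback_obj_hom, -Over.pullback_map_left]
  · simp only [pullbackTensor, Over.comp_left, Over.homMk_left, Category.assoc, lift_snd,
      tensorHom_snd, lift_snd_assoc]
    rw [← Over.comp_left, ← Over.comp_left]
    congr 1
    apply pb_ext
    simp [-Over.pullback_obj_left, -Over.pullback_obj_hom, -Over.pullback_map_left]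

lemma pullbackTensor_unit (s : J ⟶ I) (X : Over I) :
    pullbackTensor s (𝟙_ E) X ≫ tensorUnit ((Over.pullback s).obj X) =
      (Over.pullback s).map (tensorUnit X) := by
  apply pb_ext
  simp [pullbackTensor, -Over.pullback_obj_left, -Over.pullback_obj_hom, -Over.pullback_map_left]

lemma pullbackTensor_assoc (s : J ⟶ I) (K K' : E) (X : Over I) :
    (Over.pullback s).map (tensorAssoc K K' X) ≫ pullbackTensor s K (tensor K' X) ≫
      tensorMap (𝟙 K) (pullbackTensor s K' X) =
    pullbackTensor s (K ⊗ K') X ≫ tensorAssoc K K' ((Over.pullback s).obj X) := by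
  ext1
  apply CartesianMonoidalCategory.hom_ext
  · simp [pullbackTensor, -Over.pullback_obj_left, -Over.pullback_obj_hom, -Over.pullback_map_left]
  · apply CartesianMonoidalCategory.hom_ext
    · simp [pullbackTensor, -Over.pullback_obj_left, -Over.pullback_obj_hom,
        -Over.pullback_map_left]
    · simp only [pullbackTensor, Over.comp_left, Over.homMk_left, Category.assoc, lift_snd,
        tensorHom_snd, lift_snd_assoc, Over.mk_left, associator_hom_snd_snd]
      rw [← Over.comp_left, ← Over.comp_left]
      congr 1
      apply pb_ext
      simp [-Over.pullback_obj_left, -Over.pullback_obj_hom, -Over.pullback_map_left]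

variable [LocallyCartesianClosed E]

/-- The dependent product functor along `f`: the right adjoint of pullback along `f`. -/
noncomputable abbrev depProd (f : J ⟶ I) : Over J ⥤ Over I := (Over.pullback f).rightAdjoint

/-- The adjunction between pullback and dependent product. -/
noncomputable abbrev depProdAdj (f : J ⟶ I) : Over.pullback f ⊣ depProd f :=
  Adjunction.ofIsLeftAdjoint (Over.pullback f)

/-- The strength of the dependent product functor: the transpose of the canonical map
`f^*(K ⊗ Π_f X) ≅ K ⊗ f^* Π_f X → K ⊗ X` given by the counit. -/
noncomputable def Strength.depProd (f : J ⟶ I) : Strength (depProd f) where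
  app K X := (depProdAdj f).homEquiv _ _
    (pullbackTensor f K ((PolyMonads.depProd f).obj X) ≫
      tensorMap (𝟙 K) ((depProdAdj f).counit.app X))
  naturality {K K'} k {X Y} g := by
    rw [← Adjunction.homEquiv_naturality_left, ← Adjunction.homEquiv_naturality_right]
    congr 1
    have h := (depProdAdj f).counit.naturality g
    rw [reassoc_of% pullbackTensor_naturality, Category.assoc, tensorMap_comp, tensorMap_comp,
      Category.comp_id, Category.id_comp]
    exact congrArg (fun t => pullbackTensor f K _ ≫ tensorMap k t) h
  unit X := by
    rw [← Adjunction.homEquiv_naturality_right, Category.assoc, tensorUnit_naturality,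
      reassoc_of% pullbackTensor_unit, ← Equiv.eq_symm_apply, Adjunction.homEquiv_counit]
  assoc K K' X := by
    rw [← Adjunction.homEquiv_naturality_right, Category.assoc,
      ← Adjunction.homEquiv_naturality_left, ← Adjunction.homEquiv_naturality_left]
    congr 1
    rw [tensorAssoc_naturality, ← reassoc_of% pullbackTensor_assoc]
    have h := ((depProdAdj f).homEquiv _ _).symm_apply_apply
      (pullbackTensor f K' ((PolyMonads.depProd f).obj X) ≫
        tensorMap (𝟙 K') ((depProdAdj f).counit.app X))
    rw [Adjunction.homEquiv_counit] at h
    dsimp only [Functor.id_obj] at h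
    rw [reassoc_of% pullbackTensor_naturality, tensorMap_comp, h, tensorMap_comp]

end Tensor
section Strong

variable {E : Type u} [Category.{v} E] [CartesianMonoidalCategory E] {I J L M : E}

lemma IsStrong.id {F : Over I ⥤ Over J} (σ : Strength F) : IsStrong σ σ (𝟙 F) := by
  intro K X
  rw [NatTrans.id_app, NatTrans.id_app, tensorMap_id, Category.comp_id, Category.id_comp]

lemma IsStrong.comp {F G H : Over I ⥤ Over J} {σ : Strength F} {τ : Strength G} {ρ : Strength H}
    {φ : F ⟶ G} {ψ : G ⟶ H} (h : IsStrong σ τ φ) (h' : IsStrong τ ρ ψ) :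
    IsStrong σ ρ (φ ≫ ψ) := by
  intro K X
  have := tensorMap_comp (𝟙 K) (𝟙 K) (φ.app X) (ψ.app X)
  rw [Category.comp_id] at this
  rw [NatTrans.comp_app, NatTrans.comp_app, reassoc_of% h K X, h' K X, ← this, Category.assoc]

lemma IsStrong.whiskerLeft {F : Over I ⥤ Over J} (σ : Strength F) {G H : Over J ⥤ Over L}
    {τ : Strength G} {ρ : Strength H} {φ : G ⟶ H} (h : IsStrong τ ρ φ) :
    IsStrong (σ.comp τ) (σ.comp ρ) (Functor.whiskerLeft F φ) := by
  intro K X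
  have := h K (F.obj X)
  simp only [Strength.comp, Functor.whiskerLeft_app, Functor.comp_obj, Category.assoc,
    NatTrans.naturality]
  rw [reassoc_of% this]

lemma IsStrong.whiskerRight {F G : Over I ⥤ Over J} {σ : Strength F} {τ : Strength G}
    {φ : F ⟶ G} (h : IsStrong σ τ φ) {H : Over J ⥤ Over L} (ρ : Strength H) :
    IsStrong (σ.comp ρ) (τ.comp ρ) (Functor.whiskerRight φ H) := by
  intro K X
  have := ρ.naturality (𝟙 K) (φ.app X)
  simp only [Strength.comp, Functor.whiskerRight_app, Functor.comp_obj, Category.assoc,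
    ← H.map_comp, h K X]
  rw [H.map_comp, reassoc_of% this]

lemma IsStrong.assoc {F : Over I ⥤ Over J} {G : Over J ⥤ Over L} {H : Over L ⥤ Over M}
    (σ : Strength F) (τ : Strength G) (ρ : Strength H) :
    IsStrong ((σ.comp τ).comp ρ) (σ.comp (τ.comp ρ)) (Functor.associator F G H).hom := by
  intro K X
  simp [Strength.comp, tensorMap_id]

lemma IsStrong.assoc_inv {F : Over I ⥤ Over J} {G : Over J ⥤ Over L} {H : Over L ⥤ Over M}
    (σ : Strength F) (τ : Strength G) (ρ : Strength H) :
    IsStrong (σ.comp (τ.comp ρ)) ((σ.comp τ).comp ρ) (Functor.associator F G H).inv := by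
  intro K X
  simp [Strength.comp, tensorMap_id]

lemma IsStrong.mapComp (u : I ⟶ J) (w : J ⟶ L) :
    IsStrong (Strength.map (u ≫ w)) ((Strength.map u).comp (Strength.map w))
      (Over.mapComp u w).hom := by
  intro K X
  ext
  simp [Strength.comp, Strength.map]

lemma IsStrong.mapComp_inv (u : I ⟶ J) (w : J ⟶ L) :
    IsStrong ((Strength.map u).comp (Strength.map w)) (Strength.map (u ≫ w))
      (Over.mapComp u w).inv := by
  intro K X
  ext
  simp [Strength.comp, Strength.map]

lemma IsStrong.mapId (I : E) :
    IsStrong (Strength.map (𝟙 I)) (Strength.id I) (Over.mapId I).hom := by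
  intro K X
  ext
  simp [Strength.id, Strength.map]

lemma IsStrong.mapId_inv (I : E) :
    IsStrong (Strength.id I) (Strength.map (𝟙 I)) (Over.mapId I).inv := by
  intro K X
  ext
  simp [Strength.id, Strength.map]

lemma IsStrong.leftUnitor {F : Over I ⥤ Over J} (σ : Strength F) :
    IsStrong ((Strength.id I).comp σ) σ F.leftUnitor.hom := by
  intro K X
  simp [Strength.id, Strength.comp, tensorMap_id]

lemma IsStrong.leftUnitor_inv {F : Over I ⥤ Over J} (σ : Strength F) :
    IsStrong σ ((Strength.id I).comp σ) F.leftUnitor.inv := by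
  intro K X
  simp [Strength.id, Strength.comp, tensorMap_id]

lemma IsStrong.rightUnitor {F : Over I ⥤ Over J} (σ : Strength F) :
    IsStrong (σ.comp (Strength.id J)) σ F.rightUnitor.hom := by
  intro K X
  simp [Strength.id, Strength.comp, tensorMap_id]

instance (u : I ⟶ J) : PreservesLimitsOfShape WalkingCospan (Over.map u) := by
  have : PreservesLimitsOfShape WalkingCospan (Over.map u ⋙ Over.forget J) :=
    inferInstanceAs (PreservesLimitsOfShape WalkingCospan (Over.forget I))
  exact preservesLimitsOfShape_of_reflects_of_preserves (Over.map u) (Over.forget J)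

end Strong

section PolynomialMonads

/-- A polynomial `I ← B → A → J`. -/
structure Poly {E : Type u} [Category.{v} E] (I J : E) where
  B : E
  A : E
  s : B ⟶ I
  f : B ⟶ A
  t : A ⟶ J

variable {E : Type u} [Category.{v} E] [CartesianMonoidalCategory E] [HasPullbacks E]
  [LocallyCartesianClosed E] {I J : E}

/-- The extension `∑_t ∏_f s^*` of a polynomial. -/
noncomputable def Poly.ext (p : Poly I J) : Over I ⥤ Over J :=
  (Over.pullback p.s ⋙ depProd p.f) ⋙ Over.map p.t

/-- The canonical strength of the extension of a polynomial. -/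
noncomputable def Poly.strength (p : Poly I J) : Strength p.ext :=
  ((Strength.pullback p.s).comp (Strength.depProd p.f)).comp (Strength.map p.t)

/-- A functor with strength between slices is polynomial if it is isomorphic, by a strong natural
isomorphism, to the extension of a polynomial. -/
def IsPolynomialFunctor {F : Over I ⥤ Over J} (σ : Strength F) : Prop :=
  ∃ (p : Poly I J) (e : F ≅ p.ext), IsStrong σ p.strength e.hom

/-- A natural transformation is cartesian if all its naturality squares are pullbacks. -/
abbrev IsCartesian {𝒞 : Type*} [Category* 𝒞] {𝒟 : Type*} [Category* 𝒟] {F G : 𝒞 ⥤ 𝒟}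
    (φ : F ⟶ G) : Prop :=
  NatTrans.Equifibered φ

/-- A monad (with strength) on a slice is a polynomial monad if its underlying functor is polynomial
and its unit and multiplication are cartesian and strong. -/
structure IsPolynomialMonad (T : Monad (Over I)) (σ : Strength T.toFunctor) : Prop where
  isPolynomialFunctor : IsPolynomialFunctor σ
  η_cartesian : IsCartesian T.η
  μ_cartesian : IsCartesian T.μ
  η_strong : IsStrong (Strength.id I) σ T.η
  μ_strong : IsStrong (σ.comp σ) σ T.μ

/-- Polynomial monads on the slice over `I`. -/
structure PolynomialMonad (I : E) where
  toMonad : Monad (Over I)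
  strength : Strength toMonad.toFunctor
  isPolynomialMonad : IsPolynomialMonad toMonad strength

/-- Morphisms of polynomial monads on a fixed slice: cartesian strong morphisms of monads. -/
@[ext]
structure PolynomialMonad.Hom (T' T : PolynomialMonad I) where
  hom : T'.toMonad ⟶ T.toMonad
  cartesian : IsCartesian hom.toNatTrans
  strong : IsStrong T'.strength T.strength hom.toNatTrans

/-- The category of polynomial monads on the slice over `I`; this is the fibre over `I` of the
category of all polynomial monads. -/
instance : Category (PolynomialMonad I) where
  Hom := PolynomialMonad.Hom
  id T := ⟨𝟙 _, .of_isIso (𝟙 T.toMonad.toFunctor), .id _⟩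
  comp φ ψ := ⟨φ.hom ≫ ψ.hom, NatTrans.Equifibered.comp φ.cartesian ψ.cartesian,
    φ.strong.comp ψ.strong⟩
  id_comp _ := PolynomialMonad.Hom.ext (Category.id_comp _)
  comp_id _ := PolynomialMonad.Hom.ext (Category.comp_id _)
  assoc _ _ _ := PolynomialMonad.Hom.ext (Category.assoc _ _ _)

lemma PolynomialMonad.id_app (T : PolynomialMonad I) (X : Over I) :
    (PolynomialMonad.Hom.hom (𝟙 T : T ⟶ T)).app X = 𝟙 (T.toMonad.obj X) := rfl

lemma PolynomialMonad.comp_app {T'' T' T : PolynomialMonad I} (ψ : T'' ⟶ T') (φ : T' ⟶ T)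
    (X : Over I) : (PolynomialMonad.Hom.hom (ψ ≫ φ : T'' ⟶ T)).app X =
      (PolynomialMonad.Hom.hom ψ).app X ≫ (PolynomialMonad.Hom.hom φ).app X := rfl

variable (E) in
/-- Polynomial monads on arbitrary slices: pairs of an object `I` and a polynomial monad on the
slice over `I`. -/
structure PolyMnd where
  base : E
  monad : PolynomialMonad base

/-- A morphism `(I', T') ⟶ (I, T)` of polynomial monads is a map `u : I' ⟶ I` together with a
cartesian strong natural transformation `∑ᵤ T' ⟶ T ∑ᵤ` that is compatible with the units and the
multiplications. -/
@[ext]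
structure PolyMnd.Hom (T' T : PolyMnd E) where
  base : T'.base ⟶ T.base
  trans : T'.monad.toMonad.toFunctor ⋙ Over.map base ⟶ Over.map base ⋙ T.monad.toMonad.toFunctor
  cartesian : IsCartesian trans
  strong : IsStrong (T'.monad.strength.comp (Strength.map base))
    ((Strength.map base).comp T.monad.strength) trans
  unit (X : Over T'.base) :
    (Over.map base).map (T'.monad.toMonad.η.app X) ≫ trans.app X =
      T.monad.toMonad.η.app ((Over.map base).obj X)
  mult (X : Over T'.base) :
    (Over.map base).map (T'.monad.toMonad.μ.app X) ≫ trans.app X =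
      trans.app (T'.monad.toMonad.obj X) ≫ T.monad.toMonad.map (trans.app X) ≫
        T.monad.toMonad.μ.app ((Over.map base).obj X)

namespace PolyMnd

/-- A transformation `T' ⟶ T` regarded as a transformation `∑_𝟙 T' ≅ T' ⟶ T ≅ T ∑_𝟙`. -/
def fibreTrans {T' T : PolynomialMonad I} (φ : T'.toMonad.toFunctor ⟶ T.toMonad.toFunctor) :
    T'.toMonad.toFunctor ⋙ Over.map (𝟙 I) ⟶ Over.map (𝟙 I) ⋙ T.toMonad.toFunctor :=
  Functor.whiskerLeft T'.toMonad.toFunctor (Over.mapId I).hom ≫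
    T'.toMonad.toFunctor.rightUnitor.hom ≫ φ ≫ T.toMonad.toFunctor.leftUnitor.inv ≫
    Functor.whiskerRight (Over.mapId I).inv T.toMonad.toFunctor

@[simp]
lemma fibreTrans_app {T' T : PolynomialMonad I}
    (φ : T'.toMonad.toFunctor ⟶ T.toMonad.toFunctor) (X : Over I) :
    (fibreTrans φ).app X = (Over.mapId I).hom.app (T'.toMonad.obj X) ≫ φ.app X ≫
      T.toMonad.map ((Over.mapId I).inv.app X) := by
  simp only [fibreTrans, NatTrans.comp_app, Functor.whiskerLeft_app, Functor.whiskerRight_app,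
    Functor.rightUnitor_hom_app, Functor.leftUnitor_inv_app]
  erw [Category.id_comp, Category.id_comp]

lemma fibreTrans_id_app (T : PolynomialMonad I) (X : Over I) :
    (fibreTrans (PolynomialMonad.Hom.hom (𝟙 T : T ⟶ T)).toNatTrans).app X =
      (Over.mapId I).hom.app (T.toMonad.obj X) ≫
        T.toMonad.map ((Over.mapId I).inv.app X) := by
  rw [fibreTrans_app]
  exact congrArg _ (Category.id_comp _)

lemma fibreTrans_cartesian {T' T : PolynomialMonad I}
    {φ : T'.toMonad.toFunctor ⟶ T.toMonad.toFunctor} (hφ : IsCartesian φ) :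
    IsCartesian (fibreTrans φ) :=
  NatTrans.Equifibered.comp (.of_isIso _) (.comp (.of_isIso _)
    (.comp hφ (.comp (.of_isIso _) (.of_isIso _))))

/-- A morphism of polynomial monads on a fixed slice, as a morphism over the identity map. -/
def Hom.ofFibre {T' T : PolynomialMonad I} (φ : T' ⟶ T) : Hom ⟨I, T'⟩ ⟨I, T⟩ where
  base := 𝟙 I
  trans := fibreTrans φ.hom.toNatTrans
  cartesian := fibreTrans_cartesian φ.cartesian
  strong := (IsStrong.whiskerLeft _ (.mapId _)).comp <| (IsStrong.rightUnitor _).comp <|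
    φ.strong.comp <| (IsStrong.leftUnitor_inv _).comp <| IsStrong.whiskerRight (.mapId_inv _) _
  unit X := by
    have h := (Over.mapId I).hom.naturality (T'.toMonad.η.app X)
    have h2 := T.toMonad.η.naturality ((Over.mapId I).inv.app X)
    have h3 := φ.hom.app_η X
    dsimp only [Functor.id_obj, Functor.id_map, Functor.comp_obj] at h h2
    rw [fibreTrans_app, reassoc_of% h, reassoc_of% h3, ← h2, Iso.hom_inv_id_app_assoc]
  mult X := by
    have h := (Over.mapId I).hom.naturality (T'.toMonad.μ.app X)
    have h2 := T.toMonad.μ.naturality ((Over.mapId I).inv.app X)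
    have h3 := φ.hom.app_μ X
    have h4 := φ.hom.naturality (φ.hom.app X)
    dsimp only [Functor.id_obj, Functor.id_map, Functor.comp_obj, Functor.comp_map] at h h2
    have h6 : T.toMonad.map ((Over.mapId I).inv.app (T'.toMonad.obj X)) ≫
        T.toMonad.map ((Over.mapId I).hom.app (T'.toMonad.obj X)) = 𝟙 _ := by
      rw [← Functor.map_comp, Iso.inv_hom_id_app]
      exact CategoryTheory.Functor.map_id _ _
    rw [fibreTrans_app, fibreTrans_app, reassoc_of% h, reassoc_of% h3, ← h2, reassoc_of% h4]
    simp only [Category.assoc, Functor.map_comp]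
    rw [reassoc_of% h6]

/-- The composite `∑ᵤ ∑ᵥ T'' ⟶ ∑ᵤ T' ∑ᵥ ⟶ T ∑ᵤ ∑ᵥ`. -/
def compTrans {K : E} {T'' : PolynomialMonad I} {T' : PolynomialMonad J} {T : PolynomialMonad K}
    {a : I ⟶ J} {b : J ⟶ K}
    (ψ : T''.toMonad.toFunctor ⋙ Over.map a ⟶ Over.map a ⋙ T'.toMonad.toFunctor)
    (φ : T'.toMonad.toFunctor ⋙ Over.map b ⟶ Over.map b ⋙ T.toMonad.toFunctor) :
    T''.toMonad.toFunctor ⋙ Over.map (a ≫ b) ⟶ Over.map (a ≫ b) ⋙ T.toMonad.toFunctor :=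
  Functor.whiskerLeft T''.toMonad.toFunctor (Over.mapComp a b).hom ≫
    (Functor.associator _ _ _).inv ≫ Functor.whiskerRight ψ (Over.map b) ≫
    (Functor.associator _ _ _).hom ≫ Functor.whiskerLeft (Over.map a) φ ≫
    (Functor.associator _ _ _).inv ≫
    Functor.whiskerRight (Over.mapComp a b).inv T.toMonad.toFunctor

@[simp]
lemma compTrans_app {K : E} {T'' : PolynomialMonad I} {T' : PolynomialMonad J}
    {T : PolynomialMonad K} {a : I ⟶ J} {b : J ⟶ K}
    (ψ : T''.toMonad.toFunctor ⋙ Over.map a ⟶ Over.map a ⋙ T'.toMonad.toFunctor)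
    (φ : T'.toMonad.toFunctor ⋙ Over.map b ⟶ Over.map b ⋙ T.toMonad.toFunctor) (X : Over I) :
    (compTrans ψ φ).app X = (Over.mapComp a b).hom.app (T''.toMonad.obj X) ≫
      (Over.map b).map (ψ.app X) ≫ φ.app ((Over.map a).obj X) ≫
        T.toMonad.map ((Over.mapComp a b).inv.app X) := by
  simp only [compTrans, NatTrans.comp_app, Functor.whiskerLeft_app, Functor.whiskerRight_app,
    Functor.associator_hom_app, Functor.associator_inv_app]
  erw [Category.id_comp, Category.id_comp, Category.id_comp]

lemma compTrans_cartesian {K : E} {T'' : PolynomialMonad I} {T' : PolynomialMonad J}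
    {T : PolynomialMonad K} {a : I ⟶ J} {b : J ⟶ K}
    {ψ : T''.toMonad.toFunctor ⋙ Over.map a ⟶ Over.map a ⋙ T'.toMonad.toFunctor}
    {φ : T'.toMonad.toFunctor ⋙ Over.map b ⟶ Over.map b ⋙ T.toMonad.toFunctor}
    (hψ : IsCartesian ψ) (hφ : IsCartesian φ) : IsCartesian (compTrans ψ φ) := by
  refine NatTrans.Equifibered.comp (.of_isIso _) (.comp (.of_isIso _) (.comp ?_
    (.comp (.of_isIso _) (.comp ?_ (.comp (.of_isIso _) (.of_isIso _))))))
  · exact hψ.whiskerRight _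
  · exact hφ.whiskerLeft _

/-- The composite of `(v, ψ)` and `(u, φ)`. -/
def Hom.comp {T'' T' T : PolyMnd E} (ψ : Hom T'' T') (φ : Hom T' T) : Hom T'' T where
  base := ψ.base ≫ φ.base
  trans := compTrans ψ.trans φ.trans
  cartesian := compTrans_cartesian ψ.cartesian φ.cartesian
  strong := (IsStrong.whiskerLeft _ (.mapComp _ _)).comp <| (IsStrong.assoc_inv _ _ _).comp <|
    (IsStrong.whiskerRight ψ.strong _).comp <| (IsStrong.assoc _ _ _).comp <|
    (IsStrong.whiskerLeft _ φ.strong).comp <| (IsStrong.assoc_inv _ _ _).comp <|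
    IsStrong.whiskerRight (.mapComp_inv _ _) _
  unit X := by
    have h := (Over.mapComp ψ.base φ.base).hom.naturality (T''.monad.toMonad.η.app X)
    have h2 := T.monad.toMonad.η.naturality ((Over.mapComp ψ.base φ.base).inv.app X)
    have h3 := φ.unit ((Over.map ψ.base).obj X)
    have h4 := congrArg (Over.map φ.base).map (ψ.unit X)
    dsimp only [Functor.id_obj, Functor.id_map, Functor.comp_obj, Functor.comp_map] at h h2
    rw [Functor.map_comp] at h4
    rw [compTrans_app, reassoc_of% h, reassoc_of% h4, reassoc_of% h3, ← h2,
      Iso.hom_inv_id_app_assoc]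
  mult X := by
    have h := (Over.mapComp ψ.base φ.base).hom.naturality (T''.monad.toMonad.μ.app X)
    have h2 := T.monad.toMonad.μ.naturality ((Over.mapComp ψ.base φ.base).inv.app X)
    have h3 := φ.mult ((Over.map ψ.base).obj X)
    have h4 := congrArg (Over.map φ.base).map (ψ.mult X)
    have h5 := φ.trans.naturality (ψ.trans.app X)
    dsimp only [Functor.id_obj, Functor.id_map, Functor.comp_obj, Functor.comp_map] at h h2 h5
    simp only [Functor.map_comp] at h4
    rw [compTrans_app, reassoc_of% h, reassoc_of% h4, reassoc_of% h3, ← h2, reassoc_of% h5,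
      compTrans_app]
    simp only [Category.assoc, Functor.map_comp]
    have h6 : T.monad.toMonad.map ((Over.mapComp ψ.base φ.base).inv.app (T''.monad.toMonad.obj X)) ≫
        T.monad.toMonad.map ((Over.mapComp ψ.base φ.base).hom.app (T''.monad.toMonad.obj X)) =
          𝟙 _ := by
      rw [← Functor.map_comp, Iso.inv_hom_id_app]
      exact CategoryTheory.Functor.map_id _ _
    rw [reassoc_of% h6]

lemma Hom.ext' {T' T : PolyMnd E} {φ ψ : Hom T' T} (h : φ.base = ψ.base)
    (h' : ∀ X, φ.trans.app X ≫ T.monad.toMonad.map ((Over.mapCongr _ _ h).hom.app X) =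
      (Over.mapCongr _ _ h).hom.app _ ≫ ψ.trans.app X) : φ = ψ := by
  obtain ⟨u, φ, _, _, _, _⟩ := φ
  obtain ⟨u', ψ, _, _, _, _⟩ := ψ
  dsimp only at h
  subst h
  obtain rfl : φ = ψ := by
    ext1
    funext X
    have h2 := h' X
    simp only [Over.mapCongr_rfl, Iso.refl_hom, NatTrans.id_app] at h2
    erw [CategoryTheory.Functor.map_id, Category.comp_id, Category.id_comp] at h2
    exact h2
  rfl

instance : Category (PolyMnd E) where
  Hom := Hom
  id T := Hom.ofFibre (𝟙 T.monad)
  comp := Hom.comp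
  id_comp {T' T} φ := by
    refine Hom.ext' (Category.id_comp _) fun X => ?_
    have h := φ.trans.naturality ((Over.mapId T'.base).inv.app X)
    dsimp only [Functor.id_obj, Functor.id_map, Functor.comp_obj, Functor.comp_map] at h
    simp only [Hom.comp, Hom.ofFibre, compTrans_app, fibreTrans_id_app,
      Functor.map_comp, Category.assoc]
    have e1 : (Over.mapComp (𝟙 T'.base) φ.base).hom.app (T'.monad.toMonad.obj X) ≫
        (Over.map φ.base).map ((Over.mapId T'.base).hom.app (T'.monad.toMonad.obj X)) =
        (Over.mapCongr (𝟙 T'.base ≫ φ.base) φ.base (Category.id_comp _)).hom.app _ := by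
      ext; simp
    have e2 : (Over.map φ.base).map ((Over.mapId T'.base).inv.app X) ≫
        (Over.mapComp (𝟙 T'.base) φ.base).inv.app X ≫
        (Over.mapCongr (𝟙 T'.base ≫ φ.base) φ.base (Category.id_comp _)).hom.app X = 𝟙 _ := by
      ext; simp
    rw [reassoc_of% h, ← Functor.map_comp, ← Functor.map_comp, e2, reassoc_of% e1]
    erw [CategoryTheory.Functor.map_id]
    exact congrArg _ (Category.comp_id _)
  comp_id {T' T} φ := by
    refine Hom.ext' (Category.comp_id _) fun X => ?_
    have h := (Over.mapId T.base).hom.naturality (φ.trans.app X)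
    dsimp only [Functor.id_obj, Functor.id_map, Functor.comp_obj, Functor.comp_map] at h
    simp only [Hom.comp, Hom.ofFibre, compTrans_app, fibreTrans_id_app,
      Category.assoc]
    have e1 : (Over.mapComp φ.base (𝟙 T.base)).hom.app (T'.monad.toMonad.obj X) ≫
        (Over.mapId T.base).hom.app ((Over.map φ.base).obj (T'.monad.toMonad.obj X)) =
        (Over.mapCongr (φ.base ≫ 𝟙 T.base) φ.base (Category.comp_id _)).hom.app _ := by
      ext; simp
    have e2 : (Over.mapId T.base).inv.app ((Over.map φ.base).obj X) ≫
        (Over.mapComp φ.base (𝟙 T.base)).inv.app X ≫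
        (Over.mapCongr (φ.base ≫ 𝟙 T.base) φ.base (Category.comp_id _)).hom.app X = 𝟙 _ := by
      ext; simp
    rw [reassoc_of% h, ← Functor.map_comp, ← Functor.map_comp, e2, reassoc_of% e1]
    erw [CategoryTheory.Functor.map_id]
    exact congrArg _ (Category.comp_id _)
  assoc {T₃ T₂ T₁ T₀} χ ψ φ := by
    refine Hom.ext' (Category.assoc _ _ _) fun X => ?_
    have h := φ.trans.naturality ((Over.mapComp χ.base ψ.base).inv.app X)
    have h2 := (Over.mapComp ψ.base φ.base).hom.naturality (χ.trans.app X)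
    dsimp only [Functor.id_obj, Functor.id_map, Functor.comp_obj, Functor.comp_map] at h h2
    simp only [Hom.comp, compTrans_app, Functor.map_comp, Category.assoc]
    have e1 : (Over.mapComp (χ.base ≫ ψ.base) φ.base).hom.app (T₃.monad.toMonad.obj X) ≫
        (Over.map φ.base).map ((Over.mapComp χ.base ψ.base).hom.app (T₃.monad.toMonad.obj X)) =
        (Over.mapCongr _ _ (Category.assoc χ.base ψ.base φ.base)).hom.app _ ≫
        (Over.mapComp χ.base (ψ.base ≫ φ.base)).hom.app (T₃.monad.toMonad.obj X) ≫
        (Over.mapComp ψ.base φ.base).hom.app _ := by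
      ext; simp
    have e2 : (Over.map φ.base).map ((Over.mapComp χ.base ψ.base).inv.app X) ≫
        (Over.mapComp (χ.base ≫ ψ.base) φ.base).inv.app X ≫
        (Over.mapCongr _ _ (Category.assoc χ.base ψ.base φ.base)).hom.app _ =
        (Over.mapComp ψ.base φ.base).inv.app _ ≫
        (Over.mapComp χ.base (ψ.base ≫ φ.base)).inv.app X := by
      ext; simp
    rw [reassoc_of% h, ← Functor.map_comp, ← Functor.map_comp, e2, reassoc_of% h2,
      reassoc_of% e1, Functor.map_comp]

/-- The inclusion of the fibre over `I` into the category of all polynomial monads. -/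
def fibreInclusion (I : E) : PolynomialMonad I ⥤ PolyMnd E where
  obj T := ⟨I, T⟩
  map φ := Hom.ofFibre φ
  map_id _ := rfl
  map_comp {T'' T' T} ψ φ := by
    refine Hom.ext' (Category.comp_id (𝟙 I)).symm fun X => ?_
    have h := (Over.mapId I).hom.naturality ((fibreTrans ψ.hom.toNatTrans).app X)
    have h2 := φ.hom.naturality ((Over.mapId I).inv.app X)
    dsimp only [Functor.id_obj, Functor.id_map, Functor.comp_obj, Functor.comp_map] at h h2
    have e1 : (Over.mapId I).hom.app (T''.toMonad.obj X) =
        (Over.mapCongr _ _ (Category.comp_id (𝟙 I)).symm).hom.app _ ≫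
        (Over.mapComp (𝟙 I) (𝟙 I)).hom.app (T''.toMonad.obj X) ≫
        (Over.mapId I).hom.app _ ≫ (Over.mapId I).hom.app _ := by
      ext; simp
    have e2 : (Over.mapId I).inv.app X ≫
        (Over.mapCongr _ _ (Category.comp_id (𝟙 I)).symm).hom.app _ =
        (Over.mapId I).inv.app X ≫ (Over.mapId I).inv.app ((Over.map (𝟙 I)).obj X) ≫
        (Over.mapComp (𝟙 I) (𝟙 I)).inv.app X := by
      ext; simp
    change (fibreTrans (ψ ≫ φ).hom.toNatTrans).app X ≫ T.toMonad.map
      ((Over.mapCongr (𝟙 I) (𝟙 I ≫ 𝟙 I) _).hom.app X) =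
      (Over.mapCongr (𝟙 I) (𝟙 I ≫ 𝟙 I) _).hom.app (T''.toMonad.obj X) ≫
      (compTrans (fibreTrans ψ.hom.toNatTrans) (fibreTrans φ.hom.toNatTrans)).app X
    rw [compTrans_app, fibreTrans_app φ.hom.toNatTrans]
    simp only [Category.assoc]
    rw [reassoc_of% h, fibreTrans_app, fibreTrans_app]
    simp only [Category.assoc]
    rw [reassoc_of% h2, ← Functor.map_comp, e2, PolynomialMonad.comp_app]
    nth_rw 1 [e1]
    simp only [Category.assoc, Functor.map_comp]

end PolyMnd

end PolynomialMonads

section Multicategories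

/-- The data of a multicategory relative to a monad `T`: an endospan `T C ← N → C`, a unit
`C ⟶ N` and a multiplication `N ∘ N ⟶ N`. The composite span `N ∘ N` is `T N ×_{T C} N`. -/
structure PMulticatData {𝒞 : Type u} [Category.{v} 𝒞] [HasPullbacks 𝒞] (T : Monad 𝒞) where
  obj : 𝒞
  arr : 𝒞
  dom : arr ⟶ T.obj obj
  cod : arr ⟶ obj
  unit : obj ⟶ arr
  mult : pullback (T.map cod) dom ⟶ arr

namespace PMulticatData

variable {𝒞 : Type u} [Category.{v} 𝒞] [HasPullbacks 𝒞] {T : Monad 𝒞}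

/-- The map `N ∘ N ⟶ N' ∘ N'` induced by a morphism of endospans. -/
noncomputable abbrev compMap (X Y : PMulticatData T) (fobj : X.obj ⟶ Y.obj) (farr : X.arr ⟶ Y.arr)
    (hdom : X.dom ≫ T.map fobj = farr ≫ Y.dom) (hcod : X.cod ≫ fobj = farr ≫ Y.cod) :
    pullback (T.map X.cod) X.dom ⟶ pullback (T.map Y.cod) Y.dom :=
  pullback.map _ _ _ _ (T.map farr) farr (T.map fobj)
    (by rw [← T.map_comp, ← T.map_comp, hcod]) hdom

lemma compMap_fst (X Y : PMulticatData T) (fobj : X.obj ⟶ Y.obj) (farr : X.arr ⟶ Y.arr)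
    (hdom : X.dom ≫ T.map fobj = farr ≫ Y.dom) (hcod : X.cod ≫ fobj = farr ≫ Y.cod) :
    compMap X Y fobj farr hdom hcod ≫ pullback.fst (T.map Y.cod) Y.dom =
      pullback.fst (T.map X.cod) X.dom ≫ T.map farr := pullback.lift_fst _ _ _

lemma compMap_snd (X Y : PMulticatData T) (fobj : X.obj ⟶ Y.obj) (farr : X.arr ⟶ Y.arr)
    (hdom : X.dom ≫ T.map fobj = farr ≫ Y.dom) (hcod : X.cod ≫ fobj = farr ≫ Y.cod) :
    compMap X Y fobj farr hdom hcod ≫ pullback.snd (T.map Y.cod) Y.dom =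
      pullback.snd (T.map X.cod) X.dom ≫ farr := pullback.lift_snd _ _ _

lemma mult_of_iso {X Y : PMulticatData T} (fobj : X.obj ⟶ Y.obj) (farr : X.arr ⟶ Y.arr)
    (hdom : X.dom ≫ T.map fobj = farr ≫ Y.dom) (hcod : X.cod ≫ fobj = farr ≫ Y.cod) {A B : 𝒞}
    (iX : A ≅ pullback (T.map X.cod) X.dom) (iY : B ≅ pullback (T.map Y.cod) Y.dom)
    {pX : A ⟶ T.obj X.arr} {qX : A ⟶ X.arr} {pY : B ⟶ T.obj Y.arr} {qY : B ⟶ Y.arr}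
    (hpX : iX.hom ≫ pullback.fst _ _ = pX) (hqX : iX.hom ≫ pullback.snd _ _ = qX)
    (hpY : iY.hom ≫ pullback.fst _ _ = pY) (hqY : iY.hom ≫ pullback.snd _ _ = qY)
    {mX : A ⟶ X.arr} {mY : B ⟶ Y.arr} (hX : X.mult = iX.inv ≫ mX) (hY : Y.mult = iY.inv ≫ mY)
    (g : A ⟶ B) (h₁ : g ≫ pY = pX ≫ T.map farr) (h₂ : g ≫ qY = qX ≫ farr)
    (h₃ : mX ≫ farr = g ≫ mY) :
    X.mult ≫ farr = compMap X Y fobj farr hdom hcod ≫ Y.mult := by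
  have h : iX.hom ≫ compMap X Y fobj farr hdom hcod = g ≫ iY.hom := by
    apply pullback.hom_ext
    · rw [Category.assoc, compMap_fst, Category.assoc, hpY, h₁, ← hpX, Category.assoc]
    · rw [Category.assoc, compMap_snd, Category.assoc, hqY, h₂, ← hqX, Category.assoc]
  rw [hX, hY, Category.assoc, Iso.inv_comp_eq, reassoc_of% h, h₃, Iso.hom_inv_id_assoc]

/-- Morphisms: morphisms of endospans which preserve the unit and the multiplication. -/
@[ext]
structure Hom (X Y : PMulticatData T) where
  obj : X.obj ⟶ Y.obj
  arr : X.arr ⟶ Y.arr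
  dom : X.dom ≫ T.map obj = arr ≫ Y.dom
  cod : X.cod ≫ obj = arr ≫ Y.cod
  unit : X.unit ≫ arr = obj ≫ Y.unit
  mult : X.mult ≫ arr = compMap X Y obj arr dom cod ≫ Y.mult

/-- Replacing the components of a morphism by equal ones. -/
def Hom.copy {X Y : PMulticatData T} (f : Hom X Y) (o : X.obj ⟶ Y.obj) (a : X.arr ⟶ Y.arr)
    (ho : o = f.obj) (ha : a = f.arr) : Hom X Y where
  obj := o
  arr := a
  dom := by subst ho ha; exact f.dom
  cod := by subst ho ha; exact f.cod
  unit := by subst ho ha; exact f.unit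
  mult := by subst ho ha; exact f.mult

noncomputable instance : Category (PMulticatData T) where
  Hom := Hom
  id X :=
    { obj := 𝟙 _
      arr := 𝟙 _
      dom := by simp
      cod := by simp
      unit := by simp
      mult := by
        have : compMap X X (𝟙 _) (𝟙 _) (by simp) (by simp) = 𝟙 _ := by
          apply pullback.hom_ext
          · rw [compMap_fst, T.map_id, Category.comp_id, Category.id_comp]
          · rw [compMap_snd, Category.comp_id, Category.id_comp]
        rw [this, Category.id_comp, Category.comp_id] }
  comp {X Y Z} f g :=
    { obj := f.obj ≫ g.obj
      arr := f.arr ≫ g.arr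
      dom := by rw [T.map_comp, reassoc_of% f.dom, g.dom, Category.assoc]
      cod := by rw [reassoc_of% f.cod, g.cod, Category.assoc]
      unit := by rw [reassoc_of% f.unit, g.unit, Category.assoc]
      mult := by
        rw [reassoc_of% f.mult, g.mult, ← Category.assoc]
        congr 1
        apply pullback.hom_ext
        · rw [Category.assoc, compMap_fst, compMap_fst, reassoc_of% compMap_fst, T.map_comp]
        · rw [Category.assoc, compMap_snd, compMap_snd, reassoc_of% compMap_snd] }
  id_comp _ := Hom.ext (Category.id_comp _) (Category.id_comp _)
  comp_id _ := Hom.ext (Category.comp_id _) (Category.comp_id _)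
  assoc _ _ _ := Hom.ext (Category.assoc _ _ _) (Category.assoc _ _ _)

end PMulticatData

variable {𝒞 : Type u} [Category.{v} 𝒞] [HasPullbacks 𝒞] {T : Monad 𝒞}

/-- The axioms of a multicategory relative to `T`, that is, of a monad in the bicategory of
`T`-spans: the unit and the multiplication are maps of spans (the legs of the identity span being
`η : C ⟶ T C` and `𝟙`, those of `N ∘ N` being `T N ×_{T C} N ⟶ T N ⟶ T T C ⟶ T C` and
`T N ×_{T C} N ⟶ N ⟶ C`), and they satisfy the unit laws and the associativity law. The latter is
formulated on the triple composite `T (T N ×_{T C} N) ×_{T C} N`. -/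
structure IsPMulticategory (X : PMulticatData T) : Prop where
  unit_dom : X.unit ≫ X.dom = T.η.app X.obj
  unit_cod : X.unit ≫ X.cod = 𝟙 X.obj
  mult_dom : X.mult ≫ X.dom =
    pullback.fst (T.map X.cod) X.dom ≫ T.map X.dom ≫ T.μ.app X.obj
  mult_cod : X.mult ≫ X.cod = pullback.snd (T.map X.cod) X.dom ≫ X.cod
  mult_unit : pullback.lift (T.η.app X.arr) (X.cod ≫ X.unit)
      (by
        rw [Category.assoc, unit_dom]
        exact (T.η.naturality X.cod).symm) ≫ X.mult = 𝟙 X.arr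
  unit_mult : pullback.lift (X.dom ≫ T.map X.unit) (𝟙 X.arr)
      (by rw [Category.assoc, ← T.map_comp, unit_cod, T.map_id, Category.comp_id,
        Category.id_comp]) ≫ X.mult = 𝟙 X.arr
  mult_assoc :
    pullback.lift
      (pullback.fst (T.map (pullback.snd (T.map X.cod) X.dom ≫ X.cod)) X.dom ≫ T.map X.mult)
      (pullback.snd (T.map (pullback.snd (T.map X.cod) X.dom ≫ X.cod)) X.dom)
      (by rw [Category.assoc, ← T.map_comp, mult_cod, pullback.condition]) ≫ X.mult =
    pullback.lift
      (pullback.fst (T.map (pullback.snd (T.map X.cod) X.dom ≫ X.cod)) X.dom ≫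
        T.map (pullback.fst (T.map X.cod) X.dom) ≫ T.μ.app X.arr)
      (pullback.lift
        (pullback.fst (T.map (pullback.snd (T.map X.cod) X.dom ≫ X.cod)) X.dom ≫
          T.map (pullback.snd (T.map X.cod) X.dom))
        (pullback.snd (T.map (pullback.snd (T.map X.cod) X.dom ≫ X.cod)) X.dom)
        (by rw [Category.assoc, ← T.map_comp, pullback.condition]) ≫ X.mult)
      (by
        have h := T.μ.naturality X.cod
        dsimp only [Functor.comp_map] at h
        rw [Category.assoc, Category.assoc, Category.assoc, ← h, mult_dom,
          pullback.lift_fst_assoc, ← T.map_comp_assoc, pullback.condition,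
          T.map_comp (pullback.snd (T.map X.cod) X.dom) X.dom, Category.assoc,
          Category.assoc]) ≫ X.mult

/-- The category of multicategories relative to `T`. -/
abbrev PMulticat (T : Monad 𝒞) : Type _ :=
  ObjectProperty.FullSubcategory (fun X : PMulticatData T => IsPMulticategory X)

/-- The category of operads relative to `T`: multicategories whose object of objects is
terminal. -/
abbrev POperad (T : Monad 𝒞) : Type _ :=
  ObjectProperty.FullSubcategory
    (fun X : PMulticatData T => IsPMulticategory X ∧ Nonempty (IsTerminal X.obj))

/-- The underlying data of a multicategory. -/
noncomputable abbrev PMulticat.toData (T : Monad 𝒞) : PMulticat T ⥤ PMulticatData T :=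
  ObjectProperty.ι _

/-- The underlying data of an operad. -/
noncomputable abbrev POperad.toData (T : Monad 𝒞) : POperad T ⥤ PMulticatData T :=
  ObjectProperty.ι _

end Multicategories

section Comparison

variable {E : Type u} [Category.{v} E] [CartesianMonoidalCategory E] [HasPullbacks E]
  [LocallyCartesianClosed E]

/-- The terminal object `𝟙 : I ⟶ I` of the slice over `I`. -/
abbrev overOne (I : E) : Over I := Over.mk (𝟙 I)

/-- The unique map to the terminal object of a slice. -/
abbrev toOne {I : E} (X : Over I) : X ⟶ overOne I := Over.homMk X.hom

/-- For a morphism `(u, φ) : T ⟶ P` of polynomial monads, the isomorphism between `∑ᵤ T T 1` and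
`P (∑ᵤ T 1) ×_{P (∑ᵤ 1)} ∑ᵤ T 1` which expresses that `φ` is cartesian at `T 1 ⟶ 1`. -/
noncomputable def multIso {T P : PolyMnd E} (φ : PolyMnd.Hom T P) :
    (Over.map φ.base).obj (T.monad.toMonad.obj (T.monad.toMonad.obj (overOne T.base))) ≅
      pullback
        (P.monad.toMonad.map ((Over.map φ.base).map (toOne (T.monad.toMonad.obj (overOne T.base)))))
        (φ.trans.app (overOne T.base)) :=
  (φ.cartesian (toOne (T.monad.toMonad.obj (overOne T.base)))).flip.isoPullback

lemma multIso_hom_fst {T P : PolyMnd E} (φ : PolyMnd.Hom T P) :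
    (multIso φ).hom ≫ pullback.fst _ _ =
      φ.trans.app (T.monad.toMonad.obj (overOne T.base)) :=
  IsPullback.isoPullback_hom_fst _

lemma multIso_hom_snd {T P : PolyMnd E} (φ : PolyMnd.Hom T P) :
    (multIso φ).hom ≫ pullback.snd _ _ =
      (Over.map φ.base).map (T.monad.toMonad.map (toOne (T.monad.toMonad.obj (overOne T.base)))) :=
  IsPullback.isoPullback_hom_snd _

/-- The endospan `P (∑ᵤ 1) ← ∑ᵤ T 1 → ∑ᵤ 1` determined by a morphism `(u, φ) : T ⟶ P` of polynomial
monads, whose left leg is the component of `φ` at the terminal object `1` of the slice over the base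
of `T`, with the unit and the multiplication induced by those of `T`. The multiplication uses that
`φ` is cartesian, so that the composite span `P (∑ᵤ T 1) ×_{P (∑ᵤ 1)} ∑ᵤ T 1` is `∑ᵤ T T 1`. -/
noncomputable def multicatObj {T P : PolyMnd E} (φ : PolyMnd.Hom T P) :
    PMulticatData P.monad.toMonad where
  obj := (Over.map φ.base).obj (overOne T.base)
  arr := (Over.map φ.base).obj (T.monad.toMonad.obj (overOne T.base))
  dom := φ.trans.app (overOne T.base)
  cod := (Over.map φ.base).map (toOne _)
  unit := (Over.map φ.base).map (T.monad.toMonad.η.app (overOne T.base))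
  mult := (multIso φ).inv ≫ (Over.map φ.base).map (T.monad.toMonad.μ.app (overOne T.base))

/-- The map `∑ᵥ T' 1 ⟶ T ∑ᵥ 1 ⟶ T 1` determined by a morphism `(v, ψ) : T' ⟶ T`. -/
noncomputable def oneMap {T' T : PolyMnd E} (ψ : PolyMnd.Hom T' T) :
    (Over.map ψ.base).obj (T'.monad.toMonad.obj (overOne T'.base)) ⟶
      T.monad.toMonad.obj (overOne T.base) :=
  ψ.trans.app (overOne T'.base) ≫ T.monad.toMonad.map (toOne _)

lemma oneMap_w {T' T : PolyMnd E} (ψ : PolyMnd.Hom T' T) :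
    (oneMap ψ).left ≫ (T.monad.toMonad.obj (overOne T.base)).hom =
      (T'.monad.toMonad.obj (overOne T'.base)).hom ≫ ψ.base :=
  Over.w (oneMap ψ)

/-- The map `∑ᵤ ∑ᵥ T' 1 ⟶ ∑ᵤ T 1` given by `oneMap ψ`. -/
noncomputable abbrev multicatMapArr {T' T P : PolyMnd E} (ψ : PolyMnd.Hom T' T)
    (φ : PolyMnd.Hom T P) :
    (Over.map (ψ.base ≫ φ.base)).obj (T'.monad.toMonad.obj (overOne T'.base)) ⟶
      (Over.map φ.base).obj (T.monad.toMonad.obj (overOne T.base)) :=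
  (Over.mapComp ψ.base φ.base).hom.app (T'.monad.toMonad.obj (overOne T'.base)) ≫
    (Over.map φ.base).map (oneMap ψ)

lemma multicatMap_dom {T' T P : PolyMnd E} (ψ : PolyMnd.Hom T' T)
    (φ : PolyMnd.Hom T P) :
    (PolyMnd.compTrans ψ.trans φ.trans).app (overOne T'.base) ≫
      P.monad.toMonad.map ((Over.mapComp ψ.base φ.base).hom.app (overOne T'.base) ≫
        (Over.map φ.base).map (toOne ((Over.map ψ.base).obj (overOne T'.base)))) =
    multicatMapArr ψ φ ≫ φ.trans.app (overOne T.base) := by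
  have h := φ.trans.naturality (toOne ((Over.map ψ.base).obj (overOne T'.base)))
  dsimp only [Functor.comp_map, Functor.comp_obj] at h
  dsimp only [multicatMapArr, oneMap]
  rw [PolyMnd.compTrans_app, Functor.map_comp, Functor.map_comp]
  simp only [Category.assoc]
  rw [h, ← P.monad.toMonad.map_comp_assoc, Iso.inv_hom_id_app]
  erw [P.monad.toMonad.map_id, Category.id_comp]

lemma multicatMap_unit {T' T P : PolyMnd E} (ψ : PolyMnd.Hom T' T)
    (φ : PolyMnd.Hom T P) :
    (Over.map (ψ.base ≫ φ.base)).map (T'.monad.toMonad.η.app (overOne T'.base)) ≫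
      multicatMapArr ψ φ =
    ((Over.mapComp ψ.base φ.base).hom.app (overOne T'.base) ≫
      (Over.map φ.base).map (toOne ((Over.map ψ.base).obj (overOne T'.base)))) ≫
      (Over.map φ.base).map (T.monad.toMonad.η.app (overOne T.base)) := by
  have h := (Over.mapComp ψ.base φ.base).hom.naturality
    (T'.monad.toMonad.η.app (overOne T'.base))
  have h2 := T.monad.toMonad.η.naturality (toOne ((Over.map ψ.base).obj (overOne T'.base)))
  dsimp only [Functor.comp_map, Functor.comp_obj, Functor.id_map, Functor.id_obj] at h h2
  dsimp only [multicatMapArr, oneMap]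
  rw [reassoc_of% h, Category.assoc, ← Functor.map_comp, ← Functor.map_comp, h2,
    reassoc_of% ψ.unit]

lemma multicatMap_mult {T' T P : PolyMnd E} (ψ : PolyMnd.Hom T' T)
    (φ : PolyMnd.Hom T P) :
    (Over.map (ψ.base ≫ φ.base)).map (T'.monad.toMonad.μ.app (overOne T'.base)) ≫
      multicatMapArr ψ φ =
    ((Over.mapComp ψ.base φ.base).hom.app _ ≫ (Over.map φ.base).map
      (ψ.trans.app (T'.monad.toMonad.obj (overOne T'.base)) ≫ T.monad.toMonad.map (oneMap ψ))) ≫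
      (Over.map φ.base).map (T.monad.toMonad.μ.app (overOne T.base)) := by
  have h := (Over.mapComp ψ.base φ.base).hom.naturality
    (T'.monad.toMonad.μ.app (overOne T'.base))
  have h2 := T.monad.toMonad.μ.naturality (toOne ((Over.map ψ.base).obj (overOne T'.base)))
  dsimp only [Functor.comp_map, Functor.comp_obj, Functor.id_map, Functor.id_obj] at h h2
  dsimp only [multicatMapArr, oneMap]
  rw [reassoc_of% h, Category.assoc, ← Functor.map_comp, ← Functor.map_comp, reassoc_of% ψ.mult,
    Category.assoc, T.monad.toMonad.map_comp, Category.assoc, h2]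

lemma multicatMap_fst {T' T P : PolyMnd E} (ψ : PolyMnd.Hom T' T)
    (φ : PolyMnd.Hom T P) :
    (PolyMnd.compTrans ψ.trans φ.trans).app (T'.monad.toMonad.obj (overOne T'.base)) ≫
      P.monad.toMonad.map (multicatMapArr ψ φ) =
    ((Over.mapComp ψ.base φ.base).hom.app _ ≫ (Over.map φ.base).map
      (ψ.trans.app (T'.monad.toMonad.obj (overOne T'.base)) ≫ T.monad.toMonad.map (oneMap ψ))) ≫
      φ.trans.app (T.monad.toMonad.obj (overOne T.base)) := by
  have h := φ.trans.naturality (oneMap ψ)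
  dsimp only [Functor.comp_map, Functor.comp_obj] at h
  dsimp only [multicatMapArr]
  rw [PolyMnd.compTrans_app, Functor.map_comp, Functor.map_comp]
  simp only [Category.assoc]
  rw [h, ← P.monad.toMonad.map_comp_assoc, Iso.inv_hom_id_app]
  erw [P.monad.toMonad.map_id, Category.id_comp]

lemma multicatMap_snd {T' T P : PolyMnd E} (ψ : PolyMnd.Hom T' T)
    (φ : PolyMnd.Hom T P) :
    (Over.map (ψ.base ≫ φ.base)).map
      (T'.monad.toMonad.map (toOne (T'.monad.toMonad.obj (overOne T'.base)))) ≫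
      multicatMapArr ψ φ =
    ((Over.mapComp ψ.base φ.base).hom.app _ ≫ (Over.map φ.base).map
      (ψ.trans.app (T'.monad.toMonad.obj (overOne T'.base)) ≫ T.monad.toMonad.map (oneMap ψ))) ≫
      (Over.map φ.base).map
        (T.monad.toMonad.map (toOne (T.monad.toMonad.obj (overOne T.base)))) := by
  have h := (Over.mapComp ψ.base φ.base).hom.naturality
    (T'.monad.toMonad.map (toOne (T'.monad.toMonad.obj (overOne T'.base))))
  have h2 := ψ.trans.naturality (toOne (T'.monad.toMonad.obj (overOne T'.base)))
  have h3 : (Over.map ψ.base).map (toOne (T'.monad.toMonad.obj (overOne T'.base))) ≫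
      toOne ((Over.map ψ.base).obj (overOne T'.base)) = oneMap ψ ≫ toOne _ := by
    ext
    simpa [-Over.w] using (oneMap_w ψ).symm
  dsimp only [Functor.comp_map, Functor.comp_obj, Functor.id_map, Functor.id_obj] at h h2
  dsimp only [multicatMapArr, oneMap]
  rw [reassoc_of% h, Category.assoc, ← Functor.map_comp, ← Functor.map_comp, reassoc_of% h2,
    Category.assoc, ← T.monad.toMonad.map_comp, h3, T.monad.toMonad.map_comp]
  rfl

/-- The morphism of endospans `multicatObj (ψ ≫ φ) ⟶ multicatObj φ` determined by a morphism
`ψ : T' ⟶ T` and a morphism `φ : T ⟶ P`. -/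
noncomputable def multicatMapComp {T' T P : PolyMnd E} (ψ : PolyMnd.Hom T' T)
    (φ : PolyMnd.Hom T P) : PMulticatData.Hom (multicatObj (ψ.comp φ)) (multicatObj φ) where
  obj := (Over.mapComp ψ.base φ.base).hom.app (overOne T'.base) ≫
    (Over.map φ.base).map (toOne ((Over.map ψ.base).obj (overOne T'.base)))
  arr := multicatMapArr ψ φ
  dom := multicatMap_dom ψ φ
  cod := by
    ext
    simpa [multicatObj, PolyMnd.Hom.comp, -Over.w] using (oneMap_w ψ).symm
  unit := multicatMap_unit ψ φ
  mult := by
    exact PMulticatData.mult_of_iso (X := multicatObj (ψ.comp φ)) (Y := multicatObj φ) _ _ _ _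
      (multIso (ψ.comp φ)) (multIso φ) (multIso_hom_fst (ψ.comp φ)) (multIso_hom_snd (ψ.comp φ))
      (multIso_hom_fst φ) (multIso_hom_snd φ) rfl rfl _ (multicatMap_fst ψ φ).symm
      (multicatMap_snd ψ φ).symm (multicatMap_mult ψ φ)

lemma multicatMap_obj_eq {T' T P : PolyMnd E} (ψ : PolyMnd.Hom T' T) (φ : PolyMnd.Hom T P)
    (h : ψ.base ≫ ((Over.map φ.base).obj (overOne T.base)).hom =
      ((Over.map (ψ.base ≫ φ.base)).obj (overOne T'.base)).hom) :
    Over.homMk (U := (Over.map (ψ.base ≫ φ.base)).obj (overOne T'.base))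
      (V := (Over.map φ.base).obj (overOne T.base)) ψ.base h = (multicatMapComp ψ φ).obj :=
  Over.OverMorphism.ext ((Category.id_comp ψ.base).symm.trans (Category.id_comp _).symm)

lemma multicatMap_arr_eq {T' T P : PolyMnd E} (ψ : PolyMnd.Hom T' T) (φ : PolyMnd.Hom T P)
    (h : (oneMap ψ).left ≫
      ((Over.map φ.base).obj (T.monad.toMonad.obj (overOne T.base))).hom =
      ((Over.map (ψ.base ≫ φ.base)).obj (T'.monad.toMonad.obj (overOne T'.base))).hom) :
    Over.homMk (U := (Over.map (ψ.base ≫ φ.base)).obj (T'.monad.toMonad.obj (overOne T'.base)))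
      (V := (Over.map φ.base).obj (T.monad.toMonad.obj (overOne T.base))) (oneMap ψ).left h =
      (multicatMapComp ψ φ).arr :=
  Over.OverMorphism.ext (Category.id_comp (oneMap ψ).left).symm

lemma multicatMap_obj_w {T' T P : PolyMnd E} (ψ : PolyMnd.Hom T' T) (φ : PolyMnd.Hom T P)
    (φ' : PolyMnd.Hom T' P) (h : ψ.comp φ = φ') :
    ψ.base ≫ ((Over.map φ.base).obj (overOne T.base)).hom =
      ((Over.map φ'.base).obj (overOne T'.base)).hom := by
  subst h; simp [PolyMnd.Hom.comp]

lemma multicatMap_arr_w {T' T P : PolyMnd E} (ψ : PolyMnd.Hom T' T) (φ : PolyMnd.Hom T P)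
    (φ' : PolyMnd.Hom T' P) (h : ψ.comp φ = φ') :
    (oneMap ψ).left ≫ ((Over.map φ.base).obj (T.monad.toMonad.obj (overOne T.base))).hom =
      ((Over.map φ'.base).obj (T'.monad.toMonad.obj (overOne T'.base))).hom := by
  subst h
  have := oneMap_w ψ
  simp only [PolyMnd.Hom.comp, Over.map_obj_hom] at this ⊢
  rw [reassoc_of% this]

/-- The morphism `multicatObj φ' ⟶ multicatObj φ` determined by a morphism `(v, ψ) : T' ⟶ T` over
`P`: it is given by `v` on objects and by the map `∑ᵥ T' 1 ⟶ T ∑ᵥ 1 ⟶ T 1` on arrows. -/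
noncomputable def multicatMap {T' T P : PolyMnd E} (ψ : PolyMnd.Hom T' T) (φ : PolyMnd.Hom T P)
    (φ' : PolyMnd.Hom T' P) (h : ψ.comp φ = φ') :
    PMulticatData.Hom (multicatObj φ') (multicatObj φ) where
  obj := Over.homMk ψ.base (multicatMap_obj_w ψ φ φ' h)
  arr := Over.homMk (oneMap ψ).left (multicatMap_arr_w ψ φ φ' h)
  dom := by
    subst h
    exact ((multicatMapComp ψ φ).copy _ _
      (multicatMap_obj_eq ψ φ (multicatMap_obj_w ψ φ _ rfl))
      (multicatMap_arr_eq ψ φ (multicatMap_arr_w ψ φ _ rfl))).dom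
  cod := by
    subst h
    exact ((multicatMapComp ψ φ).copy _ _
      (multicatMap_obj_eq ψ φ (multicatMap_obj_w ψ φ _ rfl))
      (multicatMap_arr_eq ψ φ (multicatMap_arr_w ψ φ _ rfl))).cod
  unit := by
    subst h
    exact ((multicatMapComp ψ φ).copy _ _
      (multicatMap_obj_eq ψ φ (multicatMap_obj_w ψ φ _ rfl))
      (multicatMap_arr_eq ψ φ (multicatMap_arr_w ψ φ _ rfl))).unit
  mult := by
    subst h
    exact ((multicatMapComp ψ φ).copy _ _
      (multicatMap_obj_eq ψ φ (multicatMap_obj_w ψ φ _ rfl))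
      (multicatMap_arr_eq ψ φ (multicatMap_arr_w ψ φ _ rfl))).mult

lemma oneMap_id (T : PolyMnd E) : (oneMap (𝟙 T : T ⟶ T)).left = 𝟙 _ := by
  have h : (Over.mapId T.base).inv.app (overOne T.base) ≫
      toOne ((Over.map (𝟙 T.base)).obj (overOne T.base)) = 𝟙 (overOne T.base) := by
    ext; simp
  have h2 : (PolyMnd.fibreTrans (PolynomialMonad.Hom.hom (𝟙 T.monad)).toNatTrans).app (overOne T.base) ≫
      T.monad.toMonad.map (toOne ((Over.map (𝟙 T.base)).obj (overOne T.base))) =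
      (Over.mapId T.base).hom.app (T.monad.toMonad.obj (overOne T.base)) := by
    rw [PolyMnd.fibreTrans_id_app, Category.assoc, ← T.monad.toMonad.map_comp, h,
      T.monad.toMonad.map_id]
    exact Category.comp_id _
  exact (congrArg Over.Hom.left h2).trans (Over.mapId_hom_app_left _ _)

lemma oneMap_comp {T'' T' T : PolyMnd E} (ψ : PolyMnd.Hom T'' T') (φ : PolyMnd.Hom T' T) :
    (oneMap (ψ.comp φ)).left = (oneMap ψ).left ≫ (oneMap φ).left := by
  have h : oneMap (ψ.comp φ) = multicatMapArr ψ φ ≫ oneMap φ := by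
    have h2 := multicatMap_dom ψ φ =≫ T.monad.toMonad.map (toOne _)
    rw [Category.assoc, Category.assoc, ← T.monad.toMonad.map_comp] at h2
    refine Eq.trans ?_ h2
    change _ ≫ T.monad.toMonad.map _ = _ ≫ T.monad.toMonad.map _
    congr 2
    ext
    simp [PolyMnd.Hom.comp]
  rw [h]
  simp

/-- The functor which sends `(u, φ) : T ⟶ P` to the endospan `P (∑ᵤ 1) ← ∑ᵤ T 1 → ∑ᵤ 1`. -/
noncomputable def multicatData (P : PolyMnd E) : Over P ⥤ PMulticatData P.monad.toMonad where
  obj Q := multicatObj Q.hom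
  map f := multicatMap f.left _ _ (Over.w f)
  map_id Q := by
    apply PMulticatData.Hom.ext
    · ext; rfl
    · ext; exact oneMap_id Q.left
  map_comp f g := by
    apply PMulticatData.Hom.ext
    · ext; rfl
    · ext; exact oneMap_comp f.left g.left

end Comparison

section Types

/-- Dependent products in the category of types. -/
abbrev typePi {A B : Type w} (f : B ⟶ A) (Y : Over B) : Over A :=
  Over.mk (Y := Σ a : A, ∀ b : {b : B // f b = a}, {y : Y.left // Y.hom y = b.1})
    (↾fun x => x.1)

lemma typePi_ext {A B : Type w} {f : B ⟶ A} {Y : Over B} {x y : (typePi f Y).left} (h : x.1 = y.1)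
    (h' : ∀ b hb hb', (x.2 ⟨b, hb⟩).1 = (y.2 ⟨b, hb'⟩).1) : x = y := by
  obtain ⟨a, s⟩ := x
  obtain ⟨a', s'⟩ := y
  dsimp only at h
  subst h
  congr 1
  funext b
  exact Subtype.ext (h' b.1 b.2 b.2)

lemma typePi_congr {A B : Type w} {f : B ⟶ A} {Y : Over B} {x y : (typePi f Y).left} {b c : B}
    (h : x = y) (h' : b = c) (hb : f b = x.1) (hc : f c = y.1) :
    (x.2 ⟨b, hb⟩).1 = (y.2 ⟨c, hc⟩).1 := by
  subst h h'
  rfl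

/-- Elements of `X ×_A B`. -/
noncomputable def typePb {A B : Type w} (f : B ⟶ A) (X : Over A) (x : X.left) (b : B)
    (h : f b = X.hom x) : ((Over.pullback f).obj X).left :=
  (PullbackCone.IsLimit.equivPullbackObj (pullbackIsPullback X.hom f)).symm ⟨(x, b), h.symm⟩

lemma typePb_fst {A B : Type w} (f : B ⟶ A) (X : Over A) (x : X.left) (b : B)
    (h : f b = X.hom x) : pullback.fst X.hom f (typePb f X x b h) = x :=
  PullbackCone.IsLimit.equivPullbackObj_symm_apply_fst (pullbackIsPullback X.hom f) _

lemma typePb_snd {A B : Type w} (f : B ⟶ A) (X : Over A) (x : X.left) (b : B)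
    (h : f b = X.hom x) : pullback.snd X.hom f (typePb f X x b h) = b :=
  PullbackCone.IsLimit.equivPullbackObj_symm_apply_snd (pullbackIsPullback X.hom f) _

lemma typePb_ext {A B : Type w} {f : B ⟶ A} {X : Over A} {p q : ((Over.pullback f).obj X).left}
    (h : pullback.fst X.hom f p = pullback.fst X.hom f q)
    (h' : pullback.snd X.hom f p = pullback.snd X.hom f q) : p = q :=
  PullbackCone.IsLimit.type_ext (pullbackIsPullback X.hom f) h h'

lemma type_over_w {A : Type w} {X Y : Over A} (φ : X ⟶ Y) (x : X.left) :
    Y.hom (φ.left x) = X.hom x :=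
  ConcreteCategory.congr_hom (Over.w φ) x

/-- The universal property of `typePi`. -/
noncomputable def typePiEquiv {A B : Type w} (f : B ⟶ A) (X : Over A) (Y : Over B) :
    ((Over.pullback f).obj X ⟶ Y) ≃ (X ⟶ typePi f Y) where
  toFun φ := Over.homMk (↾fun x => ⟨X.hom x, fun b => ⟨φ.left (typePb f X x b.1 b.2),
    (type_over_w φ _).trans (typePb_snd f X x b.1 b.2)⟩⟩) (by ext; rfl)
  invFun ψ := Over.homMk (↾fun p => ((ψ.left (pullback.fst X.hom f p)).2
      ⟨pullback.snd X.hom f p, ((type_over_w ψ _).trans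
        (ConcreteCategory.congr_hom (pullback.condition (f := X.hom) (g := f)) p)).symm⟩).1) (by
    ext p
    exact ((ψ.left (pullback.fst X.hom f p)).2 _).2)
  left_inv φ := by
    ext p
    exact congrArg φ.left (typePb_ext (typePb_fst _ _ _ _ _) (typePb_snd _ _ _ _ _))
  right_inv ψ := by
    ext x
    refine typePi_ext (type_over_w ψ x).symm fun b hb hb' => ?_
    exact typePi_congr (congrArg ψ.left (typePb_fst f X x b hb)) (typePb_snd f X x b hb) _ _

instance : LocallyCartesianClosed (Type w) where
  isLeftAdjoint_pullback f :=
    (Adjunction.adjunctionOfEquivRight (G_obj := typePi f) (fun X Y => typePiEquiv f X Y)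
      (by
        intro X' X Y g φ
        ext x
        refine typePi_ext (type_over_w g x).symm fun b hb hb' => ?_
        refine congrArg φ.left (typePb_ext ?_ ?_)
        · have h := ConcreteCategory.congr_hom (pbMap_fst f g) (typePb f X' x b hb)
          refine h.trans (Eq.trans ?_ (typePb_fst f X (g.left x) b hb').symm)
          exact congrArg g.left (typePb_fst f X' x b hb)
        · have h := type_over_w ((Over.pullback f).map g) (typePb f X' x b hb)
          refine h.trans (Eq.trans ?_ (typePb_snd f X (g.left x) b hb').symm)
          exact typePb_snd f X' x b hb)).isLeftAdjoint

end Types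

section ListMonad

/-- The functor `X ↦ List X` on the slice of the category of types over the terminal object. -/
def listFunctor : Over PUnit.{w + 1} ⥤ Over PUnit.{w + 1} where
  obj X := Over.mk (Y := List X.left) (↾fun _ => PUnit.unit)
  map f := Over.homMk (↾List.map f.left)
  map_id X := by ext (x : List X.left); exact List.map_id x
  map_comp {X Y Z} f g := by
    ext (l : List X.left)
    change l.map (f.left ≫ g.left) = (l.map f.left).map g.left
    rw [List.map_map]
    rfl

/-- The free-monoid monad, with unit `x ↦ [x]` and multiplication the concatenation of lists. -/
def listMonad : Monad (Over PUnit.{w + 1}) where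
  toFunctor := listFunctor
  η := { app X := Over.homMk (↾fun x : X.left => [x]) }
  μ :=
    { app X := Over.homMk (↾fun l : List (List X.left) => l.flatten)
      naturality X Y f := by ext (l : List (List X.left)); exact (List.map_flatten ..).symm }
  left_unit X := by ext (l : List X.left); exact List.flatten_singleton
  right_unit X := by
    ext (l : List X.left)
    change (l.map fun x => [x]).flatten = l
    induction l with
    | nil => rfl
    | cons a l ih => simpa using ih
  assoc X := by
    ext (l : List (List (List X.left)))
    change (l.map List.flatten).flatten = l.flatten.flatten
    induction l with
    | nil => rfl
    | cons a l ih => simpa using ih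

/-- The strength of the free-monoid monad: `(k, [x₁, …, xₙ]) ↦ [(k, x₁), …, (k, xₙ)]`. -/
def listStrength : Strength listMonad.{w}.toFunctor where
  app K X := Over.homMk (↾fun p : K × List X.left => p.2.map fun x => ((p.1, x) : K × X.left))
  naturality {K K'} k {X Y} f := by
    ext ⟨a, (l : List X.left)⟩
    change (l.map f.left).map (fun x => (k a, x)) =
      (l.map fun x => (a, x)).map fun p => (k p.1, f.left p.2)
    simp
  unit X := by
    ext ⟨a, (l : List X.left)⟩
    change (l.map (fun x => (a, x))).map Prod.snd = l
    simp
  assoc K K' X := by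
    ext ⟨⟨a, b⟩, (l : List X.left)⟩
    change (l.map (fun x => (b, x))).map (fun x => (a, x)) =
      (l.map fun x => ((a, b), x)).map fun p => (p.1.1, p.1.2, p.2)
    simp

end ListMonad

section Multicategory

/-- A (Lambek) multicategory: a set of objects and a set of operations, each with a list of objects
as its domain and an object as its codomain, with identity operations and a composite
`f ∘ (g₁, …, gₙ)` of every operation `f` with operations `g₁, …, gₙ` whose codomains form the
domain of `f`. -/
structure Multicategory : Type (w + 1) where
  Obj : Type w
  Op : Type w
  dom : Op → List Obj
  cod : Op → Obj
  id : Obj → Op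
  comp (f : Op) (gs : List Op) (h : gs.map cod = dom f) : Op
  dom_id (a : Obj) : dom (id a) = [a]
  cod_id (a : Obj) : cod (id a) = a
  dom_comp (f : Op) (gs : List Op) (h : gs.map cod = dom f) :
    dom (comp f gs h) = gs.flatMap dom
  cod_comp (f : Op) (gs : List Op) (h : gs.map cod = dom f) : cod (comp f gs h) = cod f
  id_comp (f : Op) : comp (id (cod f)) [f] (by simp [dom_id]) = f
  comp_id (f : Op) : comp f ((dom f).map id) (by simp [Function.comp_def, cod_id]) = f
  assoc (f : Op) (L : List {p : Op × List Op // p.2.map cod = dom p.1})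
    (h : (L.map fun p => p.1.1).map cod = dom f) :
    comp f (L.map fun p => comp p.1.1 p.1.2 p.2) (by simpa [Function.comp_def, cod_comp] using h) =
      comp (comp f (L.map fun p => p.1.1) h) (L.flatMap fun p => p.1.2) (by
        rw [dom_comp, List.map_flatMap, List.flatMap_map]
        exact congrArg (fun F => L.flatMap F) (funext fun p => p.2))

namespace Multicategory

lemma comp_congr (X : Multicategory.{w}) {f f' : X.Op} {gs gs' : List X.Op} (hf : f = f')
    (hgs : gs = gs') (h : gs.map X.cod = X.dom f) (h' : gs'.map X.cod = X.dom f') :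
    X.comp f gs h = X.comp f' gs' h' := by
  subst hf hgs
  rfl

/-- Functors between multicategories. -/
@[ext]
structure Hom (X Y : Multicategory.{w}) where
  obj : X.Obj → Y.Obj
  op : X.Op → Y.Op
  dom (f : X.Op) : Y.dom (op f) = (X.dom f).map obj
  cod (f : X.Op) : Y.cod (op f) = obj (X.cod f)
  id (a : X.Obj) : op (X.id a) = Y.id (obj a)
  comp (f : X.Op) (gs : List X.Op) (h : gs.map X.cod = X.dom f) :
    op (X.comp f gs h) = Y.comp (op f) (gs.map op) (by
      rw [dom, ← h, List.map_map, List.map_map]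
      exact congrArg (fun F => gs.map F) (funext cod))

instance : Category Multicategory.{w} where
  Hom := Hom
  id X :=
    { obj := _root_.id
      op := _root_.id
      dom f := (List.map_id _).symm
      cod f := rfl
      id a := rfl
      comp f gs h := X.comp_congr rfl (List.map_id _).symm _ _ }
  comp {X Y Z} F G :=
    { obj := G.obj ∘ F.obj
      op := G.op ∘ F.op
      dom f := by simp [F.dom, G.dom]
      cod f := by simp [F.cod, G.cod]
      id a := by simp [F.id, G.id]
      comp f gs h := by
        rw [Function.comp_apply, F.comp, G.comp]
        exact Z.comp_congr rfl (by simp) _ _ }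

/-- A multicategory as an endospan `List C ← N → C` with a unit and a multiplication. -/
noncomputable def data (X : Multicategory.{w}) : PMulticatData listMonad.{w} where
  obj := Over.mk (Y := X.Obj) (↾fun _ => PUnit.unit)
  arr := Over.mk (Y := X.Op) (↾fun _ => PUnit.unit)
  dom := Over.homMk (↾X.dom)
  cod := Over.homMk (↾X.cod)
  unit := Over.homMk (↾X.id)
  mult := Over.homMk (↾fun p => X.comp ((pullback.snd (C := Over PUnit.{w + 1}) _ _).left p)
    ((pullback.fst (C := Over PUnit.{w + 1}) _ _).left p)
    (ConcreteCategory.congr_hom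
      (congrArg Over.Hom.left (pullback.condition (C := Over PUnit.{w + 1}))) p))

lemma data_mult (X : Multicategory.{w}) (p : (pullback (listMonad.map X.data.cod) X.data.dom).left)
    (f : X.Op) (gs : List X.Op)
    (hf : (pullback.snd (listMonad.map X.data.cod) X.data.dom).left p = f)
    (hgs : (pullback.fst (listMonad.map X.data.cod) X.data.dom).left p = gs)
    (h : gs.map X.cod = X.dom f) : X.data.mult.left p = X.comp f gs h :=
  X.comp_congr hf hgs _ _

/-- A functor between multicategories as a morphism of endospans. -/
noncomputable def dataMap {X Y : Multicategory.{w}} (F : Hom X Y) :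
    PMulticatData.Hom X.data Y.data where
  obj := Over.homMk (U := X.data.obj) (V := Y.data.obj) (↾F.obj)
  arr := Over.homMk (U := X.data.arr) (V := Y.data.arr) (↾F.op)
  dom := by ext f; exact (F.dom f).symm
  cod := by ext f; exact (F.cod f).symm
  unit := by ext a; exact F.id a
  mult := by
    ext p
    refine (F.comp _ _ _).trans (Y.data_mult _ _ _ ?_ ?_ _).symm
    · exact ConcreteCategory.congr_hom
        (congrArg Over.Hom.left (PMulticatData.compMap_snd X.data Y.data _ _ _ _)) p
    · exact ConcreteCategory.congr_hom
        (congrArg Over.Hom.left (PMulticatData.compMap_fst X.data Y.data _ _ _ _)) p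

/-- The functor which regards multicategories as endospans. -/
noncomputable def toData : Multicategory.{w} ⥤ PMulticatData listMonad.{w} where
  obj := data
  map := dataMap
  map_id _ := rfl
  map_comp _ _ := rfl

end Multicategory

end Multicategory

section PlainOperad

/-- A plain (nonsymmetric) operad: sets `O n` of `n`-ary operations for all `n`, an identity
operation in `O 1`, and a composite `f ∘ (g₁, …, gₙ)` of arity `k₁ + ⋯ + kₙ` for every `f ∈ O n` and
every list of operations `gᵢ ∈ O kᵢ`, `1 ≤ i ≤ n`. -/
structure PlainOperad : Type (w + 1) where
  Op : ℕ → Type w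
  one : Op 1
  comp {n : ℕ} (f : Op n) (gs : List (Σ k, Op k)) (h : gs.length = n) : Op (gs.map Sigma.fst).sum
  one_comp (f : Σ n, Op n) : (⟨_, comp one [f] rfl⟩ : Σ n, Op n) = f
  comp_one {n : ℕ} (f : Op n) :
    (⟨_, comp f (List.replicate n ⟨1, one⟩) List.length_replicate⟩ : Σ n, Op n) = ⟨n, f⟩
  assoc {n : ℕ} (f : Op n) (L : List (Σ k, {p : Op k × List (Σ j, Op j) // p.2.length = k}))
    (h : L.length = n) :
    (⟨_, comp f (L.map fun p => ⟨_, comp p.2.1.1 p.2.1.2 p.2.2⟩)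
        ((List.length_map ..).trans h)⟩ : Σ n, Op n) =
      ⟨_, comp (comp f (L.map fun p => ⟨p.1, p.2.1.1⟩) ((List.length_map ..).trans h))
        (L.flatMap fun p => p.2.1.2) (by
          rw [List.length_flatMap, List.map_map]
          exact congrArg (fun F => (L.map F).sum) (funext fun p => p.2.2))⟩

namespace PlainOperad

/-- Composition as an operation on the set of all operations. -/
def compTotal (X : PlainOperad.{w}) (f : Σ n, X.Op n) (gs : List (Σ n, X.Op n))
    (h : gs.length = f.1) : Σ n, X.Op n :=
  ⟨_, X.comp f.2 gs h⟩

lemma compTotal_congr (X : PlainOperad.{w}) {f f' : Σ n, X.Op n} {gs gs' : List (Σ n, X.Op n)}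
    (hf : f = f') (hgs : gs = gs') (h : gs.length = f.1) (h' : gs'.length = f'.1) :
    X.compTotal f gs h = X.compTotal f' gs' h' := by
  subst hf hgs
  rfl

/-- The map on the set of all operations induced by a family of maps. -/
abbrev mapTotal {X Y : PlainOperad.{w}} (op : ∀ n, X.Op n → Y.Op n) (f : Σ n, X.Op n) :
    Σ n, Y.Op n :=
  ⟨f.1, op f.1 f.2⟩

/-- Morphisms of plain operads. -/
@[ext]
structure Hom (X Y : PlainOperad.{w}) where
  op (n : ℕ) : X.Op n → Y.Op n
  one : op 1 X.one = Y.one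
  comp {n : ℕ} (f : X.Op n) (gs : List (Σ k, X.Op k)) (h : gs.length = n) :
    (⟨_, op _ (X.comp f gs h)⟩ : Σ n, Y.Op n) =
      ⟨_, Y.comp (op n f) (gs.map (mapTotal op)) ((List.length_map ..).trans h)⟩

instance : Category PlainOperad.{w} where
  Hom := Hom
  id X :=
    { op _ := id
      one := rfl
      comp f gs h := X.compTotal_congr (f := ⟨_, f⟩) (f' := ⟨_, f⟩) rfl (List.map_id _).symm h _ }
  comp {X Y Z} F G :=
    { op n := G.op n ∘ F.op n
      one := by simp [F.one, G.one]
      comp {n} f gs h := by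
        refine (congrArg (mapTotal G.op) (F.comp f gs h)).trans ((G.comp _ _ _).trans ?_)
        exact Z.compTotal_congr (f := ⟨n, G.op n (F.op n f)⟩) (f' := ⟨n, G.op n (F.op n f)⟩) rfl
          (List.map_map ..) _ _ }

/-- The terminal object of the slice over the one-point type. -/
abbrev point : Over PUnit.{w + 1} := overOne _

/-- A plain operad as an endospan `List 1 ← N → 1` with a unit and a multiplication, where `N` is
the set of all operations. -/
noncomputable def data (X : PlainOperad.{w}) : PMulticatData listMonad.{w} where
  obj := point
  arr := Over.mk (Y := Σ n, X.Op n) (↾fun _ => PUnit.unit)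
  dom := Over.homMk (↾fun f => List.replicate f.1 PUnit.unit)
  cod := Over.homMk (↾fun _ => PUnit.unit)
  unit := Over.homMk (↾fun _ => ⟨1, X.one⟩)
  mult := Over.homMk (↾fun p => X.compTotal ((pullback.snd (C := Over PUnit.{w + 1}) _ _).left p)
    ((pullback.fst (C := Over PUnit.{w + 1}) _ _).left p) (by
      have h := congrArg List.length (ConcreteCategory.congr_hom
        (congrArg Over.Hom.left (pullback.condition (C := Over PUnit.{w + 1}))) p)
      exact ((List.length_map ..).symm.trans h).trans List.length_replicate))

lemma data_mult (X : PlainOperad.{w}) (p : (pullback (listMonad.map X.data.cod) X.data.dom).left)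
    (f : Σ n, X.Op n) (gs : List (Σ n, X.Op n))
    (hf : (pullback.snd (listMonad.map X.data.cod) X.data.dom).left p = f)
    (hgs : (pullback.fst (listMonad.map X.data.cod) X.data.dom).left p = gs)
    (h : gs.length = f.1) : X.data.mult.left p = X.compTotal f gs h :=
  X.compTotal_congr hf hgs _ _

/-- A morphism of plain operads as a morphism of endospans. -/
noncomputable def dataMap {X Y : PlainOperad.{w}} (F : Hom X Y) :
    PMulticatData.Hom X.data Y.data where
  obj := 𝟙 point
  arr := Over.homMk (U := X.data.arr) (V := Y.data.arr) (↾mapTotal F.op)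
  dom := by
    ext f
    exact List.map_id _
  cod := rfl
  unit := by ext; exact congrArg (Sigma.mk 1) F.one
  mult := by
    ext p
    refine (F.comp _ _ _).trans (Y.data_mult _ (mapTotal F.op _) _ ?_ ?_ _).symm
    · exact ConcreteCategory.congr_hom
        (congrArg Over.Hom.left (PMulticatData.compMap_snd X.data Y.data _ _ _ _)) p
    · exact ConcreteCategory.congr_hom
        (congrArg Over.Hom.left (PMulticatData.compMap_fst X.data Y.data _ _ _ _)) p

/-- The functor which regards plain operads as endospans. -/
noncomputable def toData : PlainOperad.{w} ⥤ PMulticatData listMonad.{w} where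
  obj := data
  map := dataMap
  map_id _ := rfl
  map_comp _ _ := rfl

end PlainOperad

end PlainOperad

section Categories

/-- The identity monad on the slice over the one-point type. -/
abbrev idMonad : Monad (Over PUnit.{w + 1}) := Monad.id _

/-- The composite of two arrows `f` and `g` such that the target of `f` is the source of `g`. -/
def compArrow {C : Type w} [Category.{w} C] (f g : Σ p : C × C, p.1 ⟶ p.2)
    (h : f.1.2 = g.1.1) : Σ p : C × C, p.1 ⟶ p.2 :=
  ⟨(f.1.1, g.1.2), f.2 ≫ eqToHom h ≫ g.2⟩

lemma compArrow_congr {C : Type w} [Category.{w} C] {f f' g g' : Σ p : C × C, p.1 ⟶ p.2}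
    (hf : f = f') (hg : g = g') (h : f.1.2 = g.1.1) (h' : f'.1.2 = g'.1.1) :
    compArrow f g h = compArrow f' g' h' := by
  subst hf hg
  rfl

/-- The action of a functor on the set of all arrows. -/
abbrev mapArrow {C D : Type w} [Category.{w} C] [Category.{w} D] (F : C ⥤ D)
    (f : Σ p : C × C, p.1 ⟶ p.2) : Σ p : D × D, p.1 ⟶ p.2 :=
  ⟨(F.obj f.1.1, F.obj f.1.2), F.map f.2⟩

lemma mapArrow_comp {C D : Type w} [Category.{w} C] [Category.{w} D] (F : C ⥤ D)
    (f g : Σ p : C × C, p.1 ⟶ p.2) (h : f.1.2 = g.1.1) :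
    mapArrow F (compArrow f g h) =
      compArrow (mapArrow F f) (mapArrow F g) (congrArg F.obj h) := by
  simp [mapArrow, compArrow, eqToHom_map]

/-- The source map from the set of all arrows. -/
abbrev catDom (C : Type w) [Category.{w} C] :
    Over.mk (Y := Σ p : C × C, p.1 ⟶ p.2) (↾fun _ => PUnit.unit.{w + 1}) ⟶
      idMonad.obj (Over.mk (Y := C) (↾fun _ => PUnit.unit)) :=
  Over.homMk (V := Over.mk (Y := C) (↾fun _ => PUnit.unit)) (↾fun f => f.1.1)

/-- The target map from the set of all arrows. -/
abbrev catCod (C : Type w) [Category.{w} C] :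
    Over.mk (Y := Σ p : C × C, p.1 ⟶ p.2) (↾fun _ => PUnit.unit.{w + 1}) ⟶
      Over.mk (Y := C) (↾fun _ => PUnit.unit) :=
  Over.homMk (↾fun f => f.1.2)

lemma catData_w (C : Type w) [Category.{w} C]
    (p : (pullback (idMonad.map (catCod C)) (catDom C)).left) :
    ((pullback.fst (idMonad.map (catCod C)) (catDom C)).left p).1.2 =
      ((pullback.snd (idMonad.map (catCod C)) (catDom C)).left p).1.1 := by
  have h := ConcreteCategory.congr_hom (congrArg Over.Hom.left
    (pullback.condition (f := idMonad.map (catCod C)) (g := catDom C))) p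
  exact h

/-- A small category as an endospan `C ← N → C` with a unit and a multiplication, where `N` is the
set of all arrows. -/
noncomputable def catData (C : Type w) [Category.{w} C] : PMulticatData idMonad.{w} where
  obj := Over.mk (Y := C) (↾fun _ => PUnit.unit)
  arr := Over.mk (Y := Σ p : C × C, p.1 ⟶ p.2) (↾fun _ => PUnit.unit)
  dom := catDom C
  cod := catCod C
  unit := Over.homMk (↾fun a : C => (⟨(a, a), 𝟙 a⟩ : Σ p : C × C, p.1 ⟶ p.2))
  mult := Over.homMk (↾fun p => compArrow
    ((pullback.fst (idMonad.map (catCod C)) (catDom C)).left p)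
    ((pullback.snd (idMonad.map (catCod C)) (catDom C)).left p)
    (catData_w C p))

lemma catData_mult (C : Type w) [Category.{w} C]
    (p : (pullback (idMonad.map (catData C).cod) (catData C).dom).left)
    (f g : Σ p : C × C, p.1 ⟶ p.2)
    (hf : (pullback.fst (idMonad.map (catData C).cod) (catData C).dom).left p = f)
    (hg : (pullback.snd (idMonad.map (catData C).cod) (catData C).dom).left p = g)
    (h : f.1.2 = g.1.1) : (catData C).mult.left p = compArrow f g h :=
  compArrow_congr hf hg _ _

/-- A functor between small categories as a morphism of endospans. -/
noncomputable def catDataMap {C D : Type w} [Category.{w} C] [Category.{w} D] (F : C ⥤ D) :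
    PMulticatData.Hom (catData C) (catData D) where
  obj := Over.homMk (U := (catData C).obj) (V := (catData D).obj) (↾F.obj)
  arr := Over.homMk (U := (catData C).arr) (V := (catData D).arr) (↾mapArrow F)
  dom := rfl
  cod := rfl
  unit := by
    ext a
    exact congrArg (fun f : F.obj a ⟶ F.obj a =>
      (⟨(F.obj a, F.obj a), f⟩ : Σ p : D × D, p.1 ⟶ p.2)) (F.map_id a)
  mult := by
    ext p
    refine (mapArrow_comp F _ _ _).trans
      (catData_mult D _ (mapArrow F _) (mapArrow F _) ?_ ?_ _).symm
    · exact ConcreteCategory.congr_hom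
        (congrArg Over.Hom.left (PMulticatData.compMap_fst (catData C) (catData D) _ _ _ _)) p
    · exact ConcreteCategory.congr_hom
        (congrArg Over.Hom.left (PMulticatData.compMap_snd (catData C) (catData D) _ _ _ _)) p

/-- The functor which regards small categories as endospans. -/
noncomputable def catToData : Cat.{w, w} ⥤ PMulticatData idMonad.{w} where
  obj C := catData C
  map F := catDataMap F.toFunctor
  map_id _ := rfl
  map_comp _ _ := rfl

/-- The multiplication of a monoid as the composition of the corresponding one-object category: first
`x`, then `y`. -/
def mulOp {M : Type w} [Monoid M] (x y : M) : M := y * x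

/-- A monoid as an endospan `1 ← M → 1` with a unit and a multiplication. -/
noncomputable def monData (M : Type w) [Monoid M] : PMulticatData idMonad.{w} where
  obj := overOne _
  arr := Over.mk (Y := M) (↾fun _ => PUnit.unit)
  dom := Over.homMk (V := overOne PUnit.{w + 1}) (↾fun _ => PUnit.unit)
  cod := Over.homMk (↾fun _ => PUnit.unit)
  unit := Over.homMk (↾fun _ => (1 : M))
  mult := Over.homMk (↾fun p => mulOp (M := M)
    ((pullback.fst (C := Over PUnit.{w + 1}) _ _).left p)
    ((pullback.snd (C := Over PUnit.{w + 1}) _ _).left p))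

/-- A homomorphism of monoids as a morphism of endospans. -/
noncomputable def monDataMap {M N : Type w} [Monoid M] [Monoid N] (φ : M →* N) :
    PMulticatData.Hom (monData M) (monData N) where
  obj := 𝟙 (overOne _)
  arr := Over.homMk (U := (monData M).arr) (V := (monData N).arr) (↾φ)
  dom := rfl
  cod := rfl
  unit := by ext; exact φ.map_one
  mult := by
    ext p
    have h₁ := ConcreteCategory.congr_hom (congrArg Over.Hom.left
      (PMulticatData.compMap_fst (monData M) (monData N) (𝟙 (overOne _))
        (Over.homMk (U := (monData M).arr) (V := (monData N).arr) (↾φ)) rfl rfl)) p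
    have h₂ := ConcreteCategory.congr_hom (congrArg Over.Hom.left
      (PMulticatData.compMap_snd (monData M) (monData N) (𝟙 (overOne _))
        (Over.homMk (U := (monData M).arr) (V := (monData N).arr) (↾φ)) rfl rfl)) p
    exact (φ.map_mul _ _).trans (congrArg₂ (fun x y : N => mulOp x y) h₁.symm h₂.symm)

/-- The functor which regards monoids as endospans. -/
noncomputable def monToData : MonCat.{w} ⥤ PMulticatData idMonad.{w} where
  obj M := monData M
  map φ := monDataMap φ.hom
  map_id _ := rfl
  map_comp _ _ := rfl

end Categories

end PolyMonads

/-!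
Both sides of each equivalence embed fully faithfully into the category `PMulticatData P` of
endospans `P C ← N → C` equipped with a unit and a multiplication: a polynomial monad `T` over `P`
goes to the endospan `P (∑ᵤ 1) ← ∑ᵤ T 1 → ∑ᵤ 1`. By `exists_equivalence_of_fullyFaithful` it is
therefore enough to prove that the functor `multicatData` is fully faithful and that its essential
image consists of the endospans which satisfy the axioms of a multicategory, respectively of those
among them whose object of objects is terminal.

Cartesianness of `φ : ∑ᵤ T ⟶ P ∑ᵤ` means that `∑ᵤ T Y` is the pullback of `P (∑ᵤ Y)` and `∑ᵤ T 1`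
over `P (∑ᵤ 1)`. Hence a map into `T Y` is the same as a compatible pair of maps into `T 1` and
into `P (∑ᵤ Y)` (`cartesianLift`, `cartesian_hom_ext`), and everything about `T` is determined by
what happens at the terminal object:

* A monad structure on `T` compatible with `φ` is the same as a unit `1 ⟶ T 1` and a
  multiplication `T T 1 ⟶ T 1` satisfying finitely many equations (`IsMonadAtOne`), and these
  equations are precisely the axioms of a multicategory for the endospan
  (`isPMulticategory_spanAtOne_iff`). Cartesianness and strength of the unit and of the
  multiplication are inherited from `P`.
* A morphism of endospans extends uniquely to a morphism of polynomial monads over `P`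
  (`MulticatHom.polyMndHom`, `PolyMnd.Hom.ext_of_oneMap`).

It remains to find, for a multicategory `P C ← N → C`, a polynomial functor with a cartesian
strong transformation to `P` whose value at the terminal object is `N` and whose component there
is `N ⟶ P C`. If `P` is the extension of `I ← B → A → I`, then the extension of
`C ← N ×_A B → N → C` is such a functor, where the first map evaluates the elements of `P C` given
by `N ⟶ P C` (`IsPolynomialFunctor.exists_restrict`). The calculations with extensions of polynomials rest on
the universal property of the dependent product: an element of `∑_t ∏_f s^* X` is a shape `a : A`
with a family of entries in `X` indexed by the fibre of `f` over `a` (`Poly.hom_ext`,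
`Poly.lift`).

For the free-monoid monad and the identity monad on types, the axioms of a multicategory are
spelled out in terms of elements (`PMulticatData.elementLaws_iff`). This identifies the essential
images of multicategories, plain operads, small categories and monoids in the category of
endospans, and the first argument applies again (`exists_equivalence_over`,
`exists_equivalence_fibre_over`).
-/


set_option linter.unusedSectionVars false

namespace PolyMonads

open MonoidalCategory CartesianMonoidalCategory

/-! ### Generalized elements of polynomial functors -/

section PolyElements

variable {E : Type u} [Category.{v} E] [CartesianMonoidalCategory E] [HasPullbacks E]
  [LocallyCartesianClosed E] {I J I' J' : E}

namespace Poly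

/-- The projection of the extension `∑_t ∏_f s^* X` to the object `A` of shapes. -/
noncomputable def pr (p : Poly I J) (X : Over I) : (p.ext.obj X).left ⟶ p.A :=
  ((depProd p.f).obj ((Over.pullback p.s).obj X)).hom

/-- The counit of the adjunction between pullback and dependent product. -/
noncomputable def evalAux (p : Poly I J) (X : Over I) :
    pullback (p.pr X) p.f ⟶ ((Over.pullback p.s).obj X).left :=
  ((depProdAdj p.f).counit.app ((Over.pullback p.s).obj X)).left

lemma evalAux_w (p : Poly I J) (X : Over I) :
    p.evalAux X ≫ ((Over.pullback p.s).obj X).hom = pullback.snd (p.pr X) p.f :=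
  Over.w ((depProdAdj p.f).counit.app ((Over.pullback p.s).obj X))

/-- Evaluation of an element of `∏_f s^* X` over `a` at a point of the fibre of `f` over `a`. -/
noncomputable def ev (p : Poly I J) (X : Over I) : pullback (p.pr X) p.f ⟶ X.left :=
  p.evalAux X ≫ pbFst p.s X

lemma ev_w (p : Poly I J) (X : Over I) : p.ev X ≫ X.hom = pullback.snd _ _ ≫ p.s := by
  rw [ev, Category.assoc, pbFst_w, reassoc_of% evalAux_w]

/-- Evaluation of a generalized element `h` of `p.ext.obj X`, stage `W`, at the point `b` of stage
`V` over `W`. -/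
noncomputable def evAt (p : Poly I J) {X : Over I} {W V : E} (h : W ⟶ (p.ext.obj X).left)
    (v : V ⟶ W) (b : V ⟶ p.B) (w : v ≫ h ≫ p.pr X = b ≫ p.f) : V ⟶ X.left :=
  pullback.lift (v ≫ h) b (by simpa using w) ≫ p.ev X

variable (p : Poly I J) {X Y : Over I} {W W' V V' : E}

lemma evAt_w (h : W ⟶ (p.ext.obj X).left) (v : V ⟶ W) (b : V ⟶ p.B)
    (w : v ≫ h ≫ p.pr X = b ≫ p.f) : p.evAt h v b w ≫ X.hom = b ≫ p.s := by
  rw [evAt, Category.assoc, ev_w, pullback.lift_snd_assoc]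

lemma comp_evAt (h : W ⟶ (p.ext.obj X).left) (v : V ⟶ W) (b : V ⟶ p.B)
    (w : v ≫ h ≫ p.pr X = b ≫ p.f) (c : V' ⟶ V) :
    c ≫ p.evAt h v b w = p.evAt h (c ≫ v) (c ≫ b) (by simp [w]) := by
  rw [evAt, evAt, ← Category.assoc]
  congr 1
  apply pullback.hom_ext
  · rw [Category.assoc, pullback.lift_fst, pullback.lift_fst, Category.assoc]
  · rw [Category.assoc, pullback.lift_snd, pullback.lift_snd]

lemma evAt_comp (h : W ⟶ (p.ext.obj X).left) (c : W' ⟶ W) (v : V ⟶ W') (b : V ⟶ p.B)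
    (w : v ≫ (c ≫ h) ≫ p.pr X = b ≫ p.f) :
    p.evAt (c ≫ h) v b w = p.evAt h (v ≫ c) b (by simpa using w) := by
  rw [evAt, evAt]
  congr 1
  apply pullback.hom_ext <;> simp

lemma evAt_congr {h h' : W ⟶ (p.ext.obj X).left} {v v' : V ⟶ W} {b b' : V ⟶ p.B}
    (w : v ≫ h ≫ p.pr X = b ≫ p.f) (hh : h = h') (hv : v = v') (hb : b = b') :
    p.evAt h v b w = p.evAt h' v' b' (by rw [← hh, ← hv, ← hb, w]) := by
  subst hh hv hb
  rfl

lemma map_pr (g : X ⟶ Y) : (p.ext.map g).left ≫ p.pr Y = p.pr X :=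
  Over.w ((depProd p.f).map ((Over.pullback p.s).map g))

lemma evalAux_naturality (g : X ⟶ Y) :
    pullback.map (p.pr X) p.f (p.pr Y) p.f (p.ext.map g).left (𝟙 _) (𝟙 _)
      (by rw [map_pr, Category.comp_id]) (by simp) ≫ p.evalAux Y =
    p.evalAux X ≫ ((Over.pullback p.s).map g).left := by
  have h := congrArg Over.Hom.left
    ((depProdAdj p.f).counit.naturality ((Over.pullback p.s).map g))
  refine Eq.trans ?_ h
  refine congrArg (· ≫ p.evalAux Y) ?_
  refine pullback.hom_ext ?_ ?_
  · exact (pullback.lift_fst _ _ _).trans (pullback.lift_fst _ _ _).symm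
  · exact (pullback.lift_snd _ _ _).trans
      ((Category.comp_id _).trans (pullback.lift_snd _ _ _).symm)

lemma ev_naturality (g : X ⟶ Y) :
    pullback.map (p.pr X) p.f (p.pr Y) p.f (p.ext.map g).left (𝟙 _) (𝟙 _)
      (by rw [map_pr, Category.comp_id]) (by simp) ≫ p.ev Y = p.ev X ≫ g.left := by
  rw [ev, ev, reassoc_of% p.evalAux_naturality g, pbMap_fst, Category.assoc]

lemma evAt_map (h : W ⟶ (p.ext.obj X).left) (g : X ⟶ Y) (v : V ⟶ W) (b : V ⟶ p.B)
    (w : v ≫ (h ≫ (p.ext.map g).left) ≫ p.pr Y = b ≫ p.f) :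
    p.evAt (h ≫ (p.ext.map g).left) v b w =
      p.evAt h v b (by simpa only [Category.assoc, map_pr] using w) ≫ g.left := by
  refine Eq.trans ?_ (Category.assoc _ _ _).symm
  rw [← ev_naturality, ← Category.assoc (pullback.lift (v ≫ h) b _)]
  refine congrArg (· ≫ p.ev Y) ?_
  apply pullback.hom_ext
  · rw [Category.assoc, pullback.map, pullback.lift_fst, pullback.lift_fst, pullback.lift_fst_assoc,
      Category.assoc]
  · rw [Category.assoc, pullback.map, pullback.lift_snd, pullback.lift_snd, pullback.lift_snd_assoc,
      Category.comp_id]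

lemma homEquiv_symm_fst {a : W ⟶ p.A}
    (h : Over.mk a ⟶ (depProd p.f).obj ((Over.pullback p.s).obj X)) :
    (((depProdAdj p.f).homEquiv _ _).symm h).left ≫ pbFst p.s X =
      p.evAt (X := X) h.left (pullback.fst a p.f) (pullback.snd a p.f)
        ((congrArg (pullback.fst a p.f ≫ ·) (Over.w h)).trans pullback.condition) := by
  rw [Adjunction.homEquiv_counit, Over.comp_left, Category.assoc]
  rfl

/-- A generalized element of `p.ext.obj X` is determined by its shape and its values. -/
lemma hom_ext {h h' : W ⟶ (p.ext.obj X).left} {a : W ⟶ p.A} {v : V ⟶ W} {b : V ⟶ p.B}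
    (hV : IsPullback v b a p.f) (ha : h ≫ p.pr X = a) (ha' : h' ≫ p.pr X = a)
    (he : p.evAt h v b (by rw [ha, hV.w]) = p.evAt h' v b (by rw [ha', hV.w])) : h = h' := by
  let k : Over.mk a ⟶ (depProd p.f).obj ((Over.pullback p.s).obj X) := Over.homMk h ha
  let k' : Over.mk a ⟶ (depProd p.f).obj ((Over.pullback p.s).obj X) := Over.homMk h' ha'
  suffices k = k' from congrArg Over.Hom.left this
  apply ((depProdAdj p.f).homEquiv _ _).symm.injective
  apply pb_ext
  rw [homEquiv_symm_fst, homEquiv_symm_fst]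
  have := congrArg (fun t => hV.lift (pullback.fst a p.f) (pullback.snd a p.f)
    pullback.condition ≫ t) he
  rw [comp_evAt, comp_evAt] at this
  refine (p.evAt_congr _ rfl ?_ ?_).trans (this.trans (p.evAt_congr _ rfl ?_ ?_)) <;> simp

lemma exists_lift {a : W ⟶ p.A} {v : V ⟶ W} {b : V ⟶ p.B} (hV : IsPullback v b a p.f)
    (k : V ⟶ X.left) (hk : k ≫ X.hom = b ≫ p.s) :
    ∃ (h : W ⟶ (p.ext.obj X).left) (hp : h ≫ p.pr X = a),
      p.evAt h v b (by rw [hp, hV.w]) = k := by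
  let z := hV.lift (pullback.fst a p.f) (pullback.snd a p.f) pullback.condition
  let l : (Over.pullback p.f).obj (Over.mk a) ⟶ (Over.pullback p.s).obj X :=
    pbLift p.s (W := (Over.pullback p.f).obj (Over.mk a)) (z ≫ k)
      (by rw [Category.assoc, hk, hV.lift_snd_assoc]; rfl)
  let h := (depProdAdj p.f).homEquiv _ _ l
  have hp : h.left ≫ p.pr X = a := Over.w h
  refine ⟨h.left, hp, ?_⟩
  have h1 := p.homEquiv_symm_fst h
  rw [Equiv.symm_apply_apply, pbLift_fst] at h1
  have h2 : p.evAt (X := X) h.left (pullback.lift v b hV.w ≫ pullback.fst a p.f)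
      (pullback.lift v b hV.w ≫ pullback.snd a p.f) _ = pullback.lift v b hV.w ≫ z ≫ k :=
    (p.comp_evAt _ _ _ _ (pullback.lift v b hV.w)).symm.trans
      (congrArg (fun t => pullback.lift v b hV.w ≫ t) h1.symm)
  have h3 : pullback.lift v b hV.w ≫ z = 𝟙 V := by
    apply hV.hom_ext
    · rw [Category.assoc, hV.lift_fst, pullback.lift_fst, Category.id_comp]
    · rw [Category.assoc, hV.lift_snd, pullback.lift_snd, Category.id_comp]
  rw [reassoc_of% h3] at h2
  refine Eq.trans (p.evAt_congr _ rfl ?_ ?_) h2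
  · exact (pullback.lift_fst _ _ _).symm
  · exact (pullback.lift_snd _ _ _).symm

/-- The generalized element of `p.ext.obj X` with given shape and values. -/
noncomputable def lift {a : W ⟶ p.A} {v : V ⟶ W} {b : V ⟶ p.B} (hV : IsPullback v b a p.f)
    (k : V ⟶ X.left) (hk : k ≫ X.hom = b ≫ p.s) : W ⟶ (p.ext.obj X).left :=
  (p.exists_lift hV k hk).choose

lemma lift_pr {a : W ⟶ p.A} {v : V ⟶ W} {b : V ⟶ p.B} (hV : IsPullback v b a p.f)
    (k : V ⟶ X.left) (hk : k ≫ X.hom = b ≫ p.s) : p.lift hV k hk ≫ p.pr X = a :=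
  (p.exists_lift hV k hk).choose_spec.choose

lemma lift_evAt {a : W ⟶ p.A} {v : V ⟶ W} {b : V ⟶ p.B} (hV : IsPullback v b a p.f)
    (k : V ⟶ X.left) (hk : k ≫ X.hom = b ≫ p.s) :
    p.evAt (p.lift hV k hk) v b (by rw [lift_pr, hV.w]) = k :=
  (p.exists_lift hV k hk).choose_spec.choose_spec

lemma strength_pr (K : E) (X : Over I) :
    (p.strength.app K X).left ≫ p.pr (tensor K X) = snd K _ ≫ p.pr X := by
  have h := Over.w (((Strength.pullback p.s).comp (Strength.depProd p.f)).app K X)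
  refine Eq.trans ?_ h
  simp only [strength, Strength.comp, Strength.map, Over.comp_left, Over.homMk_left]
  erw [Category.id_comp]
  rfl

lemma strength_eq (K : E) (X : Over I) : (p.strength.app K X).left =
    ((Strength.depProd p.f).app K ((Over.pullback p.s).obj X) ≫
      (PolyMonads.depProd p.f).map ((Strength.pullback p.s).app K X)).left :=
  Category.id_comp _

/-- The strength of `∏_f` is the transpose of the map which evaluates under `K ⊗ -`. -/
lemma counit_strength {A B : E} (f : B ⟶ A) (K : E) (Z : Over B) {Z' : Over B}
    (g : tensor K Z ⟶ Z') :
    (Over.pullback f).map ((Strength.depProd f).app K Z ≫ (depProd f).map g) ≫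
      (depProdAdj f).counit.app Z' =
    pullbackTensor f K ((depProd f).obj Z) ≫ tensorMap (𝟙 K) ((depProdAdj f).counit.app Z) ≫ g := by
  have h : (depProdAdj f).homEquiv _ _ (pullbackTensor f K ((depProd f).obj Z) ≫
      tensorMap (𝟙 K) ((depProdAdj f).counit.app Z) ≫ g) =
      (Strength.depProd f).app K Z ≫ (depProd f).map g := by
    rw [← Category.assoc, Adjunction.homEquiv_naturality_right]
    rfl
  rw [← h]
  exact (Adjunction.homEquiv_counit _ _ _ _).symm.trans (Equiv.symm_apply_apply _ _)

/-- Evaluation at `b` of the value of the strength at `(k, x)` is `(k, x b)`. -/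
lemma strength_ev (K : E) (X : Over I) :
    pullback.map (snd K _ ≫ p.pr X) p.f (p.pr (tensor K X)) p.f (p.strength.app K X).left (𝟙 _)
      (𝟙 _) (by rw [strength_pr, Category.comp_id]) (by simp) ≫ p.ev (tensor K X) =
    CartesianMonoidalCategory.lift (pullback.fst _ _ ≫ fst K _)
      (pullback.map (snd K _ ≫ p.pr X) p.f (p.pr X) p.f (snd K _) (𝟙 _) (𝟙 _)
        (by simp) (by simp) ≫ p.ev X) := by
  let t : K ⊗ ((Over.pullback p.s).obj X).left ⟶ ((Over.pullback p.s).obj (tensor K X)).left :=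
    ((Strength.pullback p.s).app K X).left
  have ht : t ≫ pbFst p.s (tensor K X) = 𝟙 K ⊗ₘ pbFst p.s X := by
    rw [id_tensorHom]
    exact pbLift_fst _ _ _
  have h : pullback.map (snd K _ ≫ p.pr X) p.f (p.pr (tensor K X)) p.f
      (p.strength.app K X).left (𝟙 _) (𝟙 _) (by rw [strength_pr, Category.comp_id]) (by simp) ≫
      p.evalAux (tensor K X) =
      CartesianMonoidalCategory.lift (pullback.fst _ _ ≫ fst K _)
        (pullback.map (snd K _ ≫ p.pr X) p.f (p.pr X) p.f (snd K _) (𝟙 _) (𝟙 _)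
          (by simp) (by simp)) ≫ (𝟙 K ⊗ₘ p.evalAux X) ≫ t := by
    have h1 := congrArg Over.Hom.left
      (counit_strength p.f K ((Over.pullback p.s).obj X) ((Strength.pullback p.s).app K X))
    refine Eq.trans (congrArg (· ≫ p.evalAux (tensor K X)) ?_) (h1.trans ?_)
    · refine pullback.hom_ext ?_ ?_
      · refine (pullback.lift_fst _ _ _).trans (Eq.trans ?_ (pullback.lift_fst _ _ _).symm)
        exact congrArg _ (p.strength_eq K X)
      · exact (pullback.lift_snd _ _ _).trans
          ((Category.comp_id _).trans (pullback.lift_snd _ _ _).symm)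
    · refine congrArg (· ≫ (𝟙 K ⊗ₘ p.evalAux X) ≫ t) ?_
      refine congrArg (CartesianMonoidalCategory.lift _) ?_
      refine pullback.hom_ext ?_ ?_
      · exact (pullback.lift_fst _ _ _).trans (pullback.lift_fst _ _ _).symm
      · exact (pullback.lift_snd _ _ _).trans
          ((Category.comp_id _).symm.trans (pullback.lift_snd _ _ _).symm)
  rw [ev, reassoc_of% h, ht, tensorHom_comp_tensorHom, Category.comp_id (𝟙 K), lift_map]
  refine congrArg₂ CartesianMonoidalCategory.lift (Category.comp_id _) ?_
  rw [ev]

lemma strength_evAt (K : E) (h : W ⟶ K ⊗ (p.ext.obj X).left) (v : V ⟶ W) (b : V ⟶ p.B)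
    (w : v ≫ (h ≫ (p.strength.app K X).left) ≫ p.pr (tensor K X) = b ≫ p.f) :
    p.evAt (h ≫ (p.strength.app K X).left) v b w =
      CartesianMonoidalCategory.lift (v ≫ h ≫ fst _ _) (p.evAt (h ≫ snd _ _) v b
        (by simpa only [Category.assoc, strength_pr] using w)) := by
  have w' : (v ≫ h) ≫ snd K _ ≫ p.pr X = b ≫ p.f := by
    simpa only [Category.assoc, strength_pr] using w
  have h1 := congrArg (fun t => pullback.lift (v ≫ h) b w' ≫ t) (p.strength_ev K X)
  rw [← Category.assoc, comp_lift, pullback.lift_fst_assoc, Category.assoc, ← Category.assoc,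
    Category.assoc v h] at h1
  refine Eq.trans ?_ (h1.trans ?_)
  · refine congrArg (· ≫ p.ev (tensor K X)) ?_
    apply pullback.hom_ext
    · rw [Category.assoc, pullback.map, pullback.lift_fst, pullback.lift_fst,
        pullback.lift_fst_assoc, Category.assoc]
    · rw [Category.assoc, pullback.map, pullback.lift_snd, pullback.lift_snd,
        pullback.lift_snd_assoc, Category.comp_id]
  · refine congrArg (fun t => CartesianMonoidalCategory.lift (v ≫ h ≫ fst _ _) t)
      ((Category.assoc _ _ _).symm.trans (congrArg (· ≫ p.ev X) ?_))
    apply pullback.hom_ext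
    · rw [Category.assoc, pullback.map, pullback.lift_fst, pullback.lift_fst,
        pullback.lift_fst_assoc, Category.assoc]
    · rw [Category.assoc, pullback.map, pullback.lift_snd, pullback.lift_snd,
        pullback.lift_snd_assoc, Category.comp_id]

@[simp]
lemma evAt_id (X : Over I) :
    p.evAt (𝟙 (p.ext.obj X).left) (pullback.fst (p.pr X) p.f) (pullback.snd (p.pr X) p.f)
      (by rw [Category.id_comp, pullback.condition]) = p.ev X := by
  rw [evAt]
  conv_rhs => rw [← Category.id_comp (p.ev X)]
  congr 1
  apply pullback.hom_ext <;> simp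

instance : PreservesLimitsOfShape WalkingCospan p.ext := by
  unfold ext
  have : PreservesLimitsOfShape WalkingCospan (depProd p.f) :=
    (depProdAdj p.f).rightAdjoint_preservesLimits.preservesLimitsOfShape
  have : PreservesLimitsOfShape WalkingCospan (Over.pullback p.s) :=
    (Over.mapPullbackAdj p.s).rightAdjoint_preservesLimits.preservesLimitsOfShape
  infer_instance

end Poly

/-- A commutative square in a slice is a pullback if the underlying square is. -/
lemma isPullback_of_left {X Y Z W : Over I} {f : X ⟶ Y} {g : X ⟶ Z} {h : Y ⟶ W} {k : Z ⟶ W}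
    (H : IsPullback f.left g.left h.left k.left) : IsPullback f g h k :=
  IsPullback.of_map (Over.forget I) (Over.OverMorphism.ext H.w) H

/-- A commutative square is a pullback if every compatible pair of maps factors uniquely. -/
lemma isPullback_of_existsUnique {X Y Z W : E} {f : X ⟶ Y} {g : X ⟶ Z} {h : Y ⟶ W} {k : Z ⟶ W}
    (w : f ≫ h = g ≫ k)
    (ex : ∀ (V : E) (a : V ⟶ Y) (b : V ⟶ Z), a ≫ h = b ≫ k → ∃ l : V ⟶ X, l ≫ f = a ∧ l ≫ g = b)
    (un : ∀ (V : E) (l l' : V ⟶ X), l ≫ f = l' ≫ f → l ≫ g = l' ≫ g → l = l') :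
    IsPullback f g h k := by
  choose l h₁ h₂ using ex
  exact IsPullback.of_isLimit' ⟨w⟩ (PullbackCone.IsLimit.mk _
    (fun s => l _ s.fst s.snd s.condition) (fun s => h₁ _ _ _ _) (fun s => h₂ _ _ _ _)
    (fun s m hm hm' => un _ _ _ (hm.trans (h₁ _ _ _ _).symm) (hm'.trans (h₂ _ _ _ _).symm)))

namespace Poly

/-- A cartesian morphism of polynomials over `u` and `u'`: a diagram
`(J ← D → C → J') ⟶ (I ← B → A → I')` whose middle square is a pullback. -/
structure CartHom (q : Poly J J') (p : Poly I I') (u : J ⟶ I) (u' : J' ⟶ I') where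
  shape : q.A ⟶ p.A
  point : q.B ⟶ p.B
  isPullback : IsPullback q.f point shape p.f
  w_s : q.s ≫ u = point ≫ p.s
  w_t : q.t ≫ u' = shape ≫ p.t

namespace CartHom

variable {q : Poly J J'} {p : Poly I I'} {u : J ⟶ I} {u' : J' ⟶ I'} (m : CartHom q p u u')

lemma isPullback_paste {W V : E} {a : W ⟶ q.A} {v : V ⟶ W} {b : V ⟶ q.B}
    (hV : IsPullback v b a q.f) : IsPullback v (b ≫ m.point) (a ≫ m.shape) p.f :=
  (hV.flip.paste_horiz m.isPullback.flip).flip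

/-- The map of extensions induced by a cartesian morphism of polynomials. -/
noncomputable def extApp (X : Over J) :
    (q.ext.obj X).left ⟶ (p.ext.obj ((Over.map u).obj X)).left :=
  p.lift (m.isPullback_paste (IsPullback.of_hasPullback (q.pr X) q.f)) (q.ev X) (by
    have h := q.ev_w X
    refine (Category.assoc _ _ _).symm.trans ((congrArg (· ≫ u) h).trans ?_)
    rw [Category.assoc, Category.assoc, m.w_s])

lemma extApp_pr (X : Over J) : m.extApp X ≫ p.pr _ = q.pr X ≫ m.shape :=
  lift_pr _ _ _ _

lemma extApp_ev (X : Over J) :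
    p.evAt (m.extApp X) (pullback.fst _ _) (pullback.snd _ q.f ≫ m.point)
      (by rw [extApp_pr, pullback.condition_assoc, m.isPullback.w, Category.assoc]) = q.ev X :=
  lift_evAt _ _ _ _

lemma extApp_evAt {X : Over J} {W V : E} (h : W ⟶ (q.ext.obj X).left)
    (v : V ⟶ W) (b : V ⟶ q.B) (w : v ≫ h ≫ q.pr X = b ≫ q.f) :
    p.evAt (h ≫ m.extApp X) v (b ≫ m.point)
      (by rw [Category.assoc, Category.assoc, extApp_pr, reassoc_of% w, m.isPullback.w]) =
      q.evAt h v b w := by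
  rw [evAt_comp]
  have h1 := congrArg (fun t => pullback.lift (v ≫ h) b (by simpa using w) ≫ t)
    (m.extApp_ev X)
  rw [comp_evAt] at h1
  refine Eq.trans (p.evAt_congr _ rfl ?_ ?_) h1
  · rw [pullback.lift_fst]
  · rw [pullback.lift_snd_assoc]

lemma extApp_naturality {X Y : Over J} (f : X ⟶ Y) :
    (q.ext.map f).left ≫ m.extApp Y = m.extApp X ≫ (p.ext.map ((Over.map u).map f)).left := by
  have hV := m.isPullback_paste (IsPullback.of_hasPullback (q.pr X) q.f)
  have w : pullback.fst (q.pr X) q.f ≫ (q.ext.map f).left ≫ q.pr Y = pullback.snd _ _ ≫ q.f := by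
    rw [map_pr, pullback.condition]
  refine p.hom_ext hV ?_ ?_ ?_
  · rw [Category.assoc, extApp_pr, ← Category.assoc, map_pr]
  · rw [Category.assoc, map_pr, extApp_pr]
  · rw [evAt_map, extApp_ev, m.extApp_evAt _ _ _ w]
    have h := q.evAt_map (𝟙 _) f (pullback.fst _ _) (pullback.snd _ _)
      (by rw [Category.id_comp]; exact w)
    rw [evAt_id] at h
    refine Eq.trans ?_ h
    exact evAt_congr _ _ (Category.id_comp _).symm rfl rfl

/-- The transformation `∑_{u'} q.ext ⟶ p.ext ∑ᵤ` induced by a cartesian morphism of polynomials. -/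
noncomputable def extTrans : q.ext ⋙ Over.map u' ⟶ Over.map u ⋙ p.ext where
  app X := Over.homMk (m.extApp X) (by
    have h : m.extApp X ≫ p.pr _ ≫ p.t = q.pr X ≫ q.t ≫ u' := by
      rw [← Category.assoc, extApp_pr, Category.assoc, m.w_t]
    exact h.trans (Category.assoc _ _ _).symm)
  naturality X Y f := Over.OverMorphism.ext (m.extApp_naturality f)

/-- Cartesianness holds because the middle square is a pullback: an element of `p.ext (∑ᵤ X)` and an
element of `q.ext Y` with the same image in `p.ext (∑ᵤ Y)` have entries over the same points, so the
entries of the former with the shape of the latter form an element of `q.ext X`. -/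
lemma extTrans_cartesian : IsCartesian m.extTrans := by
  intro X Y f
  apply isPullback_of_left
  refine isPullback_of_existsUnique (m.extApp_naturality f) ?_ ?_
  · intro W α β hαβ
    change W ⟶ (q.ext.obj Y).left at α
    change W ⟶ (p.ext.obj ((Over.map u).obj X)).left at β
    change α ≫ m.extApp Y = β ≫ (p.ext.map ((Over.map u).map f)).left at hαβ
    have hV := IsPullback.of_hasPullback (α ≫ q.pr Y) q.f
    have hV' := m.isPullback_paste hV
    have hβ : β ≫ p.pr _ = (α ≫ q.pr Y) ≫ m.shape := by
      rw [Category.assoc, ← extApp_pr, reassoc_of% hαβ, map_pr]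
    let k : pullback (α ≫ q.pr Y) q.f ⟶ X.left := p.evAt β _ _ (by rw [hβ, hV'.w])
    have hk : k ≫ f.left = q.evAt α (pullback.fst _ _) (pullback.snd _ _)
        (by simpa using hV.w) := by
      rw [← m.extApp_evAt]
      refine (p.evAt_map β ((Over.map u).map f) _ _ ?_).symm.trans (p.evAt_congr _ hαβ.symm rfl rfl)
      rw [Category.assoc, map_pr, hβ, hV'.w]
    have hk' : k ≫ X.hom = pullback.snd _ _ ≫ q.s := by
      rw [← Over.w f, reassoc_of% hk, evAt_w]
    have e₁ : q.lift hV k hk' ≫ (q.ext.map f).left = α := by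
      refine q.hom_ext hV ?_ rfl ?_
      · rw [Category.assoc, map_pr, lift_pr]
      · rw [evAt_map, lift_evAt, hk]
    have e₂ : q.lift hV k hk' ≫ m.extApp X = β := by
      refine p.hom_ext hV' ?_ hβ ?_
      · rw [Category.assoc, extApp_pr, ← Category.assoc, lift_pr]
      · rw [m.extApp_evAt _ _ _ (by rw [lift_pr, hV.w]), lift_evAt]
    exact ⟨q.lift hV k hk', e₁, e₂⟩
  · intro W l l' h₁ h₂
    change W ⟶ (q.ext.obj X).left at l l'
    change l ≫ (q.ext.map f).left = l' ≫ (q.ext.map f).left at h₁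
    change l ≫ m.extApp X = l' ≫ m.extApp X at h₂
    have ha : l' ≫ q.pr X = l ≫ q.pr X := by
      rw [← q.map_pr f, reassoc_of% h₁]
    have hV := IsPullback.of_hasPullback (l ≫ q.pr X) q.f
    refine q.hom_ext hV rfl ha ?_
    rw [← m.extApp_evAt, ← m.extApp_evAt]
    exact p.evAt_congr _ h₂ rfl rfl

lemma extTrans_strong : IsStrong (q.strength.comp (Strength.map u'))
    ((Strength.map u).comp p.strength) m.extTrans := by
  intro K X
  ext1
  have hV := IsPullback.of_hasPullback (snd K _ ≫ q.pr X) q.f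
  have hV' := m.isPullback_paste hV
  have h₁ : ((q.strength.comp (Strength.map u')).app K X ≫ m.extTrans.app (tensor K X)).left =
      (q.strength.app K X).left ≫ m.extApp (tensor K X) :=
    congrArg (· ≫ m.extApp (tensor K X)) (Category.id_comp _)
  let e : tensor K ((Over.map u).obj X) ⟶ (Over.map u).obj (tensor K X) :=
    (Strength.map u).app K X
  have h₂ : (tensorMap (𝟙 K) (m.extTrans.app X) ≫
      ((Strength.map u).comp p.strength).app K X).left =
      ((𝟙 K ⊗ₘ m.extApp X) ≫ (p.strength.app K ((Over.map u).obj X)).left) ≫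
        (p.ext.map e).left := (Category.assoc _ _ _).symm
  rw [h₁, h₂]
  have w : pullback.fst (snd K _ ≫ q.pr X) q.f ≫ snd K _ ≫ q.pr X = pullback.snd _ _ ≫ q.f := hV.w
  refine p.hom_ext hV' ?_ ?_ ?_
  · rw [Category.assoc, extApp_pr, ← Category.assoc, strength_pr]
  · rw [Category.assoc, Category.assoc, map_pr, strength_pr, tensorHom_snd_assoc, extApp_pr,
      Category.assoc]
  · rw [evAt_map, m.extApp_evAt _ _ _ (by rw [strength_pr, w]), p.strength_evAt]
    have h₃ := q.strength_evAt (X := X) K (𝟙 _) (pullback.fst (snd K _ ≫ q.pr X) q.f)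
      (pullback.snd _ _) (by rw [Category.id_comp, strength_pr, w])
    refine (q.evAt_congr _ (Category.id_comp _).symm rfl rfl).trans (h₃.trans ?_)
    refine Eq.trans ?_ (Category.comp_id _).symm
    refine congrArg₂ CartesianMonoidalCategory.lift ?_ ?_
    · rw [tensorHom_fst, Category.comp_id, Category.id_comp]
    · rw [← m.extApp_evAt]
      refine p.evAt_congr _ ?_ rfl rfl
      rw [tensorHom_snd, Category.id_comp]

end CartHom

section Restrict

variable (p : Poly I I') {u : J ⟶ I} {u' : J' ⟶ I'} {N : Over J'}
  (g : (Over.map u').obj N ⟶ p.ext.obj ((Over.map u).obj (overOne J)))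

/-- The underlying map of `g : ∑_{u'} N ⟶ p.ext (∑ᵤ 1)`. -/
noncomputable def genericMap : N.left ⟶ (p.ext.obj ((Over.map u).obj (overOne J))).left := g.left

/-- The polynomial `J ← N ×_A B → N → J'` obtained from `p = (I ← B → A → I')` by restriction along
a map `g : ∑_{u'} N ⟶ p.ext (∑ᵤ 1)`. -/
noncomputable def restrict : Poly J J' where
  B := pullback (p.genericMap g ≫ p.pr _) p.f
  A := N.left
  s := p.evAt (p.genericMap g) (pullback.fst _ _) (pullback.snd _ _) pullback.condition
  f := pullback.fst _ _
  t := N.hom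

/-- The restriction of a polynomial has a cartesian morphism to the polynomial. -/
noncomputable def restrictHom : CartHom (p.restrict g) p u u' where
  shape := p.genericMap g ≫ p.pr _
  point := pullback.snd _ _
  isPullback := IsPullback.of_hasPullback (p.genericMap g ≫ p.pr _) p.f
  w_s := by
    refine Eq.trans ?_ (p.evAt_w (p.genericMap g) (pullback.fst _ _) (pullback.snd _ _)
      pullback.condition)
    exact congrArg _ (Category.id_comp u).symm
  w_t := (Over.w g).symm.trans (Category.assoc _ _ _).symm

lemma evAt_one (q : Poly J J') {W V : E} (h : W ⟶ (q.ext.obj (overOne J)).left) (v : V ⟶ W)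
    (b : V ⟶ q.B) (w : v ≫ h ≫ q.pr _ = b ≫ q.f) : q.evAt h v b w = b ≫ q.s :=
  (Category.comp_id _).symm.trans (q.evAt_w h v b w)

lemma isPullback_id (q : Poly J J') : IsPullback q.f (𝟙 q.B) (𝟙 q.A) q.f :=
  IsPullback.of_vert_isIso ⟨by simp⟩

lemma pr_one_lift (q : Poly J J') : q.pr (overOne J) ≫ q.lift (X := overOne J) q.isPullback_id q.s
    ((Category.comp_id _).trans (Category.id_comp _).symm) = 𝟙 _ := by
  refine q.hom_ext (IsPullback.of_hasPullback (q.pr (overOne J)) q.f) ?_ (Category.id_comp _) ?_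
  · rw [Category.assoc, lift_pr, Category.comp_id]
  · rw [evAt_one, evAt_one]

/-- The value of an extension at the terminal object is the object of shapes. -/
noncomputable def extOneIso (q : Poly J J') : q.ext.obj (overOne J) ≅ Over.mk q.t :=
  Over.isoMk ⟨q.pr (overOne J), q.lift (X := overOne J) q.isPullback_id q.s
    ((Category.comp_id _).trans (Category.id_comp _).symm), q.pr_one_lift, q.lift_pr _ _ _⟩ rfl

/-- The map `g : ∑_{u'} N ⟶ p.ext (∑ᵤ 1)` as a generalized element of stage the object of shapes of
the restriction. -/
noncomputable def restrictMap :
    (p.restrict g).A ⟶ (p.ext.obj ((Over.map u).obj (overOne J))).left :=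
  g.left

lemma restrictMap_w : (p.restrict g).f ≫ p.restrictMap g ≫ p.pr _ =
    (p.restrictHom g).point ≫ p.f :=
  (p.restrictHom g).isPullback.w

lemma restrictMap_evAt : p.evAt (p.restrictMap g) (p.restrict g).f (p.restrictHom g).point
    (p.restrictMap_w g) = (p.restrict g).s := rfl

/-- The component at the terminal object of the transformation induced by `restrictHom` is `g`. -/
lemma restrictHom_one :
    (Over.map u').map ((p.restrict g).extOneIso).hom ≫ g =
      (p.restrictHom g).extTrans.app (overOne J) := by
  ext1
  have hV := IsPullback.of_hasPullback ((p.restrict g).pr (overOne J)) (p.restrict g).f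
  have hV' := (p.restrictHom g).isPullback_paste hV
  change (p.restrict g).pr (overOne J) ≫ p.restrictMap g = (p.restrictHom g).extApp (overOne J)
  refine p.hom_ext hV' (Category.assoc _ _ _) ((p.restrictHom g).extApp_pr _) ?_
  rw [CartHom.extApp_ev, evAt_comp, ← evAt_id, evAt_one, ← restrictMap_evAt, comp_evAt]
  exact p.evAt_congr _ rfl pullback.condition rfl

end Restrict

end Poly

/-- A polynomial functor preserves pullbacks. -/
lemma IsPolynomialFunctor.preservesPullbacks {F : Over I ⥤ Over J} {σ : Strength F}
    (h : IsPolynomialFunctor σ) : PreservesLimitsOfShape WalkingCospan F := by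
  obtain ⟨p, e, -⟩ := h
  exact preservesLimitsOfShape_of_natIso e.symm

lemma IsStrong.inv {F G : Over I ⥤ Over J} {σ : Strength F} {τ : Strength G} {e : F ≅ G}
    (h : IsStrong σ τ e.hom) : IsStrong τ σ e.inv := by
  intro K X
  rw [← cancel_mono (e.hom.app (tensor K X)), Category.assoc, Category.assoc,
    Iso.inv_hom_id_app, Category.comp_id, h K X, ← Category.assoc, tensorMap_comp,
    Iso.inv_hom_id_app, Category.comp_id, tensorMap_id, Category.id_comp]

/-- Every map `g : ∑_{u'} N ⟶ G (∑ᵤ 1)` into a value of a polynomial functor is, up to isomorphism,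
the component at the terminal object of a cartesian strong transformation whose domain is
polynomial. -/
lemma IsPolynomialFunctor.exists_restrict {G : Over I ⥤ Over I'} {τ : Strength G}
    (h : IsPolynomialFunctor τ) {u : J ⟶ I} {u' : J' ⟶ I'} {N : Over J'}
    (g : (Over.map u').obj N ⟶ G.obj ((Over.map u).obj (overOne J))) :
    ∃ (q : Poly J J') (φ : q.ext ⋙ Over.map u' ⟶ Over.map u ⋙ G)
      (n : q.ext.obj (overOne J) ≅ N), IsCartesian φ ∧
      IsStrong (q.strength.comp (Strength.map u')) ((Strength.map u).comp τ) φ ∧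
      (Over.map u').map n.hom ≫ g = φ.app (overOne J) := by
  obtain ⟨p, e, he⟩ := h
  let g' := g ≫ e.hom.app _
  refine ⟨p.restrict g', (p.restrictHom g').extTrans ≫ Functor.whiskerLeft _ e.inv,
    (p.restrict g').extOneIso, ?_, ?_, ?_⟩
  · exact (p.restrictHom g').extTrans_cartesian.comp (.of_isIso _)
  · exact (p.restrictHom g').extTrans_strong.comp (.whiskerLeft _ he.inv)
  · have h : g = g' ≫ e.inv.app _ := by simp [g']
    exact (congrArg ((Over.map u').map (p.restrict g').extOneIso.hom ≫ ·) h).trans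
      ((Category.assoc _ _ _).symm.trans (congrArg (· ≫ e.inv.app _) (p.restrictHom_one g')))

end PolyElements

/-! ### Monads determined by their value at the terminal object -/

lemma comp_pullback_lift {𝒞 : Type u} [Category.{v} 𝒞] {V W X Y Z : 𝒞} {f : X ⟶ Z} {g : Y ⟶ Z}
    [HasPullback f g] (c : V ⟶ W) (a : W ⟶ X) (b : W ⟶ Y) (w : a ≫ f = b ≫ g) :
    c ≫ pullback.lift a b w = pullback.lift (c ≫ a) (c ≫ b)
      (by rw [Category.assoc, w, Category.assoc]) := by
  apply pullback.hom_ext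
  · rw [Category.assoc, pullback.lift_fst, pullback.lift_fst]
  · rw [Category.assoc, pullback.lift_snd, pullback.lift_snd]

section CartesianLift

variable {E : Type u} [Category.{v} E] {I J : E}

@[simp]
lemma comp_toOne {X Y : Over I} (f : X ⟶ Y) : f ≫ toOne Y = toOne X := by
  ext
  simp

@[simp]
lemma comp_toOne_assoc {X Y Z : Over I} (f : X ⟶ Y) (g : overOne I ⟶ Z) :
    f ≫ toOne Y ≫ g = toOne X ≫ g := by
  rw [← Category.assoc, comp_toOne]

lemma toOne_overOne (I : E) : toOne (overOne I) = 𝟙 (overOne I) := rfl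

lemma overMap_injective {u : J ⟶ I} {X Y : Over J} {f g : X ⟶ Y}
    (h : (Over.map u).map f = (Over.map u).map g) : f = g := by
  have h' := congrArg Over.Hom.left h
  exact Over.OverMorphism.ext h'

/-- A map between dependent sums along `u` which is compatible with the projections to the base of
`u` comes from a map in the slice over that base. -/
def overMapPreimage {u : J ⟶ I} {X Y : Over J} (f : (Over.map u).obj X ⟶ (Over.map u).obj Y)
    (hf : f ≫ (Over.map u).map (toOne Y) = (Over.map u).map (toOne X)) : X ⟶ Y :=
  Over.homMk f.left (congrArg Over.Hom.left hf)

@[simp]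
lemma overMap_preimage {u : J ⟶ I} {X Y : Over J} (f : (Over.map u).obj X ⟶ (Over.map u).obj Y)
    (hf : f ≫ (Over.map u).map (toOne Y) = (Over.map u).map (toOne X)) :
    (Over.map u).map (overMapPreimage f hf) = f := by
  ext1
  rfl

variable {F : Over J ⥤ Over J} {G : Over I ⥤ Over I} {u : J ⟶ I}
  {φ : F ⋙ Over.map u ⟶ Over.map u ⋙ G}

lemma trans_naturality (φ : F ⋙ Over.map u ⟶ Over.map u ⋙ G) {X Y : Over J} (f : X ⟶ Y) :
    (Over.map u).map (F.map f) ≫ φ.app Y = φ.app X ≫ G.map ((Over.map u).map f) :=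
  φ.naturality f

lemma trans_naturality_assoc (φ : F ⋙ Over.map u ⟶ Over.map u ⋙ G) {X Y : Over J} (f : X ⟶ Y)
    {Z : Over I} (g : G.obj ((Over.map u).obj Y) ⟶ Z) :
    (Over.map u).map (F.map f) ≫ φ.app Y ≫ g = φ.app X ≫ G.map ((Over.map u).map f) ≫ g :=
  φ.naturality_assoc f g

lemma isPullback_trans (hφ : IsCartesian φ) {X Y : Over J} (f : X ⟶ Y) :
    IsPullback (φ.app X) ((Over.map u).map (F.map f)) (G.map ((Over.map u).map f)) (φ.app Y) :=
  (hφ f).flip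

/-- If `φ : ∑ᵤ F ⟶ G ∑ᵤ` is cartesian, then a map to `F Y` is determined by the induced maps to
`F 1` and to `G (∑ᵤ Y)`. -/
lemma cartesian_hom_ext (hφ : IsCartesian φ) {W Y : Over J} {l l' : W ⟶ F.obj Y}
    (h₁ : l ≫ F.map (toOne Y) = l' ≫ F.map (toOne Y))
    (h₂ : (Over.map u).map l ≫ φ.app Y = (Over.map u).map l' ≫ φ.app Y) : l = l' := by
  apply overMap_injective (u := u)
  refine (isPullback_trans hφ (toOne Y)).hom_ext h₂ ?_
  rw [← Functor.map_comp, ← Functor.map_comp, h₁]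

lemma exists_cartesianLift (hφ : IsCartesian φ) {W Y : Over J} (k : W ⟶ F.obj (overOne J))
    (h : (Over.map u).obj W ⟶ G.obj ((Over.map u).obj Y))
    (w : h ≫ G.map ((Over.map u).map (toOne Y)) = (Over.map u).map k ≫ φ.app (overOne J)) :
    ∃ l : W ⟶ F.obj Y, l ≫ F.map (toOne Y) = k ∧ (Over.map u).map l ≫ φ.app Y = h := by
  have H := isPullback_trans hφ (toOne Y)
  have h₁ : H.lift h ((Over.map u).map k) w ≫ (Over.map u).map (F.map (toOne Y)) =
      (Over.map u).map k := H.lift_snd _ _ _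
  have h₂ : H.lift h ((Over.map u).map k) w ≫ (Over.map u).map (toOne (F.obj Y)) =
      (Over.map u).map (toOne W) := by
    rw [← comp_toOne (F.map (toOne Y)), Functor.map_comp]
    refine (Category.assoc _ _ _).symm.trans ((congrArg (· ≫ _) h₁).trans ?_)
    rw [← Functor.map_comp, comp_toOne]
  refine ⟨overMapPreimage (H.lift h ((Over.map u).map k) w) h₂, ?_, ?_⟩
  · apply overMap_injective (u := u)
    rw [Functor.map_comp, overMap_preimage, h₁]
  · rw [overMap_preimage]
    exact H.lift_fst _ _ _

/-- The map to `F Y` with given components in `F 1` and in `G (∑ᵤ Y)`, for a cartesian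
transformation `∑ᵤ F ⟶ G ∑ᵤ`. -/
noncomputable def cartesianLift (hφ : IsCartesian φ) {W Y : Over J} (k : W ⟶ F.obj (overOne J))
    (h : (Over.map u).obj W ⟶ G.obj ((Over.map u).obj Y))
    (w : h ≫ G.map ((Over.map u).map (toOne Y)) = (Over.map u).map k ≫ φ.app (overOne J)) :
    W ⟶ F.obj Y :=
  (exists_cartesianLift hφ k h w).choose

lemma cartesianLift_toOne (hφ : IsCartesian φ) {W Y : Over J} (k : W ⟶ F.obj (overOne J))
    (h : (Over.map u).obj W ⟶ G.obj ((Over.map u).obj Y))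
    (w : h ≫ G.map ((Over.map u).map (toOne Y)) = (Over.map u).map k ≫ φ.app (overOne J)) :
    cartesianLift hφ k h w ≫ F.map (toOne Y) = k :=
  (exists_cartesianLift hφ k h w).choose_spec.1

lemma cartesianLift_app (hφ : IsCartesian φ) {W Y : Over J} (k : W ⟶ F.obj (overOne J))
    (h : (Over.map u).obj W ⟶ G.obj ((Over.map u).obj Y))
    (w : h ≫ G.map ((Over.map u).map (toOne Y)) = (Over.map u).map k ≫ φ.app (overOne J)) :
    (Over.map u).map (cartesianLift hφ k h w) ≫ φ.app Y = h :=
  (exists_cartesianLift hφ k h w).choose_spec.2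

end CartesianLift

section MonadAtOne

variable {E : Type u} [Category.{v} E] {I J : E}
  {F : Over J ⥤ Over J} {P : Monad (Over I)} {u : J ⟶ I}

/-- A unit `e : 1 ⟶ F 1` and a multiplication `m : F F 1 ⟶ F 1` which behave like the components
at the terminal object of a monad structure on `F` for which `φ : ∑ᵤ F ⟶ P ∑ᵤ` is a morphism of
monads. The components of the unit and of the multiplication at `F 1`, which occur in the unit law
and in the associativity law, are characterized by their images in `F 1` and in `P (∑ᵤ F 1)`. -/
structure IsMonadAtOne (φ : F ⋙ Over.map u ⟶ Over.map u ⋙ P.toFunctor)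
    (e : overOne J ⟶ F.obj (overOne J)) (m : F.obj (F.obj (overOne J)) ⟶ F.obj (overOne J)) :
    Prop where
  unit_app : (Over.map u).map e ≫ φ.app (overOne J) = P.η.app ((Over.map u).obj (overOne J))
  mult_app : (Over.map u).map m ≫ φ.app (overOne J) =
    φ.app (F.obj (overOne J)) ≫ P.map (φ.app (overOne J)) ≫
      P.μ.app ((Over.map u).obj (overOne J))
  left_unit (l : F.obj (overOne J) ⟶ F.obj (F.obj (overOne J)))
    (h₁ : l ≫ F.map (toOne (F.obj (overOne J))) = toOne (F.obj (overOne J)) ≫ e)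
    (h₂ : (Over.map u).map l ≫ φ.app (F.obj (overOne J)) =
      P.η.app ((Over.map u).obj (F.obj (overOne J)))) : l ≫ m = 𝟙 _
  right_unit : F.map e ≫ m = 𝟙 _
  assoc (l : F.obj (F.obj (F.obj (overOne J))) ⟶ F.obj (F.obj (overOne J)))
    (h₁ : l ≫ F.map (toOne (F.obj (overOne J))) =
      F.map (F.map (toOne (F.obj (overOne J)))) ≫ m)
    (h₂ : (Over.map u).map l ≫ φ.app (F.obj (overOne J)) =
      φ.app (F.obj (F.obj (overOne J))) ≫ P.map (φ.app (F.obj (overOne J))) ≫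
        P.μ.app ((Over.map u).obj (F.obj (overOne J)))) : F.map m ≫ m = l ≫ m

variable {φ : F ⋙ Over.map u ⟶ Over.map u ⋙ P.toFunctor} {e : overOne J ⟶ F.obj (overOne J)}
  {m : F.obj (F.obj (overOne J)) ⟶ F.obj (overOne J)}

namespace IsMonadAtOne

section Lifts

variable (H : IsMonadAtOne φ e m) (hφ : IsCartesian φ)

/-- The component at `Y` of the unit. -/
noncomputable def unit (Y : Over J) : Y ⟶ F.obj Y :=
  cartesianLift hφ (toOne Y ≫ e) (P.η.app ((Over.map u).obj Y)) (by
    rw [Functor.map_comp, Category.assoc]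
    exact (P.η.naturality _).symm.trans (congrArg (_ ≫ ·) H.unit_app.symm))

lemma unit_toOne (Y : Over J) : H.unit hφ Y ≫ F.map (toOne Y) = toOne Y ≫ e :=
  cartesianLift_toOne _ _ _ _

lemma unit_trans (Y : Over J) :
    (Over.map u).map (H.unit hφ Y) ≫ φ.app Y = P.η.app ((Over.map u).obj Y) :=
  cartesianLift_app _ _ _ _

/-- The component at `Y` of the multiplication. -/
noncomputable def mult (Y : Over J) : F.obj (F.obj Y) ⟶ F.obj Y :=
  cartesianLift hφ (F.map (F.map (toOne Y)) ≫ m)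
    (φ.app (F.obj Y) ≫ P.map (φ.app Y) ≫ P.μ.app ((Over.map u).obj Y)) (by
    have h := P.μ.naturality ((Over.map u).map (toOne Y))
    dsimp only [Functor.comp_map] at h
    rw [Functor.map_comp, Category.assoc, Category.assoc, Category.assoc, H.mult_app, ← h,
      trans_naturality_assoc, ← P.map_comp_assoc, ← P.map_comp_assoc, trans_naturality])

lemma mult_toOne (Y : Over J) :
    H.mult hφ Y ≫ F.map (toOne Y) = F.map (F.map (toOne Y)) ≫ m :=
  cartesianLift_toOne _ _ _ _

lemma mult_trans (Y : Over J) : (Over.map u).map (H.mult hφ Y) ≫ φ.app Y =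
    φ.app (F.obj Y) ≫ P.map (φ.app Y) ≫ P.μ.app ((Over.map u).obj Y) :=
  cartesianLift_app _ _ _ _

lemma unit_naturality {X Y : Over J} (f : X ⟶ Y) :
    f ≫ H.unit hφ Y = H.unit hφ X ≫ F.map f := by
  apply cartesian_hom_ext hφ
  · rw [Category.assoc, Category.assoc, ← F.map_comp, comp_toOne, unit_toOne, unit_toOne,
      ← Category.assoc, comp_toOne]
  · rw [Functor.map_comp, Functor.map_comp, Category.assoc, Category.assoc, trans_naturality,
      unit_trans, ← Category.assoc, unit_trans]
    exact P.η.naturality _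

lemma mult_naturality {X Y : Over J} (f : X ⟶ Y) :
    F.map (F.map f) ≫ H.mult hφ Y = H.mult hφ X ≫ F.map f := by
  apply cartesian_hom_ext hφ
  · rw [Category.assoc, Category.assoc, ← F.map_comp f, comp_toOne, mult_toOne, mult_toOne,
      ← Category.assoc, ← F.map_comp, ← F.map_comp, comp_toOne]
  · have h := P.μ.naturality ((Over.map u).map f)
    dsimp only [Functor.comp_map] at h
    rw [Functor.map_comp, Functor.map_comp, Category.assoc, Category.assoc, trans_naturality,
      mult_trans, reassoc_of% H.mult_trans hφ X, ← h, trans_naturality_assoc, ← P.map_comp_assoc,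
      ← P.map_comp_assoc, trans_naturality]

/-- The monad structure determined by its components at the terminal object. -/
noncomputable def monad : Monad (Over J) where
  toFunctor := F
  η := { app := H.unit hφ, naturality := fun _ _ f => H.unit_naturality hφ f }
  μ := { app := H.mult hφ, naturality := fun _ _ f => H.mult_naturality hφ f }
  assoc Y := by
    change F.map (H.mult hφ Y) ≫ H.mult hφ Y = H.mult hφ (F.obj Y) ≫ H.mult hφ Y
    apply cartesian_hom_ext hφ
    · rw [Category.assoc, Category.assoc, mult_toOne, ← F.map_comp_assoc, mult_toOne,
        ← reassoc_of% H.mult_naturality hφ (F.map (toOne Y)), F.map_comp, Category.assoc,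
        H.assoc _ (H.mult_toOne hφ _) (H.mult_trans hφ _)]
    · have h := P.μ.naturality (φ.app Y)
      have h' := P.assoc ((Over.map u).obj Y)
      dsimp only [Functor.comp_map] at h
      rw [Functor.map_comp, Functor.map_comp, Category.assoc, Category.assoc, mult_trans,
        trans_naturality_assoc, ← P.map_comp_assoc, mult_trans,
        reassoc_of% H.mult_trans hφ (F.obj Y)]
      simp only [Functor.map_comp, Category.assoc]
      rw [← reassoc_of% h, h']
  left_unit Y := by
    change H.unit hφ (F.obj Y) ≫ H.mult hφ Y = 𝟙 (F.obj Y)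
    apply cartesian_hom_ext hφ
    · rw [Category.assoc, mult_toOne, ← reassoc_of% H.unit_naturality hφ (F.map (toOne Y)),
        H.left_unit _ (H.unit_toOne hφ _) (H.unit_trans hφ _), Category.comp_id, Category.id_comp]
    · have h := P.η.naturality (φ.app Y)
      have h' := P.left_unit ((Over.map u).obj Y)
      dsimp only [Functor.id_map] at h
      rw [Functor.map_comp, Category.assoc, mult_trans, reassoc_of% H.unit_trans hφ (F.obj Y),
        ← reassoc_of% h, h', (Over.map u).map_id]
      exact (Category.comp_id _).trans (Category.id_comp _).symm
  right_unit Y := by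
    change F.map (H.unit hφ Y) ≫ H.mult hφ Y = 𝟙 (F.obj Y)
    apply cartesian_hom_ext hφ
    · rw [Category.assoc, mult_toOne, ← F.map_comp_assoc, unit_toOne, F.map_comp, Category.assoc,
        H.right_unit, Category.comp_id, Category.id_comp]
    · have h' := P.right_unit ((Over.map u).obj Y)
      rw [Functor.map_comp, Category.assoc, mult_trans, trans_naturality_assoc, ← P.map_comp_assoc,
        unit_trans, h', (Over.map u).map_id]
      exact (Category.comp_id _).trans (Category.id_comp _).symm

lemma unit_one : H.unit hφ (overOne J) = e := by
  have h := H.unit_toOne hφ (overOne J)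
  rwa [toOne_overOne, F.map_id, Category.comp_id, Category.id_comp] at h

lemma mult_one : H.mult hφ (overOne J) = m := by
  have h := H.mult_toOne hφ (overOne J)
  rwa [toOne_overOne, F.map_id, F.map_id, Category.comp_id, Category.id_comp] at h

end Lifts

end IsMonadAtOne

variable [HasPullbacks E]

/-- The isomorphism `∑ᵤ F F 1 ≅ P (∑ᵤ F 1) ×_{P (∑ᵤ 1)} ∑ᵤ F 1` given by a cartesian
transformation. -/
noncomputable def compositeIso (hφ : IsCartesian φ) :
    (Over.map u).obj (F.obj (F.obj (overOne J))) ≅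
      pullback (P.map ((Over.map u).map (toOne (F.obj (overOne J))))) (φ.app (overOne J)) :=
  (isPullback_trans hφ (toOne (F.obj (overOne J)))).isoPullback

lemma compositeIso_hom_fst (hφ : IsCartesian φ) : (compositeIso hφ).hom ≫
    pullback.fst (P.map ((Over.map u).map (toOne (F.obj (overOne J))))) (φ.app (overOne J)) =
      φ.app (F.obj (overOne J)) :=
  IsPullback.isoPullback_hom_fst _

lemma compositeIso_hom_snd (hφ : IsCartesian φ) : (compositeIso hφ).hom ≫
    pullback.snd (P.map ((Over.map u).map (toOne (F.obj (overOne J))))) (φ.app (overOne J)) =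
      (Over.map u).map (F.map (toOne (F.obj (overOne J)))) :=
  IsPullback.isoPullback_hom_snd _

/-- The endospan `P (∑ᵤ 1) ← ∑ᵤ F 1 → ∑ᵤ 1` with the unit `e` and the multiplication `m`. -/
noncomputable def spanAtOne (hφ : IsCartesian φ) (e : overOne J ⟶ F.obj (overOne J))
    (m : F.obj (F.obj (overOne J)) ⟶ F.obj (overOne J)) : PMulticatData P where
  obj := (Over.map u).obj (overOne J)
  arr := (Over.map u).obj (F.obj (overOne J))
  dom := φ.app (overOne J)
  cod := (Over.map u).map (toOne _)
  unit := (Over.map u).map e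
  mult := (compositeIso hφ).inv ≫ (Over.map u).map m

/-- Since `φ` is cartesian, `∑ᵤ F F F 1` is the pullback which defines the triple composite of the
endospan `P (∑ᵤ 1) ← ∑ᵤ F 1 → ∑ᵤ 1`. -/
lemma isPullback_triple (hφ : IsCartesian φ) :
    IsPullback (φ.app (F.obj (F.obj (overOne J))) ≫ P.map (compositeIso hφ).hom)
      ((Over.map u).map (F.map (toOne (F.obj (F.obj (overOne J))))))
      (P.map (pullback.snd (P.map ((Over.map u).map (toOne (F.obj (overOne J)))))
        (φ.app (overOne J)) ≫ (Over.map u).map (toOne (F.obj (overOne J)))))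
      (φ.app (overOne J)) := by
  refine IsPullback.of_iso (isPullback_trans hφ (toOne (F.obj (F.obj (overOne J)))))
    (Iso.refl _) (P.mapIso (compositeIso hφ)) (Iso.refl _) (Iso.refl _) ?_ ?_ ?_ ?_
  · exact (Category.id_comp _).symm
  · exact (Category.comp_id _).trans (Category.id_comp _).symm
  · refine (Category.comp_id _).trans ?_
    change _ = P.map (compositeIso hφ).hom ≫ _
    rw [← P.map_comp, reassoc_of% compositeIso_hom_snd hφ, ← Functor.map_comp, comp_toOne]
  · exact (Category.comp_id _).trans (Category.id_comp _).symm

section SpanAtOne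

variable (hφ : IsCartesian φ)

/-- The multiplication of `spanAtOne`. -/
noncomputable def spanMult (m : F.obj (F.obj (overOne J)) ⟶ F.obj (overOne J)) :
    pullback (P.map ((Over.map u).map (toOne (F.obj (overOne J))))) (φ.app (overOne J)) ⟶
      (Over.map u).obj (F.obj (overOne J)) :=
  (compositeIso hφ).inv ≫ (Over.map u).map m

lemma compositeIso_spanMult (m : F.obj (F.obj (overOne J)) ⟶ F.obj (overOne J)) :
    (compositeIso hφ).hom ≫ spanMult hφ m = (Over.map u).map m :=
  Iso.hom_inv_id_assoc _ _

lemma spanMult_dom_iff :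
    spanMult hφ m ≫ φ.app (overOne J) = pullback.fst _ _ ≫ P.map (φ.app (overOne J)) ≫
      P.μ.app ((Over.map u).obj (overOne J)) ↔
    (Over.map u).map m ≫ φ.app (overOne J) = φ.app (F.obj (overOne J)) ≫
      P.map (φ.app (overOne J)) ≫ P.μ.app ((Over.map u).obj (overOne J)) := by
  rw [spanMult, Category.assoc, Iso.inv_comp_eq, reassoc_of% compositeIso_hom_fst hφ]

lemma spanMult_cod :
    spanMult hφ m ≫ (Over.map u).map (toOne _) =
      pullback.snd _ _ ≫ (Over.map u).map (toOne _) := by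
  rw [spanMult, Category.assoc, Iso.inv_comp_eq, reassoc_of% compositeIso_hom_snd hφ,
    ← Functor.map_comp, ← Functor.map_comp, comp_toOne, comp_toOne]

lemma lift_eq_map_compositeIso {W : Over J} (l : W ⟶ F.obj (F.obj (overOne J)))
    {a : (Over.map u).obj W ⟶ P.obj ((Over.map u).obj (F.obj (overOne J)))}
    {b : (Over.map u).obj W ⟶ (Over.map u).obj (F.obj (overOne J))}
    (w : a ≫ P.map ((Over.map u).map (toOne (F.obj (overOne J)))) = b ≫ φ.app (overOne J))
    (h₁ : (Over.map u).map (l ≫ F.map (toOne (F.obj (overOne J)))) = b)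
    (h₂ : (Over.map u).map l ≫ φ.app (F.obj (overOne J)) = a) :
    pullback.lift a b w = (Over.map u).map l ≫ (compositeIso hφ).hom := by
  apply pullback.hom_ext
  · rw [pullback.lift_fst, Category.assoc, compositeIso_hom_fst, h₂]
  · rw [pullback.lift_snd, Category.assoc, compositeIso_hom_snd, ← Functor.map_comp, h₁]

lemma lift_spanMult {W : Over J} (l : W ⟶ F.obj (F.obj (overOne J)))
    {a : (Over.map u).obj W ⟶ P.obj ((Over.map u).obj (F.obj (overOne J)))}
    {b : (Over.map u).obj W ⟶ (Over.map u).obj (F.obj (overOne J))}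
    (w : a ≫ P.map ((Over.map u).map (toOne (F.obj (overOne J)))) = b ≫ φ.app (overOne J))
    (h₁ : (Over.map u).map (l ≫ F.map (toOne (F.obj (overOne J)))) = b)
    (h₂ : (Over.map u).map l ≫ φ.app (F.obj (overOne J)) = a) :
    pullback.lift a b w ≫ spanMult hφ m = (Over.map u).map (l ≫ m) := by
  rw [lift_eq_map_compositeIso hφ l w h₁ h₂, Category.assoc, compositeIso_spanMult,
    Functor.map_comp]

lemma lift_spanMult_eq_id_iff (l : F.obj (overOne J) ⟶ F.obj (F.obj (overOne J)))
    {a : (Over.map u).obj (F.obj (overOne J)) ⟶ P.obj ((Over.map u).obj (F.obj (overOne J)))}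
    {b : (Over.map u).obj (F.obj (overOne J)) ⟶ (Over.map u).obj (F.obj (overOne J))}
    (w : a ≫ P.map ((Over.map u).map (toOne (F.obj (overOne J)))) = b ≫ φ.app (overOne J))
    (h₁ : (Over.map u).map (l ≫ F.map (toOne (F.obj (overOne J)))) = b)
    (h₂ : (Over.map u).map l ≫ φ.app (F.obj (overOne J)) = a) :
    pullback.lift a b w ≫ spanMult hφ m = 𝟙 _ ↔ l ≫ m = 𝟙 _ := by
  rw [lift_spanMult hφ l w h₁ h₂]
  exact ⟨fun h => overMap_injective (u := u) (h.trans ((Over.map u).map_id _).symm),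
    fun h => (congrArg _ h).trans ((Over.map u).map_id _)⟩

/-- The object of pairs of composable pairs of `spanAtOne`. -/
noncomputable abbrev tripleObj (φ : F ⋙ Over.map u ⟶ Over.map u ⋙ P.toFunctor) : Over I :=
  pullback (P.map (pullback.snd (P.map ((Over.map u).map (toOne (F.obj (overOne J)))))
    (φ.app (overOne J)) ≫ (Over.map u).map (toOne (F.obj (overOne J))))) (φ.app (overOne J))

/-- The isomorphism of `∑ᵤ F F F 1` with the triple composite of the endospan
`P (∑ᵤ 1) ← ∑ᵤ F 1 → ∑ᵤ 1`. -/
noncomputable def tripleIso :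
    (Over.map u).obj (F.obj (F.obj (F.obj (overOne J)))) ≅ tripleObj φ :=
  (isPullback_triple hφ).isoPullback

lemma tripleIso_fst : (tripleIso hφ).hom ≫ pullback.fst _ _ =
    φ.app (F.obj (F.obj (overOne J))) ≫ P.map (compositeIso hφ).hom :=
  IsPullback.isoPullback_hom_fst _

lemma tripleIso_snd : (tripleIso hφ).hom ≫ pullback.snd _ _ =
    (Over.map u).map (F.map (toOne (F.obj (F.obj (overOne J))))) :=
  IsPullback.isoPullback_hom_snd _

/-- The left-hand side of the associativity law, pulled back to `∑ᵤ F F F 1`. -/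
lemma triple_left {a : tripleObj φ ⟶ P.obj ((Over.map u).obj (F.obj (overOne J)))}
    (ha : a = pullback.fst _ _ ≫ P.map (spanMult hφ m))
    {b : tripleObj φ ⟶ (Over.map u).obj (F.obj (overOne J))} (hb : b = pullback.snd _ _)
    (w : a ≫ P.map ((Over.map u).map (toOne (F.obj (overOne J)))) = b ≫ φ.app (overOne J)) :
    (tripleIso hφ).hom ≫ pullback.lift a b w ≫ spanMult hφ m =
      (Over.map u).map (F.map m ≫ m) := by
  have w' : ((tripleIso hφ).hom ≫ a) ≫ P.map ((Over.map u).map (toOne (F.obj (overOne J)))) =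
      ((tripleIso hφ).hom ≫ b) ≫ φ.app (overOne J) := by
    rw [Category.assoc, w, Category.assoc]
  rw [← lift_spanMult hφ (F.map m) w', ← Category.assoc]
  · exact congrArg (· ≫ spanMult hφ m) (comp_pullback_lift _ _ _ _)
  · rw [hb, tripleIso_snd, ← F.map_comp, comp_toOne]
  · rw [ha, reassoc_of% tripleIso_fst hφ, ← P.map_comp, compositeIso_spanMult, trans_naturality]

/-- The right-hand side of the associativity law, pulled back to `∑ᵤ F F F 1`. The map `l` is the
component of the multiplication at `F 1`, given by its characterization. -/
lemma triple_right (l : F.obj (F.obj (F.obj (overOne J))) ⟶ F.obj (F.obj (overOne J)))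
    (h₁ : l ≫ F.map (toOne (F.obj (overOne J))) =
      F.map (F.map (toOne (F.obj (overOne J)))) ≫ m)
    (h₂ : (Over.map u).map l ≫ φ.app (F.obj (overOne J)) =
      φ.app (F.obj (F.obj (overOne J))) ≫ P.map (φ.app (F.obj (overOne J))) ≫
        P.μ.app ((Over.map u).obj (F.obj (overOne J))))
    {a : tripleObj φ ⟶ P.obj ((Over.map u).obj (F.obj (overOne J)))}
    (ha : a = pullback.fst _ _ ≫ P.map (pullback.fst _ _) ≫ P.μ.app _)
    {c : tripleObj φ ⟶ P.obj ((Over.map u).obj (F.obj (overOne J)))}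
    (hc : c = pullback.fst _ _ ≫ P.map (pullback.snd _ _))
    {d : tripleObj φ ⟶ (Over.map u).obj (F.obj (overOne J))} (hd : d = pullback.snd _ _)
    (w' : c ≫ P.map ((Over.map u).map (toOne (F.obj (overOne J)))) = d ≫ φ.app (overOne J))
    (w : a ≫ P.map ((Over.map u).map (toOne (F.obj (overOne J)))) =
      (pullback.lift c d w' ≫ spanMult hφ m) ≫ φ.app (overOne J)) :
    (tripleIso hφ).hom ≫ pullback.lift a (pullback.lift c d w' ≫ spanMult hφ m) w ≫
      spanMult hφ m = (Over.map u).map (l ≫ m) := by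
  have z' : ((tripleIso hφ).hom ≫ c) ≫ P.map ((Over.map u).map (toOne (F.obj (overOne J)))) =
      ((tripleIso hφ).hom ≫ d) ≫ φ.app (overOne J) := by
    rw [Category.assoc, w', Category.assoc]
  have hb : (tripleIso hφ).hom ≫ pullback.lift c d w' ≫ spanMult hφ m =
      (Over.map u).map (F.map (F.map (toOne (F.obj (overOne J)))) ≫ m) := by
    rw [← lift_spanMult hφ (F.map (F.map (toOne (F.obj (overOne J))))) z', ← Category.assoc]
    · exact congrArg (· ≫ spanMult hφ m) (comp_pullback_lift _ _ _ _)
    · rw [hd, tripleIso_snd, ← F.map_comp, comp_toOne]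
    · rw [hc, reassoc_of% tripleIso_fst hφ, ← P.map_comp, compositeIso_hom_snd, trans_naturality]
  have z : ((tripleIso hφ).hom ≫ a) ≫ P.map ((Over.map u).map (toOne (F.obj (overOne J)))) =
      ((tripleIso hφ).hom ≫ pullback.lift c d w' ≫ spanMult hφ m) ≫ φ.app (overOne J) := by
    rw [Category.assoc, w, Category.assoc, Category.assoc, Category.assoc]
  rw [← lift_spanMult hφ l z, ← Category.assoc]
  · exact congrArg (· ≫ spanMult hφ m) (comp_pullback_lift _ _ _ _)
  · rw [hb, h₁]
  · rw [ha, reassoc_of% tripleIso_fst hφ, ← P.map_comp_assoc, compositeIso_hom_fst, h₂]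

/-- The endospan `P (∑ᵤ 1) ← ∑ᵤ F 1 → ∑ᵤ 1` with a unit and a multiplication is a multicategory if
and only if these are the components at the terminal object of a monad structure. -/
theorem isPMulticategory_spanAtOne_iff :
    IsPMulticategory (spanAtOne hφ e m) ↔ IsMonadAtOne φ e m := by
  have unit_cod : (Over.map u).map e ≫ (Over.map u).map (toOne (F.obj (overOne J))) =
      𝟙 ((Over.map u).obj (overOne J)) := by
    rw [← Functor.map_comp, comp_toOne]
    exact (Over.map u).map_id _
  have unit_mult (w) : pullback.lift (f := P.map ((Over.map u).map (toOne (F.obj (overOne J)))))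
      (g := φ.app (overOne J))
      (φ.app (overOne J) ≫ P.map ((Over.map u).map e)) (𝟙 _) w ≫ spanMult hφ m = 𝟙 _ ↔
      F.map e ≫ m = 𝟙 _ := by
    refine lift_spanMult_eq_id_iff hφ (F.map e) w ?_ (trans_naturality φ e)
    rw [← F.map_comp, comp_toOne, toOne_overOne, F.map_id]
    exact (Over.map u).map_id _
  constructor
  · intro H
    refine ⟨H.unit_dom, (spanMult_dom_iff hφ).1 H.mult_dom, fun l h₁ h₂ => ?_,
      (unit_mult _).1 H.unit_mult, fun l h₁ h₂ => ?_⟩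
    · refine (lift_spanMult_eq_id_iff hφ l _ ?_ h₂).1 H.mult_unit
      rw [h₁, Functor.map_comp]
      rfl
    · apply overMap_injective (u := u)
      have h := congrArg ((tripleIso hφ).hom ≫ ·) H.mult_assoc
      exact (triple_left hφ rfl rfl _).symm.trans
        (h.trans (triple_right hφ l h₁ h₂ rfl rfl rfl _ _))
  · intro H
    refine ⟨H.unit_app, unit_cod, (spanMult_dom_iff hφ).2 H.mult_app, spanMult_cod hφ, ?_,
      (unit_mult _).2 H.right_unit, ?_⟩
    · refine (lift_spanMult_eq_id_iff hφ (H.unit hφ _) _ ?_ (H.unit_trans hφ _)).2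
        (H.left_unit _ (H.unit_toOne hφ _) (H.unit_trans hφ _))
      rw [H.unit_toOne, Functor.map_comp]
      rfl
    · refine (cancel_epi (tripleIso hφ).hom).1 ?_
      exact (triple_left hφ rfl rfl _).trans ((congrArg _
        (H.assoc _ (H.mult_toOne hφ _) (H.mult_trans hφ _))).trans
        (triple_right hφ _ (H.mult_toOne hφ _) (H.mult_trans hφ _) rfl rfl rfl _ _).symm)

end SpanAtOne

end MonadAtOne

/-! ### Transport of multicategories along isomorphisms -/

namespace PMulticatData

variable {𝒞 : Type u} [Category.{v} 𝒞] [HasPullbacks 𝒞] {T : Monad 𝒞} {X Y : PMulticatData T}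

lemma pullback_lift_congr {W A B C : 𝒞} {f : A ⟶ C} {g : B ⟶ C} {a a' : W ⟶ A} {b b' : W ⟶ B}
    (ha : a = a') (hb : b = b') (w : a ≫ f = b ≫ g) :
    pullback.lift a b w = pullback.lift a' b' (by rw [← ha, ← hb, w]) := by
  subst ha hb
  rfl

lemma lift_compMap (f : Hom X Y) {W : 𝒞} (a : W ⟶ T.obj X.arr) (b : W ⟶ X.arr)
    (w : a ≫ T.map X.cod = b ≫ X.dom) :
    pullback.lift a b w ≫ compMap X Y f.obj f.arr f.dom f.cod =
      pullback.lift (a ≫ T.map f.arr) (b ≫ f.arr) (by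
        rw [Category.assoc, ← T.map_comp, ← f.cod, T.map_comp, reassoc_of% w, f.dom,
          Category.assoc]) := by
  apply pullback.hom_ext
  · rw [Category.assoc, compMap_fst, pullback.lift_fst, pullback.lift_fst_assoc]
  · rw [Category.assoc, compMap_snd, pullback.lift_snd, pullback.lift_snd_assoc]

lemma lift_mult_arr (f : Hom X Y) {W : 𝒞} (a : W ⟶ T.obj X.arr) (b : W ⟶ X.arr)
    (w : a ≫ T.map X.cod = b ≫ X.dom) :
    (pullback.lift a b w ≫ X.mult) ≫ f.arr =
      pullback.lift (a ≫ T.map f.arr) (b ≫ f.arr) (by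
        rw [Category.assoc, ← T.map_comp, ← f.cod, T.map_comp, reassoc_of% w, f.dom,
          Category.assoc]) ≫ Y.mult := by
  rw [Category.assoc, f.mult, ← Category.assoc, lift_compMap]

/-- A morphism of endospans whose components are isomorphisms is an isomorphism. -/
noncomputable def isoOfHom (f : Hom X Y) [IsIso f.obj] [IsIso f.arr] : X ≅ Y where
  hom := f
  inv :=
    { obj := inv f.obj
      arr := inv f.arr
      dom := by rw [T.map_inv, IsIso.comp_inv_eq, Category.assoc, f.dom, IsIso.inv_hom_id_assoc]
      cod := by rw [IsIso.comp_inv_eq, Category.assoc, f.cod, IsIso.inv_hom_id_assoc]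
      unit := by rw [IsIso.comp_inv_eq, Category.assoc, f.unit, IsIso.inv_hom_id_assoc]
      mult := by
        rw [IsIso.comp_inv_eq, Category.assoc, f.mult, ← Category.assoc]
        refine (Category.id_comp _).symm.trans (congrArg (· ≫ Y.mult) ?_)
        apply pullback.hom_ext
        · rw [Category.assoc, compMap_fst, ← Category.assoc, compMap_fst, Category.assoc,
            ← T.map_comp, IsIso.inv_hom_id, T.map_id, Category.comp_id, Category.id_comp]
        · rw [Category.assoc, compMap_snd, ← Category.assoc, compMap_snd, Category.assoc,
            IsIso.inv_hom_id, Category.comp_id, Category.id_comp] }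
  hom_inv_id := Hom.ext (IsIso.hom_inv_id f.obj) (IsIso.hom_inv_id f.arr)
  inv_hom_id := Hom.ext (IsIso.inv_hom_id f.obj) (IsIso.inv_hom_id f.arr)

end PMulticatData

open PMulticatData in
/-- The axioms of a multicategory are invariant under isomorphism of endospans. -/
theorem IsPMulticategory.of_hom {𝒞 : Type u} [Category.{v} 𝒞] [HasPullbacks 𝒞] {T : Monad 𝒞}
    {X Y : PMulticatData T} (f : PMulticatData.Hom X Y) [IsIso f.obj] [IsIso f.arr]
    (H : IsPMulticategory Y) : IsPMulticategory X := by
  have unit_cod : X.unit ≫ X.cod = 𝟙 X.obj := by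
    rw [← cancel_mono f.obj, Category.assoc, f.cod, reassoc_of% f.unit, H.unit_cod,
      Category.comp_id, Category.id_comp]
  have mult_dom : X.mult ≫ X.dom =
      pullback.fst (T.map X.cod) X.dom ≫ T.map X.dom ≫ T.μ.app X.obj := by
    have h := T.μ.naturality f.obj
    dsimp only [Functor.comp_map] at h
    rw [← cancel_mono (T.map f.obj), Category.assoc, f.dom, reassoc_of% f.mult, H.mult_dom,
      reassoc_of% compMap_fst, Category.assoc, Category.assoc, ← h, ← T.map_comp_assoc, ← f.dom,
      T.map_comp_assoc]
  have mult_cod : X.mult ≫ X.cod = pullback.snd (T.map X.cod) X.dom ≫ X.cod := by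
    rw [← cancel_mono f.obj, Category.assoc, f.cod, reassoc_of% f.mult, H.mult_cod,
      reassoc_of% compMap_snd, Category.assoc, f.cod]
  refine ⟨?_, unit_cod, mult_dom, mult_cod, ?_, ?_, ?_⟩
  · rw [← cancel_mono (T.map f.obj), Category.assoc, f.dom, reassoc_of% f.unit, H.unit_dom]
    exact T.η.naturality f.obj
  · have h := congrArg (f.arr ≫ ·) H.mult_unit
    rw [← Category.assoc, comp_pullback_lift] at h
    rw [← cancel_mono f.arr, lift_mult_arr]
    refine Eq.trans (congrArg (· ≫ Y.mult) (pullback_lift_congr ?_ ?_ _))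
      (h.trans ((Category.comp_id _).trans (Category.id_comp _).symm))
    · exact (T.η.naturality f.arr).symm
    · rw [Category.assoc, f.unit, reassoc_of% f.cod]
  · have h := congrArg (f.arr ≫ ·) H.unit_mult
    rw [← Category.assoc, comp_pullback_lift] at h
    rw [← cancel_mono f.arr, lift_mult_arr]
    refine Eq.trans (congrArg (· ≫ Y.mult) (pullback_lift_congr ?_ ?_ _))
      (h.trans ((Category.comp_id _).trans (Category.id_comp _).symm))
    · rw [Category.assoc, ← T.map_comp, f.unit, T.map_comp, reassoc_of% f.dom]
    · exact (Category.id_comp _).trans (Category.comp_id _).symm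
  · let g : pullback (T.map (pullback.snd (T.map X.cod) X.dom ≫ X.cod)) X.dom ⟶
        pullback (T.map (pullback.snd (T.map Y.cod) Y.dom ≫ Y.cod)) Y.dom :=
      pullback.map _ _ _ _ (T.map (compMap X Y f.obj f.arr f.dom f.cod)) f.arr (T.map f.obj)
        (by rw [← T.map_comp, ← T.map_comp, Category.assoc, f.cod, reassoc_of% compMap_snd])
        f.dom
    have g₁ : g ≫ pullback.fst _ _ =
        pullback.fst _ _ ≫ T.map (compMap X Y f.obj f.arr f.dom f.cod) := pullback.lift_fst _ _ _
    have g₂ : g ≫ pullback.snd _ _ = pullback.snd _ _ ≫ f.arr := pullback.lift_snd _ _ _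
    have h := ((congrArg (· ≫ Y.mult) (comp_pullback_lift g _ _ _).symm).trans
      (Category.assoc _ _ _)).trans ((congrArg (g ≫ ·) H.mult_assoc).trans
      ((Category.assoc _ _ _).symm.trans (congrArg (· ≫ Y.mult) (comp_pullback_lift g _ _ _))))
    rw [← cancel_mono f.arr, lift_mult_arr, lift_mult_arr]
    refine Eq.trans (congrArg (· ≫ Y.mult) ?_) (h.trans (congrArg (· ≫ Y.mult) ?_))
    · apply pullback_lift_congr
      · rw [reassoc_of% g₁, Category.assoc, ← T.map_comp, ← T.map_comp, f.mult]
      · exact g₂.symm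
    · apply pullback_lift_congr
      · have h' := T.μ.naturality f.arr
        dsimp only [Functor.comp_map] at h'
        rw [reassoc_of% g₁, Category.assoc, Category.assoc, ← h', ← T.map_comp_assoc, compMap_fst,
          T.map_comp_assoc]
      · rw [lift_mult_arr, ← Category.assoc, comp_pullback_lift]
        congr 1
        apply pullback_lift_congr
        · rw [reassoc_of% g₁, Category.assoc, ← T.map_comp, compMap_snd,
            T.map_comp (pullback.snd (T.map X.cod) X.dom) f.arr]
        · exact g₂

/-! ### Polynomial monads from their value at the terminal object -/

section Strong

variable {E : Type u} [Category.{v} E] [CartesianMonoidalCategory E] {I J : E}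

/-- The projection `K ⊗ X ⟶ X`. -/
abbrev tensorSnd (K : E) (X : Over I) : tensor K X ⟶ X := Over.homMk (snd K X.left)

lemma tensorMap_toUnit (K : E) (X : Over I) :
    tensorMap (toUnit K) (𝟙 X) ≫ tensorUnit X = tensorSnd K X := by
  ext
  simp

lemma tensorMap_tensorSnd {K K' : E} (k : K ⟶ K') {X Y : Over I} (f : X ⟶ Y) :
    tensorMap k f ≫ tensorSnd K' Y = tensorSnd K X ≫ f := by
  ext
  simp

lemma tensorMap_id_comp (K : E) {X Y Z : Over I} (f : X ⟶ Y) (g : Y ⟶ Z) :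
    tensorMap (𝟙 K) (f ≫ g) = tensorMap (𝟙 K) f ≫ tensorMap (𝟙 K) g := by
  rw [tensorMap_comp, Category.comp_id]

/-- A strength is compatible with the projections `K ⊗ X ⟶ X`. -/
lemma Strength.app_tensorSnd {F : Over I ⥤ Over J} (σ : Strength F) (K : E) (X : Over I) :
    σ.app K X ≫ F.map (tensorSnd K X) = tensorSnd K (F.obj X) := by
  rw [← tensorMap_toUnit, F.map_comp, ← Category.assoc, ← σ.naturality, Category.assoc, σ.unit,
    F.map_id, tensorMap_toUnit]

variable {F : Over J ⥤ Over J} {G : Over I ⥤ Over I} {u : J ⟶ I}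
  {φ : F ⋙ Over.map u ⟶ Over.map u ⋙ G} {σ : Strength F} {τ : Strength G}

/-- The canonical identification of `K ⊗ ∑ᵤ X` with `∑ᵤ (K ⊗ X)`. -/
abbrev mapTensor (u : J ⟶ I) (K : E) (X : Over J) :
    tensor K ((Over.map u).obj X) ⟶ (Over.map u).obj (tensor K X) :=
  (Strength.map u).app K X

instance (u : J ⟶ I) (K : E) (X : Over J) : IsIso (mapTensor u K X) := by
  have : IsIso ((Over.forget I).map (mapTensor u K X)) :=
    inferInstanceAs (IsIso (𝟙 (K ⊗ X.left)))
  exact isIso_of_reflects_iso _ (Over.forget I)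

lemma mapTensor_naturality (u : J ⟶ I) (K : E) {X Y : Over J} (f : X ⟶ Y) :
    mapTensor u K X ≫ (Over.map u).map (tensorMap (𝟙 K) f) =
      tensorMap (𝟙 K) ((Over.map u).map f) ≫ mapTensor u K Y :=
  ((Strength.map u).naturality (𝟙 K) f).symm

/-- The condition that `φ : ∑ᵤ F ⟶ G ∑ᵤ` is strong, with the strengths of the composites written
out. -/
lemma isStrong_iff : IsStrong (σ.comp (Strength.map u)) ((Strength.map u).comp τ) φ ↔
    ∀ (K : E) (X : Over J), mapTensor u K (F.obj X) ≫ (Over.map u).map (σ.app K X) ≫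
      φ.app (tensor K X) = tensorMap (𝟙 K) (φ.app X) ≫ τ.app K ((Over.map u).obj X) ≫
        G.map (mapTensor u K X) := by
  refine forall_congr' fun K => forall_congr' fun X => ?_
  simp only [Strength.comp, Category.assoc]

lemma cartesian_tensor_hom_ext (hφ : IsCartesian φ) {K : E} {V Y : Over J}
    {l l' : tensor K V ⟶ F.obj Y} (h₁ : l ≫ F.map (toOne Y) = l' ≫ F.map (toOne Y))
    (h₂ : mapTensor u K V ≫ (Over.map u).map l ≫ φ.app Y =
      mapTensor u K V ≫ (Over.map u).map l' ≫ φ.app Y) : l = l' :=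
  cartesian_hom_ext hφ h₁ ((cancel_epi _).1 h₂)

variable [HasPullbacks E]

/-- Dependent sums reflect pullbacks. -/
lemma isPullback_of_overMap {X Y Z W : Over J} {f : X ⟶ Y} {g : X ⟶ Z} {h : Y ⟶ W} {k : Z ⟶ W}
    (H : IsPullback ((Over.map u).map f) ((Over.map u).map g) ((Over.map u).map h)
      ((Over.map u).map k)) : IsPullback f g h k := by
  have H' := H.map (Over.forget I)
  exact IsPullback.of_map (Over.forget J) (Over.OverMorphism.ext H'.w) H'

end Strong

namespace IsMonadAtOne

variable {E : Type u} [Category.{v} E] [CartesianMonoidalCategory E] [HasPullbacks E] {I J : E}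
  {F : Over J ⥤ Over J} {P : Monad (Over I)} {u : J ⟶ I}
  {φ : F ⋙ Over.map u ⟶ Over.map u ⋙ P.toFunctor} {e : overOne J ⟶ F.obj (overOne J)}
  {m : F.obj (F.obj (overOne J)) ⟶ F.obj (overOne J)} (H : IsMonadAtOne φ e m)
  (hφ : IsCartesian φ)

/-- The composite of the naturality square of the unit with the cartesian naturality square of `φ`
is a naturality square of the unit of `P`. -/
lemma η_cartesian (hη : IsCartesian P.η) : IsCartesian (H.monad hφ).η := by
  intro X Y f
  refine isPullback_of_overMap (u := u) ?_
  refine IsPullback.of_bot (h₁₁ := (Over.map u).map f) (h₂₁ := (Over.map u).map (F.map f))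
    (v₁₁ := (Over.map u).map (H.unit hφ X)) (v₁₂ := (Over.map u).map (H.unit hφ Y)) ?_ ?_ (hφ f)
  · have h := hη ((Over.map u).map f)
    rw [H.unit_trans hφ X, H.unit_trans hφ Y]
    exact h
  · rw [← Functor.map_comp, ← Functor.map_comp, unit_naturality]

lemma μ_cartesian (hμ : IsCartesian P.μ) [PreservesLimitsOfShape WalkingCospan P.toFunctor] :
    IsCartesian (H.monad hφ).μ := by
  intro X Y f
  refine isPullback_of_overMap (u := u) ?_
  refine IsPullback.of_bot (h₁₁ := (Over.map u).map (F.map (F.map f)))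
    (h₂₁ := (Over.map u).map (F.map f))
    (v₁₁ := (Over.map u).map (H.mult hφ X)) (v₁₂ := (Over.map u).map (H.mult hφ Y)) ?_ ?_ (hφ f)
  · have h₁ := hφ (F.map f)
    have h₂ := (hφ f).map P.toFunctor
    have h₃ := hμ ((Over.map u).map f)
    rw [H.mult_trans hφ X, H.mult_trans hφ Y]
    exact h₁.paste_vert (h₂.paste_vert h₃)
  · rw [← Functor.map_comp, ← Functor.map_comp, mult_naturality]

variable {σ : Strength F} {τ : Strength P.toFunctor}

lemma η_strong (hs : IsStrong (σ.comp (Strength.map u)) ((Strength.map u).comp τ) φ)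
    (hη : IsStrong (Strength.id I) τ P.η) : IsStrong (Strength.id J) σ (H.monad hφ).η := by
  intro K X
  have h : H.unit hφ (tensor K X) = tensorMap (𝟙 K) (H.unit hφ X) ≫ σ.app K X := by
    apply cartesian_tensor_hom_ext hφ
    · have h := σ.app_tensorSnd K X
      rw [unit_toOne, ← comp_toOne (tensorSnd K X), F.map_comp, Category.assoc, Category.assoc,
        reassoc_of% h, reassoc_of% tensorMap_tensorSnd, unit_toOne]
    · have h := isStrong_iff.1 hs K X
      have h₁ := P.η.naturality (mapTensor u K X)
      have h₂ := hη K ((Over.map u).obj X)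
      have h₃ : P.η.app (tensor K ((Over.map u).obj X)) = _ := (Category.id_comp _).symm.trans h₂
      dsimp only [Functor.id_map] at h₁
      rw [unit_trans, h₁, Functor.map_comp, Category.assoc, reassoc_of% mapTensor_naturality, h,
        h₃, ← H.unit_trans hφ X, tensorMap_id_comp, Category.assoc, Category.assoc]
  exact (Category.id_comp _).trans h

lemma μ_strong (hs : IsStrong (σ.comp (Strength.map u)) ((Strength.map u).comp τ) φ)
    (hμ : IsStrong (τ.comp τ) τ P.μ) : IsStrong (σ.comp σ) σ (H.monad hφ).μ := by
  intro K X
  change (σ.app K (F.obj X) ≫ F.map (σ.app K X)) ≫ H.mult hφ (tensor K X) =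
    tensorMap (𝟙 K) (H.mult hφ X) ≫ σ.app K X
  apply cartesian_tensor_hom_ext hφ
  · have h := σ.app_tensorSnd K X
    have h' := σ.app_tensorSnd K (F.obj X)
    rw [Category.assoc, Category.assoc, mult_toOne, ← comp_toOne (tensorSnd K X), F.map_comp,
      ← F.map_comp_assoc, reassoc_of% h, Category.assoc, reassoc_of% h,
      reassoc_of% tensorMap_tensorSnd, mult_toOne, F.map_comp, Category.assoc, reassoc_of% h']
  · have h := isStrong_iff.1 hs K X
    have h' := isStrong_iff.1 hs K (F.obj X)
    have h₁ := P.μ.naturality (mapTensor u K X)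
    have h₂ : (τ.app K (P.obj ((Over.map u).obj X)) ≫ P.map (τ.app K ((Over.map u).obj X))) ≫
      P.μ.app _ = tensorMap (𝟙 K) (P.μ.app _) ≫ τ.app K _ := hμ K ((Over.map u).obj X)
    have h₃ := τ.naturality (𝟙 K) (φ.app X)
    dsimp only [Functor.comp_map, Functor.comp_obj] at h₁ h₃
    simp only [Functor.map_comp, Category.assoc]
    rw [mult_trans, trans_naturality_assoc, reassoc_of% h', ← P.map_comp_assoc,
      ← P.map_comp_assoc, Category.assoc, h, reassoc_of% mapTensor_naturality, h]
    simp only [Functor.map_comp, Category.assoc]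
    simp only [Category.assoc] at h₂
    have h₄ := congrArg (tensorMap (𝟙 K)) (H.mult_trans hφ X)
    simp only [tensorMap_id_comp] at h₄
    rw [h₁, ← reassoc_of% h₃, reassoc_of% h₂, reassoc_of% h₄]

/-- The polynomial monad determined by its components at the terminal object. -/
noncomputable def polynomialMonad [LocallyCartesianClosed E]
    (hP : IsPolynomialMonad P τ) (hσ : IsPolynomialFunctor σ)
    (hs : IsStrong (σ.comp (Strength.map u)) ((Strength.map u).comp τ) φ) : PolynomialMonad J where
  toMonad := H.monad hφ
  strength := σ
  isPolynomialMonad :=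
    have := hP.isPolynomialFunctor.preservesPullbacks
    { isPolynomialFunctor := hσ
      η_cartesian := H.η_cartesian hφ hP.η_cartesian
      μ_cartesian := H.μ_cartesian hφ hP.μ_cartesian
      η_strong := H.η_strong hφ hs hP.η_strong
      μ_strong := H.μ_strong hφ hs hP.μ_strong }

/-- The transformation `φ` as a morphism of polynomial monads. -/
noncomputable def polyMndHom [LocallyCartesianClosed E]
    (hP : IsPolynomialMonad P τ) (hσ : IsPolynomialFunctor σ)
    (hs : IsStrong (σ.comp (Strength.map u)) ((Strength.map u).comp τ) φ) :
    PolyMnd.Hom ⟨J, H.polynomialMonad hφ hP hσ hs⟩ ⟨I, ⟨P, τ, hP⟩⟩ where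
  base := u
  trans := φ
  cartesian := hφ
  strong := hs
  unit := H.unit_trans hφ
  mult := H.mult_trans hφ

end IsMonadAtOne

section MulticatObj

variable {E : Type u} [Category.{v} E] [CartesianMonoidalCategory E] [HasPullbacks E]
  [LocallyCartesianClosed E] {I J : E}

/-- A morphism of polynomial monads exhibits the components of the unit and of the multiplication of
its source at the terminal object. -/
lemma PolyMnd.Hom.isMonadAtOne {T P : PolyMnd E} (φ : PolyMnd.Hom T P) :
    IsMonadAtOne φ.trans (T.monad.toMonad.η.app (overOne T.base))
      (T.monad.toMonad.μ.app (overOne T.base)) where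
  unit_app := φ.unit _
  mult_app := φ.mult _
  left_unit l h₁ h₂ := by
    obtain rfl : l = T.monad.toMonad.η.app _ :=
      cartesian_hom_ext φ.cartesian (h₁.trans (T.monad.toMonad.η.naturality _))
        (h₂.trans (φ.unit _).symm)
    exact T.monad.toMonad.left_unit _
  right_unit := T.monad.toMonad.right_unit _
  assoc l h₁ h₂ := by
    obtain rfl : l = T.monad.toMonad.μ.app _ :=
      cartesian_hom_ext φ.cartesian (h₁.trans (T.monad.toMonad.μ.naturality _))
        (h₂.trans (φ.mult _).symm)
    exact T.monad.toMonad.assoc _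

theorem isPMulticategory_multicatObj {T P : PolyMnd E} (φ : PolyMnd.Hom T P) :
    IsPMulticategory (multicatObj φ) :=
  (isPMulticategory_spanAtOne_iff φ.cartesian).2 φ.isMonadAtOne

end MulticatObj

/-! ### Every multicategory comes from a polynomial monad -/

section EssSurj

variable {E : Type u} [Category.{v} E] [CartesianMonoidalCategory E] [HasPullbacks E]
  {I J : E}

/-- An endospan with a unit and a multiplication which satisfies the laws for the target map is
isomorphic to `spanAtOne` as soon as its underlying span is. -/
lemma exists_spanAtOne_hom {P : Monad (Over I)} {F : Over J ⥤ Over J} {u : J ⟶ I}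
    {φ : F ⋙ Over.map u ⟶ Over.map u ⋙ P.toFunctor} (hφ : IsCartesian φ) {X : PMulticatData P}
    (unit_cod : X.unit ≫ X.cod = 𝟙 X.obj)
    (mult_cod : X.mult ≫ X.cod = pullback.snd (P.map X.cod) X.dom ≫ X.cod)
    (i : (Over.map u).obj (overOne J) ≅ X.obj) (a : (Over.map u).obj (F.obj (overOne J)) ≅ X.arr)
    (dom : φ.app (overOne J) ≫ P.map i.hom = a.hom ≫ X.dom)
    (cod : (Over.map u).map (toOne (F.obj (overOne J))) ≫ i.hom = a.hom ≫ X.cod) :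
    ∃ (e : overOne J ⟶ F.obj (overOne J)) (m : F.obj (F.obj (overOne J)) ⟶ F.obj (overOne J))
      (f : PMulticatData.Hom (spanAtOne hφ e m) X), IsIso f.obj ∧ IsIso f.arr := by
  have cod' : a.inv ≫ (Over.map u).map (toOne (F.obj (overOne J))) = X.cod ≫ i.inv := by
    rw [Iso.inv_comp_eq, ← reassoc_of% cod, i.hom_inv_id, Category.comp_id]
  let c : pullback (P.map ((Over.map u).map (toOne (F.obj (overOne J))))) (φ.app (overOne J)) ⟶
      pullback (P.map X.cod) X.dom :=
    pullback.map _ _ _ _ (P.map a.hom) a.hom (P.map i.hom)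
      (by rw [← P.map_comp, ← P.map_comp, cod]) dom
  have c₂ : c ≫ pullback.snd _ _ = pullback.snd _ _ ≫ a.hom := pullback.lift_snd _ _ _
  have hm : ((compositeIso hφ).hom ≫ c ≫ X.mult ≫ a.inv) ≫
      (Over.map u).map (toOne (F.obj (overOne J))) = (Over.map u).map (toOne _) := by
    rw [Category.assoc, Category.assoc, Category.assoc, cod', reassoc_of% mult_cod, reassoc_of% c₂,
      ← cod', a.hom_inv_id_assoc, reassoc_of% compositeIso_hom_snd hφ, ← Functor.map_comp,
      comp_toOne]
  refine ⟨overMapPreimage (i.hom ≫ X.unit ≫ a.inv) ?_, overMapPreimage _ hm, ⟨i.hom, a.hom, dom,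
    cod, ?_, ?_⟩, i.isIso_hom, a.isIso_hom⟩
  · rw [Category.assoc, Category.assoc, cod', reassoc_of% unit_cod, i.hom_inv_id]
    exact ((Over.map u).map_id _).symm
  · change (Over.map u).map (overMapPreimage _ _) ≫ a.hom = i.hom ≫ X.unit
    rw [overMap_preimage, Category.assoc, Category.assoc, a.inv_hom_id, Category.comp_id]
  · change ((compositeIso hφ).inv ≫ (Over.map u).map (overMapPreimage _ _)) ≫ a.hom = c ≫ X.mult
    rw [overMap_preimage, Iso.inv_hom_id_assoc, Category.assoc, Category.assoc, a.inv_hom_id,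
      Category.comp_id]

variable [LocallyCartesianClosed E]

/-- The polynomial monad of a multicategory: the functor is a restriction of `P` to the generic
elements indexed by the operations. -/
theorem exists_polyMndHom (P : PolynomialMonad I) {X : PMulticatData P.toMonad}
    (H : IsPMulticategory X) (u : J ⟶ I) (i : (Over.map u).obj (overOne J) ≅ X.obj) :
    ∃ (T : PolynomialMonad J) (φ : PolyMnd.Hom ⟨J, T⟩ ⟨I, P⟩), φ.base = u ∧
      Nonempty (multicatObj φ ≅ X) := by
  let N : Over J := Over.mk (X.cod ≫ i.inv).left
  have w : (X.cod ≫ i.inv).left ≫ 𝟙 J ≫ u = X.arr.hom := Over.w (X.cod ≫ i.inv)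
  let b : (Over.map u).obj N ≅ X.arr := Over.isoMk (Iso.refl _) (by
    refine (Category.id_comp _).trans (w.symm.trans ?_)
    exact congrArg ((X.cod ≫ i.inv).left ≫ ·) (Category.id_comp u))
  have hb : b.hom ≫ X.cod ≫ i.inv = (Over.map u).map (toOne N) := by
    ext1
    exact Category.id_comp _
  obtain ⟨q, φ, n, hφ, hs, hn⟩ := P.isPolynomialMonad.isPolynomialFunctor.exists_restrict
    (u := u) (b.hom ≫ X.dom ≫ P.toMonad.map i.inv)
  obtain ⟨e, m, f, h₁, h₂⟩ := exists_spanAtOne_hom hφ H.unit_cod H.mult_cod i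
    ((Over.map u).mapIso n ≪≫ b) (by
      rw [← hn, Category.assoc, Category.assoc, Category.assoc, ← P.toMonad.map_comp, i.inv_hom_id]
      refine (congrArg (_ ≫ b.hom ≫ X.dom ≫ ·) (P.toMonad.map_id _)).trans ?_
      simp) (by
      rw [← comp_toOne n.hom, Functor.map_comp, ← hb]
      simp)
  have H' := (isPMulticategory_spanAtOne_iff hφ).1 (IsPMulticategory.of_hom f H)
  have hq : IsPolynomialFunctor q.strength := ⟨q, Iso.refl _, IsStrong.id _⟩
  refine ⟨H'.polynomialMonad hφ P.isPolynomialMonad hq hs,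
    H'.polyMndHom hφ P.isPolynomialMonad hq hs, rfl, ⟨eqToIso ?_ ≪≫ PMulticatData.isoOfHom f⟩⟩
  have h : multicatObj (H'.polyMndHom hφ P.isPolynomialMonad hq hs) =
    spanAtOne hφ (H'.unit hφ (overOne J)) (H'.mult hφ (overOne J)) := rfl
  rw [h, H'.unit_one, H'.mult_one]

end EssSurj

/-! ### Morphisms of multicategories and morphisms of polynomial monads -/

section SumIso

variable {E : Type u} [Category.{v} E] {I J K : E} {v : K ⟶ J} {u : J ⟶ I} {u' : K ⟶ I}

/-- The isomorphism `∑ᵤ ∑ᵥ ≅ ∑ᵤ'` for `u' = u ∘ v`. -/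
abbrev sumIso (h : v ≫ u = u') : Over.map v ⋙ Over.map u ≅ Over.map u' :=
  (Over.mapComp v u).symm ≪≫ Over.mapCongr _ _ h

lemma sumIso_hom_naturality (h : v ≫ u = u') {X Y : Over K} (f : X ⟶ Y) :
    (Over.map u).map ((Over.map v).map f) ≫ (sumIso h).hom.app Y =
      (sumIso h).hom.app X ≫ (Over.map u').map f :=
  (sumIso h).hom.naturality f

lemma sumIso_inv_naturality (h : v ≫ u = u') {X Y : Over K} (f : X ⟶ Y) :
    (Over.map u').map f ≫ (sumIso h).inv.app Y =
      (sumIso h).inv.app X ≫ (Over.map u).map ((Over.map v).map f) :=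
  (sumIso h).inv.naturality f

lemma sumIso_hom_inv (h : v ≫ u = u') (X : Over K) :
    (sumIso h).hom.app X ≫ (sumIso h).inv.app X = 𝟙 ((Over.map u).obj ((Over.map v).obj X)) :=
  Iso.hom_inv_id_app _ _

lemma sumIso_inv_hom (h : v ≫ u = u') (X : Over K) :
    (sumIso h).inv.app X ≫ (sumIso h).hom.app X = 𝟙 ((Over.map u').obj X) :=
  Iso.inv_hom_id_app _ _

lemma sumIso_hom_left (h : v ≫ u = u') (X : Over K) :
    ((sumIso h).hom.app X).left = 𝟙 X.left := by
  subst h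
  simp

lemma sumIso_inv_left (h : v ≫ u = u') (X : Over K) :
    ((sumIso h).inv.app X).left = 𝟙 X.left := by
  subst h
  simp

end SumIso

section FullyFaithful

variable {E : Type u} [Category.{v} E] [CartesianMonoidalCategory E] [HasPullbacks E]
  [LocallyCartesianClosed E] {T' T P : PolyMnd E}

/-- As `φ` is cartesian, a morphism `ψ` over `P` is determined by its component at the terminal
object. -/
lemma PolyMnd.Hom.ext_of_oneMap {ψ χ : PolyMnd.Hom T' T} {φ : PolyMnd.Hom T P}
    (hb : ψ.base = χ.base) (h₁ : (oneMap ψ).left = (oneMap χ).left)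
    (h : ψ.comp φ = χ.comp φ) : ψ = χ := by
  obtain ⟨v, ψ, _, _, _, _⟩ := ψ
  obtain ⟨v', χ, _, _, _, _⟩ := χ
  dsimp only at hb
  subst hb
  obtain rfl : ψ = χ := by
    ext1
    funext X
    refine cartesian_hom_ext (Y := (Over.map v).obj X) φ.cartesian ?_ ?_
    · have h₂ : ψ.app (overOne T'.base) ≫ T.monad.toMonad.map (toOne _) =
          χ.app (overOne T'.base) ≫ T.monad.toMonad.map (toOne _) := Over.OverMorphism.ext h₁
      rw [← comp_toOne ((Over.map v).map (toOne X)), T.monad.toMonad.map_comp,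
        ← trans_naturality_assoc, h₂, ← trans_naturality_assoc]
    · have h₂ := eq_of_heq (PolyMnd.Hom.ext_iff.1 h).2
      have h₃ : (compTrans ψ φ.trans).app X = (compTrans χ φ.trans).app X :=
        congrArg (fun t => NatTrans.app t X) h₂
      rw [compTrans_app, compTrans_app, cancel_epi, ← Category.assoc, ← Category.assoc] at h₃
      exact (cancel_mono _).1 h₃
  rfl

end FullyFaithful

section Full

variable {E : Type u} [Category.{v} E] [CartesianMonoidalCategory E] [HasPullbacks E]
  [LocallyCartesianClosed E] {T' T P : PolyMnd E} {φ' : PolyMnd.Hom T' P} {φ : PolyMnd.Hom T P}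

namespace MulticatHom

variable (f : PMulticatData.Hom (multicatObj φ') (multicatObj φ))

/-- The map between the base objects underlying a morphism of multicategories. -/
noncomputable def base : T'.base ⟶ T.base := f.obj.left

lemma base_comp : base f ≫ φ.base = φ'.base := by
  have h : f.obj.left ≫ 𝟙 T.base ≫ φ.base = 𝟙 T'.base ≫ φ'.base := Over.w f.obj
  exact (congrArg (f.obj.left ≫ ·) (Category.id_comp φ.base)).symm.trans
    (h.trans (Category.id_comp φ'.base))

/-- The map `∑ᵥ T' 1 ⟶ T 1` underlying a morphism of multicategories. -/
noncomputable def one : (Over.map (base f)).obj (T'.monad.toMonad.obj (overOne T'.base)) ⟶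
    T.monad.toMonad.obj (overOne T.base) :=
  Over.homMk f.arr.left (by
    have h := congrArg Over.Hom.left f.cod
    have h' : (T'.monad.toMonad.obj (overOne T'.base)).hom ≫ f.obj.left =
      f.arr.left ≫ (T.monad.toMonad.obj (overOne T.base)).hom := h
    exact h'.symm)

lemma obj_eq : f.obj = (sumIso (base_comp f)).inv.app (overOne T'.base) ≫
    (Over.map φ.base).map (toOne ((Over.map (base f)).obj (overOne T'.base))) := by
  ext1
  rw [Over.comp_left, sumIso_inv_left]
  refine Eq.trans ?_ (Category.id_comp _).symm
  exact (Category.id_comp f.obj.left).symm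

lemma arr_eq : f.arr = (sumIso (base_comp f)).inv.app _ ≫ (Over.map φ.base).map (one f) := by
  ext1
  rw [Over.comp_left, sumIso_inv_left]
  exact (Category.id_comp f.arr.left).symm

lemma one_dom : (Over.map φ.base).map (one f) ≫ φ.trans.app (overOne T.base) =
    (sumIso (base_comp f)).hom.app _ ≫ φ'.trans.app (overOne T'.base) ≫
      P.monad.toMonad.map ((sumIso (base_comp f)).inv.app (overOne T'.base)) ≫
      P.monad.toMonad.map ((Over.map φ.base).map (toOne _)) := by
  have h : φ'.trans.app (overOne T'.base) ≫
      P.monad.toMonad.map ((sumIso (base_comp f)).inv.app (overOne T'.base) ≫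
        (Over.map φ.base).map (toOne ((Over.map (base f)).obj (overOne T'.base)))) =
      ((sumIso (base_comp f)).inv.app _ ≫ (Over.map φ.base).map (one f)) ≫
        φ.trans.app (overOne T.base) :=
    (congrArg (fun k => φ'.trans.app (overOne T'.base) ≫ P.monad.toMonad.map k)
      (obj_eq f).symm).trans (f.dom.trans (congrArg (· ≫ φ.trans.app (overOne T.base)) (arr_eq f)))
  rw [Category.assoc] at h
  rw [← P.monad.toMonad.map_comp, h, ← Category.assoc, sumIso_hom_inv]
  exact (Category.id_comp _).symm

lemma one_unit : (Over.map (base f)).map (T'.monad.toMonad.η.app (overOne T'.base)) ≫ one f =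
    toOne _ ≫ T.monad.toMonad.η.app (overOne T.base) := by
  have h := congrArg Over.Hom.left f.unit
  have h' : f.obj.left = (toOne ((Over.map (base f)).obj (overOne T'.base))).left :=
    (Category.id_comp _).symm
  refine Over.OverMorphism.ext (h.trans ?_)
  exact congrArg (· ≫ (T.monad.toMonad.η.app (overOne T.base)).left) h'

lemma trans_w (Y : Over T'.base) :
    ((sumIso (base_comp f)).hom.app (T'.monad.toMonad.obj Y) ≫ φ'.trans.app Y ≫
      P.monad.toMonad.map ((sumIso (base_comp f)).inv.app Y)) ≫
      P.monad.toMonad.map ((Over.map φ.base).map (toOne ((Over.map (base f)).obj Y))) =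
    (Over.map φ.base).map ((Over.map (base f)).map (T'.monad.toMonad.map (toOne Y)) ≫ one f) ≫
      φ.trans.app (overOne T.base) := by
  have h : P.monad.toMonad.map ((Over.map φ.base).map ((Over.map (base f)).map (toOne Y))) ≫
      P.monad.toMonad.map ((Over.map φ.base).map (toOne _)) =
        P.monad.toMonad.map ((Over.map φ.base).map (toOne _)) := by
    rw [← P.monad.toMonad.map_comp, ← Functor.map_comp, comp_toOne]
  simp only [Functor.map_comp, Category.assoc]
  rw [one_dom, reassoc_of% sumIso_hom_naturality (base_comp f) (T'.monad.toMonad.map (toOne Y)),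
    trans_naturality_assoc, ← P.monad.toMonad.map_comp_assoc, sumIso_inv_naturality,
    P.monad.toMonad.map_comp_assoc, h]

/-- The components of the transformation `∑ᵥ T' ⟶ T ∑ᵥ`. -/
noncomputable def transApp (Y : Over T'.base) :
    (Over.map (base f)).obj (T'.monad.toMonad.obj Y) ⟶
      T.monad.toMonad.obj ((Over.map (base f)).obj Y) :=
  cartesianLift φ.cartesian ((Over.map (base f)).map (T'.monad.toMonad.map (toOne Y)) ≫ one f)
    ((sumIso (base_comp f)).hom.app (T'.monad.toMonad.obj Y) ≫ φ'.trans.app Y ≫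
      P.monad.toMonad.map ((sumIso (base_comp f)).inv.app Y)) (trans_w f Y)

lemma transApp_toOne (Y : Over T'.base) :
    transApp f Y ≫ T.monad.toMonad.map (toOne ((Over.map (base f)).obj Y)) =
      (Over.map (base f)).map (T'.monad.toMonad.map (toOne Y)) ≫ one f :=
  cartesianLift_toOne _ _ _ _

lemma transApp_trans (Y : Over T'.base) :
    (Over.map φ.base).map (transApp f Y) ≫ φ.trans.app ((Over.map (base f)).obj Y) =
      (sumIso (base_comp f)).hom.app (T'.monad.toMonad.obj Y) ≫ φ'.trans.app Y ≫
        P.monad.toMonad.map ((sumIso (base_comp f)).inv.app Y) :=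
  cartesianLift_app _ _ _ _

lemma transApp_naturality {X Y : Over T'.base} (k : X ⟶ Y) :
    (Over.map (base f)).map (T'.monad.toMonad.map k) ≫ transApp f Y =
      transApp f X ≫ T.monad.toMonad.map ((Over.map (base f)).map k) := by
  apply cartesian_hom_ext φ.cartesian
  · rw [Category.assoc, Category.assoc, ← T.monad.toMonad.map_comp, comp_toOne, transApp_toOne,
      transApp_toOne, ← Functor.map_comp_assoc, ← T'.monad.toMonad.map_comp, comp_toOne]
  · rw [Functor.map_comp, Functor.map_comp, Category.assoc, Category.assoc, trans_naturality,
      transApp_trans, reassoc_of% transApp_trans,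
      reassoc_of% sumIso_hom_naturality (base_comp f) (T'.monad.toMonad.map k),
      trans_naturality_assoc, ← P.monad.toMonad.map_comp, ← P.monad.toMonad.map_comp,
      sumIso_inv_naturality]

/-- The transformation `∑ᵥ T' ⟶ T ∑ᵥ` determined by a morphism of multicategories. -/
noncomputable def trans : T'.monad.toMonad.toFunctor ⋙ Over.map (base f) ⟶
    Over.map (base f) ⋙ T.monad.toMonad.toFunctor where
  app := transApp f
  naturality _ _ k := transApp_naturality f k

lemma trans_cartesian : IsCartesian (trans f) := by
  intro X Y k
  refine isPullback_of_overMap (u := φ.base) ?_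
  refine IsPullback.of_bot (h₁₁ := (Over.map φ.base).map ((Over.map (base f)).map
      (T'.monad.toMonad.map k)))
    (h₂₁ := (Over.map φ.base).map (T.monad.toMonad.map ((Over.map (base f)).map k)))
    (v₁₁ := (Over.map φ.base).map (transApp f X)) (v₁₂ := (Over.map φ.base).map (transApp f Y))
    ?_ ?_ (φ.cartesian ((Over.map (base f)).map k))
  · have h₁ : IsPullback ((Over.map φ.base).map ((Over.map (base f)).map
        (T'.monad.toMonad.map k))) ((sumIso (base_comp f)).hom.app _)
        ((sumIso (base_comp f)).hom.app _) ((Over.map φ'.base).map (T'.monad.toMonad.map k)) :=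
      IsPullback.of_vert_isIso ⟨sumIso_hom_naturality _ _⟩
    have h₂ : IsPullback (P.monad.toMonad.map ((Over.map φ'.base).map k))
        (P.monad.toMonad.map ((sumIso (base_comp f)).inv.app X))
        (P.monad.toMonad.map ((sumIso (base_comp f)).inv.app Y))
        (P.monad.toMonad.map ((Over.map φ.base).map ((Over.map (base f)).map k))) :=
      IsPullback.of_vert_isIso ⟨by
        rw [← P.monad.toMonad.map_comp, ← P.monad.toMonad.map_comp, sumIso_inv_naturality]⟩
    rw [transApp_trans, transApp_trans]
    exact h₁.paste_vert ((φ'.cartesian k).paste_vert h₂)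
  · rw [← Functor.map_comp, ← Functor.map_comp, transApp_naturality]

lemma mapTensor_tensorSnd {I J : E} (u : J ⟶ I) (K : E) (X : Over J) :
    mapTensor u K X ≫ (Over.map u).map (tensorSnd K X) = tensorSnd K ((Over.map u).obj X) :=
  (Strength.map u).app_tensorSnd K X

lemma mapTensor_sumIso {I J L : E} {v : L ⟶ J} {u : J ⟶ I} {u' : L ⟶ I} (h : v ≫ u = u') (K : E)
    (X : Over L) : mapTensor u K ((Over.map v).obj X) ≫ (Over.map u).map (mapTensor v K X) ≫
      (sumIso h).hom.app (tensor K X) =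
        tensorMap (𝟙 K) ((sumIso h).hom.app X) ≫ mapTensor u' K X := by
  subst h
  ext
  simp only [Over.comp_left, sumIso_hom_left]
  simp
  exact Category.comp_id _

lemma mapTensor_sumIso_inv {I J L : E} {v : L ⟶ J} {u : J ⟶ I} {u' : L ⟶ I} (h : v ≫ u = u')
    (K : E) (X : Over L) : tensorMap (𝟙 K) ((sumIso h).inv.app X) ≫
      mapTensor u K ((Over.map v).obj X) ≫ (Over.map u).map (mapTensor v K X) =
        mapTensor u' K X ≫ (sumIso h).inv.app (tensor K X) := by
  subst h
  ext
  simp only [Over.comp_left, sumIso_inv_left]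
  simp
  exact Category.comp_id _

lemma trans_strong : IsStrong (T'.monad.strength.comp (Strength.map (base f)))
    ((Strength.map (base f)).comp T.monad.strength) (trans f) := by
  rw [isStrong_iff]
  intro K X
  change mapTensor (base f) K (T'.monad.toMonad.obj X) ≫
    (Over.map (base f)).map (T'.monad.strength.app K X) ≫ transApp f (tensor K X) =
      tensorMap (𝟙 K) (transApp f X) ≫ T.monad.strength.app K ((Over.map (base f)).obj X) ≫
        T.monad.toMonad.map (mapTensor (base f) K X)
  refine cartesian_tensor_hom_ext (Y := (Over.map (base f)).obj (tensor K X)) φ.cartesian ?_ ?_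
  · have h := T'.monad.strength.app_tensorSnd K X
    have h' := T.monad.strength.app_tensorSnd K ((Over.map (base f)).obj X)
    rw [Category.assoc, Category.assoc, Category.assoc, Category.assoc, transApp_toOne,
      ← comp_toOne (tensorSnd K X), T'.monad.toMonad.map_comp, Functor.map_comp_assoc,
      ← Functor.map_comp_assoc, h, reassoc_of% mapTensor_tensorSnd,
      ← T.monad.toMonad.map_comp, comp_toOne,
      ← comp_toOne (tensorSnd K ((Over.map (base f)).obj X)),
      T.monad.toMonad.map_comp, reassoc_of% h', reassoc_of% tensorMap_tensorSnd, transApp_toOne]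
  · have h := isStrong_iff.1 φ.strong K ((Over.map (base f)).obj X)
    have h' := isStrong_iff.1 φ'.strong K X
    have h₃ := P.monad.strength.naturality (𝟙 K) ((sumIso (base_comp f)).inv.app X)
    have h₄ := congrArg (tensorMap (𝟙 K)) (transApp_trans f X)
    simp only [tensorMap_id_comp] at h₄
    simp only [Functor.map_comp, Category.assoc]
    rw [transApp_trans, reassoc_of% sumIso_hom_naturality (base_comp f) (T'.monad.strength.app K X),
      reassoc_of% mapTensor_sumIso, reassoc_of% h', trans_naturality,
      reassoc_of% mapTensor_naturality, reassoc_of% h, reassoc_of% h₄, reassoc_of% h₃,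
      ← P.monad.toMonad.map_comp, ← P.monad.toMonad.map_comp, ← P.monad.toMonad.map_comp,
      mapTensor_sumIso_inv]

lemma trans_unit (X : Over T'.base) :
    (Over.map (base f)).map (T'.monad.toMonad.η.app X) ≫ transApp f X =
      T.monad.toMonad.η.app ((Over.map (base f)).obj X) := by
  apply cartesian_hom_ext φ.cartesian
  · have h := T'.monad.toMonad.η.naturality (toOne X)
    have h' := T.monad.toMonad.η.naturality (toOne ((Over.map (base f)).obj X))
    dsimp only [Functor.id_map] at h h'
    rw [Category.assoc, transApp_toOne, ← Functor.map_comp_assoc, ← h, Functor.map_comp_assoc,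
      one_unit, comp_toOne_assoc, ← h']
    rfl
  · have h := P.monad.toMonad.η.naturality ((sumIso (base_comp f)).inv.app X)
    dsimp only [Functor.id_map] at h
    rw [Functor.map_comp, Category.assoc, transApp_trans,
      reassoc_of% sumIso_hom_naturality (base_comp f) (T'.monad.toMonad.η.app X),
      reassoc_of% φ'.unit, ← h, φ.unit, ← Category.assoc, sumIso_hom_inv]
    exact Category.id_comp _

lemma one_mult : (Over.map (base f)).map (T'.monad.toMonad.μ.app (overOne T'.base)) ≫ one f =
    transApp f (T'.monad.toMonad.obj (overOne T'.base)) ≫ T.monad.toMonad.map (one f) ≫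
      T.monad.toMonad.μ.app (overOne T.base) := by
  have h : ((multIso φ').inv ≫ (Over.map φ'.base).map
      (T'.monad.toMonad.μ.app (overOne T'.base))) ≫ f.arr =
    PMulticatData.compMap (multicatObj φ') (multicatObj φ) f.obj f.arr f.dom f.cod ≫
      (multIso φ).inv ≫ (Over.map φ.base).map (T.monad.toMonad.μ.app (overOne T.base)) := f.mult
  have key : (multIso φ').hom ≫
      PMulticatData.compMap (multicatObj φ') (multicatObj φ) f.obj f.arr f.dom f.cod =
    (sumIso (base_comp f)).inv.app _ ≫ (Over.map φ.base).map
      (transApp f (T'.monad.toMonad.obj (overOne T'.base)) ≫ T.monad.toMonad.map (one f)) ≫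
      (multIso φ).hom := by
    have h₁ := PMulticatData.compMap_fst (multicatObj φ') (multicatObj φ) f.obj f.arr f.dom f.cod
    have h₂ := PMulticatData.compMap_snd (multicatObj φ') (multicatObj φ) f.obj f.arr f.dom f.cod
    have h₃ : φ'.trans.app (T'.monad.toMonad.obj (overOne T'.base)) ≫ P.monad.toMonad.map
          ((sumIso (base_comp f)).inv.app _ ≫ (Over.map φ.base).map (one f)) =
        (sumIso (base_comp f)).inv.app _ ≫ (Over.map φ.base).map
          (transApp f (T'.monad.toMonad.obj (overOne T'.base)) ≫ T.monad.toMonad.map (one f)) ≫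
            φ.trans.app (T.monad.toMonad.obj (overOne T.base)) := by
      simp only [Functor.map_comp, Category.assoc]
      rw [trans_naturality, reassoc_of% transApp_trans,
        ← Category.assoc ((sumIso (base_comp f)).inv.app _), sumIso_inv_hom, Category.id_comp]
    have h₄ : (Over.map φ'.base).map
          (T'.monad.toMonad.map (toOne (T'.monad.toMonad.obj (overOne T'.base)))) ≫
          ((sumIso (base_comp f)).inv.app _ ≫ (Over.map φ.base).map (one f)) =
        (sumIso (base_comp f)).inv.app _ ≫ (Over.map φ.base).map
          (transApp f (T'.monad.toMonad.obj (overOne T'.base)) ≫ T.monad.toMonad.map (one f)) ≫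
            (Over.map φ.base).map
              (T.monad.toMonad.map (toOne (T.monad.toMonad.obj (overOne T.base)))) := by
      rw [reassoc_of% sumIso_inv_naturality (base_comp f), ← Functor.map_comp, ← Functor.map_comp,
        Category.assoc, ← T.monad.toMonad.map_comp, comp_toOne, transApp_toOne]
    apply pullback.hom_ext
    · refine (Category.assoc _ _ _).trans ((congrArg ((multIso φ').hom ≫ ·) h₁).trans ?_)
      refine (Category.assoc _ _ _).symm.trans
        ((congrArg (· ≫ P.monad.toMonad.map f.arr) (multIso_hom_fst φ')).trans ?_)
      refine ((congrArg (fun k => φ'.trans.app _ ≫ P.monad.toMonad.map k) (arr_eq f)).trans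
        (h₃.trans ?_))
      refine (congrArg (fun k => _ ≫ _ ≫ k) (multIso_hom_fst φ).symm).trans ?_
      exact ((Category.assoc _ _ _).trans (congrArg _ (Category.assoc _ _ _))).symm
    · refine (Category.assoc _ _ _).trans ((congrArg ((multIso φ').hom ≫ ·) h₂).trans ?_)
      refine (Category.assoc _ _ _).symm.trans
        ((congrArg (· ≫ f.arr) (multIso_hom_snd φ')).trans ?_)
      refine ((congrArg (fun k => _ ≫ k) (arr_eq f)).trans (h₄.trans ?_))
      refine (congrArg (fun k => _ ≫ _ ≫ k) (multIso_hom_snd φ).symm).trans ?_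
      exact ((Category.assoc _ _ _).trans (congrArg _ (Category.assoc _ _ _))).symm
  have h' : (Over.map φ'.base).map (T'.monad.toMonad.μ.app (overOne T'.base)) ≫ f.arr =
      (sumIso (base_comp f)).inv.app _ ≫ (Over.map φ.base).map
        (transApp f (T'.monad.toMonad.obj (overOne T'.base)) ≫ T.monad.toMonad.map (one f)) ≫
          (Over.map φ.base).map (T.monad.toMonad.μ.app (overOne T.base)) := by
    have h₁ := ((Category.assoc _ _ _).symm.trans h)
    refine ((Iso.inv_comp_eq _).1 h₁).trans ((Category.assoc _ _ _).symm.trans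
      ((congrArg (· ≫ _) key).trans ?_))
    exact (Category.assoc _ _ _).trans
      (congrArg _ ((Category.assoc _ _ _).trans (congrArg _ (Iso.hom_inv_id_assoc _ _))))
  have h'' := (congrArg (fun k => _ ≫ k) (arr_eq f)).symm.trans h'
  apply overMap_injective (u := φ.base)
  refine (cancel_epi ((sumIso (base_comp f)).inv.app _)).1 ?_
  rw [Functor.map_comp, ← reassoc_of% sumIso_inv_naturality (base_comp f)]
  refine h''.trans ?_
  rw [← Functor.map_comp, Category.assoc]
  rfl

lemma trans_mult (X : Over T'.base) :
    (Over.map (base f)).map (T'.monad.toMonad.μ.app X) ≫ transApp f X =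
      transApp f (T'.monad.toMonad.obj X) ≫ T.monad.toMonad.map (transApp f X) ≫
        T.monad.toMonad.μ.app ((Over.map (base f)).obj X) := by
  apply cartesian_hom_ext φ.cartesian
  · have h := T'.monad.toMonad.μ.naturality (toOne X)
    have h' := T.monad.toMonad.μ.naturality (toOne ((Over.map (base f)).obj X))
    dsimp only [Functor.comp_map] at h h'
    rw [Category.assoc, Category.assoc, Category.assoc, transApp_toOne, ← Functor.map_comp_assoc,
      ← h, Functor.map_comp_assoc, one_mult, ← h', ← T.monad.toMonad.map_comp_assoc,
      transApp_toOne, T.monad.toMonad.map_comp, Category.assoc,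
      ← reassoc_of% transApp_naturality f (T'.monad.toMonad.map (toOne X))]
  · have h := P.monad.toMonad.μ.naturality ((sumIso (base_comp f)).inv.app X)
    dsimp only [Functor.comp_map] at h
    have h₁ : P.monad.toMonad.map ((Over.map φ.base).map (transApp f X)) ≫
        P.monad.toMonad.map (φ.trans.app ((Over.map (base f)).obj X)) =
          P.monad.toMonad.map ((sumIso (base_comp f)).hom.app (T'.monad.toMonad.obj X)) ≫
            P.monad.toMonad.map (φ'.trans.app X) ≫
              P.monad.toMonad.map (P.monad.toMonad.map ((sumIso (base_comp f)).inv.app X)) := by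
      rw [← P.monad.toMonad.map_comp, transApp_trans, P.monad.toMonad.map_comp,
        P.monad.toMonad.map_comp]
    have h₂ : P.monad.toMonad.map ((sumIso (base_comp f)).inv.app (T'.monad.toMonad.obj X)) ≫
        P.monad.toMonad.map ((sumIso (base_comp f)).hom.app (T'.monad.toMonad.obj X)) = 𝟙 _ := by
      rw [← P.monad.toMonad.map_comp, sumIso_inv_hom, P.monad.toMonad.map_id]
    simp only [Functor.map_comp, Category.assoc]
    rw [transApp_trans,
      reassoc_of% sumIso_hom_naturality (base_comp f) (T'.monad.toMonad.μ.app X),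
      reassoc_of% φ'.mult, ← h, φ.mult, trans_naturality_assoc, reassoc_of% transApp_trans,
      reassoc_of% h₁, reassoc_of% h₂]
    rfl

/-- The morphism of polynomial monads determined by a morphism of multicategories. -/
noncomputable def polyMndHom : PolyMnd.Hom T' T where
  base := base f
  trans := trans f
  cartesian := trans_cartesian f
  strong := trans_strong f
  unit := trans_unit f
  mult := trans_mult f

lemma polyMndHom_comp : (polyMndHom f).comp φ = φ' := by
  refine PolyMnd.Hom.ext' (base_comp f) fun X => ?_
  have h₁ : (sumIso (base_comp f)).hom.app X = (Over.mapComp (base f) φ.base).inv.app X ≫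
    (Over.mapCongr _ _ (base_comp f)).hom.app X := rfl
  have h₂ : (Over.mapComp (base f) φ.base).hom.app (T'.monad.toMonad.obj X) ≫
      (sumIso (base_comp f)).hom.app (T'.monad.toMonad.obj X) =
        (Over.mapCongr _ _ (base_comp f)).hom.app (T'.monad.toMonad.obj X) :=
    Iso.hom_inv_id_app_assoc _ _ _
  have h₃ : P.monad.toMonad.map ((sumIso (base_comp f)).inv.app X) ≫
      P.monad.toMonad.map ((sumIso (base_comp f)).hom.app X) = 𝟙 _ := by
    rw [← P.monad.toMonad.map_comp, sumIso_inv_hom, P.monad.toMonad.map_id]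
  have h : (PolyMnd.compTrans (trans f) φ.trans).app X ≫
      P.monad.toMonad.map ((Over.mapCongr _ _ (base_comp f)).hom.app X) =
        (Over.mapCongr _ _ (base_comp f)).hom.app (T'.monad.toMonad.obj X) ≫ φ'.trans.app X := by
    rw [PolyMnd.compTrans_app, Category.assoc, Category.assoc, Category.assoc,
      ← P.monad.toMonad.map_comp, ← h₁]
    refine (congrArg (fun k => (Over.mapComp (base f) φ.base).hom.app _ ≫ k)
      ((reassoc_of% transApp_trans f X) _)).trans ?_
    rw [reassoc_of% h₂, h₃, Category.comp_id]
  exact h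

lemma oneMap_polyMndHom : oneMap (polyMndHom f) = one f := by
  refine (transApp_toOne f (overOne T'.base)).trans ?_
  rw [toOne_overOne, T'.monad.toMonad.map_id, (Over.map (base f)).map_id]
  exact Category.id_comp _

end MulticatHom

end Full

/-! ### The equivalences for a polynomial monad -/

/-- Two fully faithful functors with the same objects in their images, up to isomorphism, have
equivalent domains. -/
theorem exists_equivalence_of_fullyFaithful {𝒜 ℬ 𝒟 : Type*} [Category* 𝒜] [Category* ℬ]
    [Category* 𝒟] (G : 𝒜 ⥤ 𝒟) (H : ℬ ⥤ 𝒟) [G.Full] [G.Faithful] [H.Full] [H.Faithful]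
    (hG : ∀ A, ∃ B, Nonempty (H.obj B ≅ G.obj A)) (hH : ∀ B, ∃ A, Nonempty (G.obj A ≅ H.obj B)) :
    ∃ e : 𝒜 ≌ ℬ, Nonempty (e.functor ⋙ H ≅ G) := by
  choose b hb using hG
  let i (A : 𝒜) : H.obj (b A) ≅ G.obj A := (hb A).some
  let K : 𝒜 ⥤ ℬ :=
    { obj := b
      map f := H.preimage ((i _).hom ≫ G.map f ≫ (i _).inv)
      map_id A := H.map_injective (by simp)
      map_comp f g := H.map_injective (by simp) }
  let α : K ⋙ H ≅ G := NatIso.ofComponents i (by simp [K])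
  have : (K ⋙ H).Full := Functor.Full.of_iso α.symm
  have : (K ⋙ H).Faithful := Functor.Faithful.of_iso α.symm
  have : K.Full := Functor.Full.of_comp_faithful K H
  have : K.Faithful := Functor.Faithful.of_comp K H
  have : K.EssSurj := ⟨fun B => by
    obtain ⟨A, ⟨j⟩⟩ := hH B
    exact ⟨A, ⟨H.preimageIso (i A ≪≫ j)⟩⟩⟩
  have : K.IsEquivalence := { }
  exact ⟨K.asEquivalence, ⟨α⟩⟩

section Equivalence

variable {E : Type u} [Category.{v} E] [CartesianMonoidalCategory E] [HasPullbacks E]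
  [LocallyCartesianClosed E]

instance multicatData_faithful (P : PolyMnd E) : (multicatData P).Faithful where
  map_injective {Q R f g} h := by
    have h₁ := congrArg (fun k => k.obj.left) h
    have h₂ := congrArg (fun k => k.arr.left) h
    exact Over.OverMorphism.ext
      (PolyMnd.Hom.ext_of_oneMap h₁ h₂ ((Over.w f).trans (Over.w g).symm))

instance multicatData_full (P : PolyMnd E) : (multicatData P).Full where
  map_surjective {Q R} f := by
    refine ⟨Over.homMk (MulticatHom.polyMndHom f) (MulticatHom.polyMndHom_comp f), ?_⟩
    apply PMulticatData.Hom.ext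
    · rfl
    · ext1
      have h := congrArg Over.Hom.left (MulticatHom.oneMap_polyMndHom f)
      exact h

instance {I : E} (P : PolynomialMonad I) : Functor.Faithful
    (multicatData ⟨I, P⟩ : Over (⟨I, P⟩ : PolyMnd E) ⥤ PMulticatData P.toMonad) :=
  multicatData_faithful _

instance {I : E} (P : PolynomialMonad I) : Functor.Full
    (multicatData ⟨I, P⟩ : Over (⟨I, P⟩ : PolyMnd E) ⥤ PMulticatData P.toMonad) :=
  multicatData_full _

/-- Every multicategory relative to `P` is the endospan of a polynomial monad over `P`, on the slice
over the total object of its object of objects. -/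
lemma IsPMulticategory.exists_over {I : E} {P : PolynomialMonad I} {X : PMulticatData P.toMonad}
    (H : IsPMulticategory X) :
    ∃ Q : Over (⟨I, P⟩ : PolyMnd E), Nonempty ((multicatData ⟨I, P⟩).obj Q ≅ X) := by
  obtain ⟨T, φ, -, ⟨i⟩⟩ := exists_polyMndHom P H X.obj.hom
    (Over.isoMk (Iso.refl _) rfl)
  exact ⟨Over.mk (Y := (⟨_, T⟩ : PolyMnd E)) φ, ⟨i⟩⟩

/-- The transformation `T' ⟶ T` underlying a transformation `∑_𝟙 T' ⟶ T ∑_𝟙`. -/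
def unfibreTrans {I : E} {T' T : PolynomialMonad I}
    (φ : T'.toMonad.toFunctor ⋙ Over.map (𝟙 I) ⟶ Over.map (𝟙 I) ⋙ T.toMonad.toFunctor) :
    T'.toMonad.toFunctor ⟶ T.toMonad.toFunctor :=
  T'.toMonad.toFunctor.rightUnitor.inv ≫
    Functor.whiskerLeft T'.toMonad.toFunctor (Over.mapId I).inv ≫ φ ≫
    Functor.whiskerRight (Over.mapId I).hom T.toMonad.toFunctor ≫
    T.toMonad.toFunctor.leftUnitor.hom

lemma unfibreTrans_app {I : E} {T' T : PolynomialMonad I}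
    (φ : T'.toMonad.toFunctor ⋙ Over.map (𝟙 I) ⟶ Over.map (𝟙 I) ⋙ T.toMonad.toFunctor)
    (X : Over I) : (unfibreTrans φ).app X = (Over.mapId I).inv.app (T'.toMonad.obj X) ≫ φ.app X ≫
      T.toMonad.map ((Over.mapId I).hom.app X) := by
  simp only [unfibreTrans, NatTrans.comp_app, Functor.whiskerLeft_app, Functor.whiskerRight_app,
    Functor.rightUnitor_inv_app, Functor.leftUnitor_hom_app]
  erw [Category.id_comp, Category.comp_id]

lemma fibreTrans_unfibreTrans {I : E} {T' T : PolynomialMonad I}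
    (φ : T'.toMonad.toFunctor ⋙ Over.map (𝟙 I) ⟶ Over.map (𝟙 I) ⋙ T.toMonad.toFunctor) :
    PolyMnd.fibreTrans (unfibreTrans φ) = φ := by
  ext1
  funext X
  rw [PolyMnd.fibreTrans_app, unfibreTrans_app, Category.assoc, Category.assoc,
    Iso.hom_inv_id_app_assoc, ← T.toMonad.map_comp, Iso.hom_inv_id_app]
  exact (congrArg _ (T.toMonad.map_id _)).trans (Category.comp_id _)

/-- A morphism of polynomial monads over the identity map comes from the fibre. -/
lemma PolyMnd.Hom.exists_ofFibre {I : E} {T' T : PolynomialMonad I}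
    (ψ : PolyMnd.Hom ⟨I, T'⟩ ⟨I, T⟩) (h : ψ.base = 𝟙 I) : ∃ χ : T' ⟶ T, Hom.ofFibre χ = ψ := by
  obtain ⟨u, φ, hφ, hs, hη, hμ⟩ := ψ
  dsimp only at h
  subst h
  refine ⟨⟨⟨unfibreTrans φ, fun X => ?_, fun X => ?_⟩, ?_, ?_⟩, ?_⟩
  · have h := (Over.mapId I).inv.naturality (T'.toMonad.η.app X)
    have h₂ := T.toMonad.η.naturality ((Over.mapId I).hom.app X)
    have h₃ := hη X
    dsimp only [Functor.id_obj, Functor.id_map, Functor.comp_obj] at h h₂ h₃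
    rw [unfibreTrans_app, reassoc_of% h, reassoc_of% h₃, ← h₂, Iso.inv_hom_id_app_assoc]
  · have h := (Over.mapId I).inv.naturality (T'.toMonad.μ.app X)
    have h₂ := T.toMonad.μ.naturality ((Over.mapId I).hom.app X)
    have h₃ := hμ X
    have h₄ := (unfibreTrans φ).naturality ((unfibreTrans φ).app X)
    have h₅ : T.toMonad.map ((Over.mapId I).hom.app (T'.toMonad.obj X)) ≫
        T.toMonad.map ((Over.mapId I).inv.app (T'.toMonad.obj X)) = 𝟙 _ := by
      rw [← Functor.map_comp, Iso.hom_inv_id_app]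
      exact CategoryTheory.Functor.map_id _ _
    dsimp only [Functor.id_obj, Functor.id_map, Functor.comp_obj, Functor.comp_map] at h h₂ h₃
    refine Eq.trans ?_ (congrArg (· ≫ T.toMonad.μ.app X) h₄.symm)
    rw [unfibreTrans_app, unfibreTrans_app, reassoc_of% h, reassoc_of% h₃, ← h₂]
    simp only [Category.assoc, Functor.map_comp]
    rw [reassoc_of% h₅]
  · exact NatTrans.Equifibered.comp (.of_isIso _) (.comp (.of_isIso _)
      (.comp hφ (.comp (.of_isIso _) (.of_isIso _))))
  · exact (IsStrong.inv (IsStrong.rightUnitor T'.strength)).comp <|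
      (IsStrong.whiskerLeft _ (.mapId_inv _)).comp <| hs.comp <|
      (IsStrong.whiskerRight (.mapId _) _).comp (IsStrong.leftUnitor _)
  · apply PolyMnd.Hom.ext
    · rfl
    · exact heq_of_eq (fibreTrans_unfibreTrans φ)

instance (I : E) : (PolyMnd.fibreInclusion I).Faithful where
  map_injective {T' T χ χ'} h := by
    have h₁ := eq_of_heq (PolyMnd.Hom.ext_iff.1 h).2
    apply PolynomialMonad.Hom.ext
    ext X : 2
    have h₂ : (PolyMnd.fibreTrans χ.hom.toNatTrans).app X =
      (PolyMnd.fibreTrans χ'.hom.toNatTrans).app X := congrArg (fun t => NatTrans.app t X) h₁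
    rw [PolyMnd.fibreTrans_app, PolyMnd.fibreTrans_app, cancel_epi] at h₂
    exact (cancel_mono _).1 h₂

/-- The endospan of a polynomial monad on the slice over `I` over a fixed one. -/
noncomputable abbrev operadData {I : E} (P : PolynomialMonad I) :
    Over P ⥤ PMulticatData P.toMonad :=
  Over.post (PolyMnd.fibreInclusion I) ⋙ multicatData ⟨I, P⟩

instance {I : E} (P : PolynomialMonad I) : (operadData P).Faithful where
  map_injective h :=
    (Over.post (PolyMnd.fibreInclusion I)).map_injective ((multicatData ⟨I, P⟩).map_injective h)

instance {I : E} (P : PolynomialMonad I) : (operadData P).Full where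
  map_surjective {Q R} f := by
    obtain ⟨g, hg⟩ := (multicatData ⟨I, P⟩).map_surjective f
    have hb : g.left.base = 𝟙 I := by
      have h : g.left.base ≫ 𝟙 I = 𝟙 I := congrArg PolyMnd.Hom.base (Over.w g)
      exact (Category.comp_id _).symm.trans h
    obtain ⟨χ, hχ⟩ := PolyMnd.Hom.exists_ofFibre g.left hb
    refine ⟨Over.homMk χ ((PolyMnd.fibreInclusion I).map_injective ?_), ?_⟩
    · rw [Functor.map_comp]
      refine Eq.trans ?_ (Over.w g)
      exact congrArg (· ≫ _) hχ
    · refine Eq.trans ?_ hg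
      refine congrArg (multicatData ⟨I, P⟩).map (Over.OverMorphism.ext hχ)

/-- For an operad, the object of objects is `∑_𝟙 1` up to isomorphism, so that the polynomial
monad can be chosen on the slice over `I` itself. -/
lemma IsPMulticategory.exists_over_of_isTerminal {I : E} {P : PolynomialMonad I}
    {X : PMulticatData P.toMonad} (H : IsPMulticategory X) (h : IsTerminal X.obj) :
    ∃ Q : Over P, Nonempty ((operadData P).obj Q ≅ X) := by
  obtain ⟨T, φ, hφ, ⟨i⟩⟩ := exists_polyMndHom P H (𝟙 I)
    ((Over.mapId I).app (overOne I) ≪≫ Over.mkIdTerminal.uniqueUpToIso h)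
  obtain ⟨χ, rfl⟩ := φ.exists_ofFibre hφ
  exact ⟨Over.mk χ, ⟨i⟩⟩

lemma isTerminal_operadData_obj {I : E} {P : PolynomialMonad I} (Q : Over P) :
    Nonempty (IsTerminal ((operadData P).obj Q).obj) :=
  ⟨Over.mkIdTerminal.ofIso ((Over.mapId I).symm.app (overOne I))⟩

/-- Multicategories relative to `P` are polynomial monads over `P`. -/
theorem exists_pMulticat_equivalence {I : E} (P : PolynomialMonad I) :
    ∃ e : PMulticat P.toMonad ≌ Over (⟨I, P⟩ : PolyMnd E),
      Nonempty (e.inverse ⋙ PMulticat.toData P.toMonad ≅ multicatData ⟨I, P⟩) := by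
  obtain ⟨e, he⟩ := exists_equivalence_of_fullyFaithful (multicatData ⟨I, P⟩)
    (PMulticat.toData P.toMonad)
    (fun Q => ⟨⟨_, isPMulticategory_multicatObj Q.hom⟩, ⟨Iso.refl _⟩⟩)
    (fun X => X.property.exists_over)
  exact ⟨e.symm, he⟩

/-- Operads relative to `P` are polynomial monads over `P` on the same slice. -/
theorem exists_pOperad_equivalence {I : E} (P : PolynomialMonad I) :
    ∃ e : POperad P.toMonad ≌ Over P,
      Nonempty (e.inverse ⋙ POperad.toData P.toMonad ≅ operadData P) := by
  obtain ⟨e, he⟩ := exists_equivalence_of_fullyFaithful (operadData P)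
    (POperad.toData P.toMonad)
    (fun Q => ⟨⟨_, isPMulticategory_multicatObj _, isTerminal_operadData_obj Q⟩, ⟨Iso.refl _⟩⟩)
    (fun X => X.property.1.exists_over_of_isTerminal X.property.2.some)
  exact ⟨e.symm, he⟩

end Equivalence

/-! ### The identity monad and the free-monoid monad are polynomial -/

section Presentation

variable {E : Type u} [Category.{v} E] [CartesianMonoidalCategory E] [HasPullbacks E]
  [LocallyCartesianClosed E] {I J : E}

/-- A presentation of a functor with strength by a polynomial: every element of `F X` has a shape,
and it is the same as the family of its entries in `X`, indexed by the positions of its shape. The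
object `pos X` consists of the elements of `F X` with a position, and `build` reconstructs an
element from its entries. By `eq_id`, an endomorphism of `F X` which preserves shapes and entries
is the identity. -/
structure Poly.Presentation (p : Poly I J) {F : Over I ⥤ Over J} (σ : Strength F) where
  shape (X : Over I) : (F.obj X).left ⟶ p.A
  shape_t (X : Over I) : shape X ≫ p.t = (F.obj X).hom
  shape_map {X Y : Over I} (f : X ⟶ Y) : (F.map f).left ≫ shape Y = shape X
  shape_str (K : E) (X : Over I) : (σ.app K X).left ≫ shape (tensor K X) = snd K _ ≫ shape X
  pos (X : Over I) : E
  elt (X : Over I) : pos X ⟶ (F.obj X).left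
  point (X : Over I) : pos X ⟶ p.B
  isPullback (X : Over I) : IsPullback (elt X) (point X) (shape X) p.f
  entry (X : Over I) : pos X ⟶ X.left
  entry_w (X : Over I) : entry X ≫ X.hom = point X ≫ p.s
  entry_map {X Y : Over I} (f : X ⟶ Y) (c : pos X ⟶ pos Y)
    (h : c ≫ elt Y = elt X ≫ (F.map f).left) (h' : c ≫ point Y = point X) :
    c ≫ entry Y = entry X ≫ f.left
  entry_str (K : E) (X : Over I) (c : K ⊗ pos X ⟶ pos (tensor K X))
    (h : c ≫ elt (tensor K X) = K ◁ elt X ≫ (σ.app K X).left)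
    (h' : c ≫ point (tensor K X) = snd K (pos X) ≫ point X) :
    c ≫ entry (tensor K X) = K ◁ entry X
  build (X : Over I) : (p.ext.obj X).left ⟶ (F.obj X).left
  build_shape (X : Over I) : build X ≫ shape X = p.pr X
  build_entry (X : Over I) (c : pullback (p.pr X) p.f ⟶ pos X)
    (h : c ≫ elt X = pullback.fst _ _ ≫ build X) (h' : c ≫ point X = pullback.snd _ _) :
    c ≫ entry X = p.ev X
  eq_id (X : Over I) (l : (F.obj X).left ⟶ (F.obj X).left) (h : l ≫ shape X = shape X)
    (h' : ∀ c : pos X ⟶ pos X, c ≫ elt X = elt X ≫ l → c ≫ point X = point X →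
      c ≫ entry X = entry X) : l = 𝟙 _

namespace Poly.Presentation

variable {p : Poly I J} {F : Over I ⥤ Over J} {σ : Strength F} (S : p.Presentation σ)

/-- The comparison map from `F X` to the extension of the polynomial. -/
noncomputable def toExt (X : Over I) : (F.obj X).left ⟶ (p.ext.obj X).left :=
  p.lift (S.isPullback X) (S.entry X) (S.entry_w X)

lemma toExt_pr (X : Over I) : S.toExt X ≫ p.pr X = S.shape X := lift_pr _ _ _ _

lemma toExt_w (X : Over I) : S.elt X ≫ S.toExt X ≫ p.pr X = S.point X ≫ p.f := by
  rw [toExt_pr, (S.isPullback X).w]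

lemma toExt_evAt_elt (X : Over I) :
    p.evAt (S.toExt X) (S.elt X) (S.point X) (S.toExt_w X) = S.entry X :=
  p.lift_evAt _ _ _

lemma toExt_evAt {X : Over I} {W V : E} {h : W ⟶ (F.obj X).left} {v : V ⟶ W} {b : V ⟶ p.B}
    (w : v ≫ (h ≫ S.toExt X) ≫ p.pr X = b ≫ p.f) (c : V ⟶ S.pos X) (h₁ : c ≫ S.elt X = v ≫ h)
    (h₂ : c ≫ S.point X = b) : p.evAt (h ≫ S.toExt X) v b w = c ≫ S.entry X := by
  rw [evAt_comp, ← toExt_evAt_elt, comp_evAt]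
  exact p.evAt_congr _ rfl h₁.symm h₂.symm

lemma toExt_naturality {X Y : Over I} (f : X ⟶ Y) :
    (F.map f).left ≫ S.toExt Y = S.toExt X ≫ (p.ext.map f).left := by
  let c : S.pos X ⟶ S.pos Y := (S.isPullback Y).lift (S.elt X ≫ (F.map f).left) (S.point X)
    (by rw [Category.assoc, S.shape_map, (S.isPullback X).w])
  have h₁ : c ≫ S.elt Y = S.elt X ≫ (F.map f).left := (S.isPullback Y).lift_fst _ _ _
  have h₂ : c ≫ S.point Y = S.point X := (S.isPullback Y).lift_snd _ _ _
  refine p.hom_ext (S.isPullback X) (a := S.shape X) ?_ ?_ ?_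
  · rw [Category.assoc, toExt_pr, S.shape_map]
  · rw [Category.assoc, map_pr, toExt_pr]
  · rw [S.toExt_evAt _ c h₁ h₂, evAt_map, toExt_evAt_elt, S.entry_map f c h₁ h₂]

lemma build_toExt (X : Over I) : S.build X ≫ S.toExt X = 𝟙 _ := by
  let c : pullback (p.pr X) p.f ⟶ S.pos X := (S.isPullback X).lift
    (pullback.fst _ _ ≫ S.build X) (pullback.snd _ _)
    (by rw [Category.assoc, S.build_shape, pullback.condition])
  have h₁ : c ≫ S.elt X = pullback.fst _ _ ≫ S.build X := (S.isPullback X).lift_fst _ _ _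
  have h₂ : c ≫ S.point X = pullback.snd _ _ := (S.isPullback X).lift_snd _ _ _
  refine p.hom_ext (IsPullback.of_hasPullback (p.pr X) p.f) ?_ (Category.id_comp _) ?_
  · rw [Category.assoc, toExt_pr, S.build_shape]
  · rw [S.toExt_evAt _ c h₁ h₂, evAt_id, S.build_entry X c h₁ h₂]

lemma toExt_build (X : Over I) : S.toExt X ≫ S.build X = 𝟙 _ := by
  refine S.eq_id X _ (by rw [Category.assoc, S.build_shape, toExt_pr]) fun c h₁ h₂ => ?_
  have h : (S.toExt X ≫ S.build X) ≫ S.toExt X = S.toExt X := by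
    rw [Category.assoc, build_toExt, Category.comp_id]
  rw [← S.toExt_evAt (by rw [h, toExt_w]) c h₁ h₂, ← toExt_evAt_elt]
  exact p.evAt_congr _ h rfl rfl

lemma isPullback_whiskerLeft_snd (K : E) {X Y : E} (f : X ⟶ Y) :
    IsPullback (K ◁ f) (snd K X) (snd K Y) f := by
  refine isPullback_of_existsUnique (whiskerLeft_snd _ _) (fun V a b h => ?_)
    fun V l l' h₁ h₂ => ?_
  · refine ⟨CartesianMonoidalCategory.lift (a ≫ fst _ _) b, ?_, lift_snd _ _⟩
    ext
    · simp
    · simp [h]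
  · ext
    · simpa using congrArg (· ≫ fst _ _) h₁
    · exact h₂

lemma toExt_strength (K : E) (X : Over I) : (σ.app K X).left ≫ S.toExt (tensor K X) =
    K ◁ S.toExt X ≫ (p.strength.app K X).left := by
  have hV : IsPullback (K ◁ S.elt X) (snd K _ ≫ S.point X) (snd K _ ≫ S.shape X) p.f :=
    IsPullback.paste_vert (isPullback_whiskerLeft_snd K (S.elt X)) (S.isPullback X)
  have w : K ◁ S.elt X ≫ (σ.app K X).left ≫ S.shape (tensor K X) =
      (snd K _ ≫ S.point X) ≫ p.f := by
    rw [S.shape_str, hV.w]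
  let c : K ⊗ S.pos X ⟶ S.pos (tensor K X) := (S.isPullback (tensor K X)).lift _ _
    ((Category.assoc _ _ _).trans w)
  have h₁ : c ≫ S.elt (tensor K X) = K ◁ S.elt X ≫ (σ.app K X).left :=
    (S.isPullback _).lift_fst _ _ _
  have h₂ : c ≫ S.point (tensor K X) = snd K _ ≫ S.point X := (S.isPullback _).lift_snd _ _ _
  refine p.hom_ext hV ?_ ?_ ?_
  · rw [Category.assoc, toExt_pr, S.shape_str]
  · rw [Category.assoc, strength_pr, whiskerLeft_snd_assoc, toExt_pr]
  · rw [S.toExt_evAt _ c h₁ h₂, S.entry_str K X c h₁ h₂, strength_evAt]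
    have h₃ : K ◁ S.elt X ≫ snd K _ ≫ S.toExt X ≫ p.pr X = (snd K _ ≫ S.point X) ≫ p.f := by
      rw [whiskerLeft_snd_assoc, toExt_w, Category.assoc]
    have h₄ : p.evAt (K ◁ S.toExt X ≫ snd K _) (K ◁ S.elt X) (snd K _ ≫ S.point X) (by
        rw [Category.assoc, whiskerLeft_snd_assoc, h₃]) = snd K _ ≫ S.entry X := by
      rw [← toExt_evAt_elt, comp_evAt, p.evAt_congr _ (whiskerLeft_snd K (S.toExt X)) rfl rfl,
        evAt_comp]
      exact p.evAt_congr _ rfl (whiskerLeft_snd _ _) rfl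
    rw [h₄]
    refine CartesianMonoidalCategory.hom_ext (K ◁ S.entry X)
      (CartesianMonoidalCategory.lift _ _) ?_ ?_ <;> simp

/-- The comparison isomorphism. -/
noncomputable def isoExt : F ≅ p.ext :=
  NatIso.ofComponents (fun X => Over.isoMk ⟨S.toExt X, S.build X, S.toExt_build X, S.build_toExt X⟩
    (by
      change S.toExt X ≫ p.pr X ≫ p.t = _
      rw [← Category.assoc, toExt_pr, S.shape_t]))
    (fun f => Over.OverMorphism.ext (S.toExt_naturality f))

/-- A functor with a presentation by a polynomial is polynomial. -/
theorem isPolynomialFunctor (S : p.Presentation σ) : IsPolynomialFunctor σ :=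
  ⟨p, S.isoExt, fun K X => Over.OverMorphism.ext
    ((S.toExt_strength K X).trans (congrArg (· ≫ _) (id_tensorHom K (S.toExt X)).symm))⟩

end Poly.Presentation

/-- The presentation of the identity functor by the identity polynomial. -/
noncomputable def idPresentation (I : E) :
    Poly.Presentation ⟨I, I, 𝟙 I, 𝟙 I, 𝟙 I⟩ (Strength.id I) where
  shape X := X.hom
  shape_t X := Category.comp_id _
  shape_map f := Over.w f
  shape_str K X := Category.id_comp _
  pos X := X.left
  elt X := 𝟙 _
  point X := X.hom
  isPullback X := IsPullback.of_horiz_isIso ⟨by simp⟩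
  entry X := 𝟙 _
  entry_w X := by simp
  entry_map f c h h' := h
  entry_str K X c h h' := h.trans (Category.comp_id _)
  build X := pullback.lift (𝟙 _) (Poly.pr _ X) (by simp) ≫ Poly.ev _ X
  build_shape X := by
    rw [Category.assoc, Poly.ev_w, pullback.lift_snd_assoc]
    exact Category.comp_id _
  build_entry X c h h' := by
    rw [h, ← Category.assoc]
    refine Eq.trans (congrArg (· ≫ Poly.ev _ X) ?_) (Category.id_comp _)
    apply pullback.hom_ext
    · rw [Category.assoc, pullback.lift_fst]
      simp
    · rw [Category.assoc, pullback.lift_snd, pullback.condition]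
      simp
  eq_id X l h h' := by
    have := h' l (by simp) h
    simpa using this

/-- The identity monad is polynomial. -/
theorem isPolynomialMonad_id (I : E) : IsPolynomialMonad (Monad.id (Over I)) (Strength.id I) where
  isPolynomialFunctor := (idPresentation I).isPolynomialFunctor
  η_cartesian := .of_isIso (𝟙 (𝟭 (Over I)))
  μ_cartesian := .of_isIso (𝟙 (𝟭 (Over I)))
  η_strong := IsStrong.id _
  μ_strong := fun K X => by
    exact (Category.comp_id _).trans ((Category.comp_id _).trans
      ((tensorMap_id K X).symm.trans (Category.comp_id _).symm))

end Presentation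

section ListMonad

/-- The polynomial of the free-monoid monad: the shapes are the natural numbers, and the positions
of the shape `n` are the natural numbers less than `n`. -/
def listPoly : Poly PUnit.{w + 1} PUnit.{w + 1} where
  B := {p : ULift.{w} ℕ × ULift.{w} ℕ // p.2.down < p.1.down}
  A := ULift.{w} ℕ
  s := ↾fun _ => PUnit.unit
  f := ↾fun p => p.1.1
  t := ↾fun _ => PUnit.unit

/-- The lists of elements of `X` with a position. -/
abbrev ListPos (X : Type w) : Type w := {p : List X × ULift.{w} ℕ // p.2.down < p.1.length}

/-- The entry of a list at a position. -/
abbrev ListPos.entry {X : Type w} (p : ListPos X) : X := p.1.1[p.1.2.down]'p.2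

lemma ListPos.entry_eq {X : Type w} (p : ListPos X) {l : List X} {n : ULift.{w} ℕ}
    (hl : p.1.1 = l) (hn : p.1.2 = n) (h : n.down < l.length) : p.entry = l[n.down] := by
  subst hl hn
  rfl

/-- Elements of the domain of the evaluation map of the polynomial functor of lists. -/
noncomputable def listPolyMk (X : Over PUnit.{w + 1}) (x : (listPoly.{w}.ext.obj X).left)
    (n : ULift.{w} ℕ) (h : n.down < (listPoly.{w}.pr X x).down) :
    pullback (listPoly.{w}.pr X) listPoly.{w}.f :=
  (PullbackCone.IsLimit.equivPullbackObj
    (pullbackIsPullback (listPoly.{w}.pr X) listPoly.{w}.f)).symm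
    ⟨(x, (⟨(listPoly.{w}.pr X x, n), h⟩ :
      {p : ULift.{w} ℕ × ULift.{w} ℕ // p.2.down < p.1.down})), rfl⟩

lemma listPolyMk_fst (X : Over PUnit.{w + 1}) (x : (listPoly.{w}.ext.obj X).left) (n : ULift.{w} ℕ)
    (h : n.down < (listPoly.{w}.pr X x).down) :
    pullback.fst (listPoly.{w}.pr X) listPoly.{w}.f (listPolyMk X x n h) = x :=
  PullbackCone.IsLimit.equivPullbackObj_symm_apply_fst (pullbackIsPullback _ _) _

lemma listPolyMk_snd (X : Over PUnit.{w + 1}) (x : (listPoly.{w}.ext.obj X).left) (n : ULift.{w} ℕ)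
    (h : n.down < (listPoly.{w}.pr X x).down) :
    pullback.snd (listPoly.{w}.pr X) listPoly.{w}.f (listPolyMk X x n h) =
      (⟨(listPoly.{w}.pr X x, n), h⟩ : {p : ULift.{w} ℕ × ULift.{w} ℕ // p.2.down < p.1.down}) :=
  PullbackCone.IsLimit.equivPullbackObj_symm_apply_snd (pullbackIsPullback _ _) _

/-- The list with given entries. -/
noncomputable def listBuild (X : Over PUnit.{w + 1}) (x : (listPoly.{w}.ext.obj X).left) :
    List X.left :=
  List.ofFn fun i : Fin (listPoly.{w}.pr X x).down => listPoly.{w}.ev X (listPolyMk X x ⟨i⟩ i.2)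

lemma listBuild_length (X : Over PUnit.{w + 1}) (x : (listPoly.{w}.ext.obj X).left) :
    (listBuild X x).length = (listPoly.{w}.pr X x).down :=
  List.length_ofFn

lemma listBuild_getElem (X : Over PUnit.{w + 1})
    (p : (pullback (listPoly.{w}.pr X) listPoly.{w}.f : Type w))
    {x : (listPoly.{w}.ext.obj X).left} (hx : pullback.fst (listPoly.{w}.pr X) listPoly.{w}.f p = x)
    {b : listPoly.{w}.B} (hb : pullback.snd (listPoly.{w}.pr X) listPoly.{w}.f p = b)
    (h : b.1.2.down < (listBuild X x).length) :
    (listBuild X x)[b.1.2.down] = listPoly.{w}.ev X p := by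
  subst hx hb
  refine (List.getElem_ofFn _).trans (congrArg (listPoly.{w}.ev X)
    (PullbackCone.IsLimit.type_ext (pullbackIsPullback _ _) ?_ ?_))
  · exact listPolyMk_fst _ _ _ _
  · refine (listPolyMk_snd _ _ _ _).trans (Subtype.ext (Prod.ext ?_ rfl))
    exact ConcreteCategory.congr_hom (pullback.condition (f := listPoly.{w}.pr X)
      (g := listPoly.{w}.f)) p

/-- The presentation of the free-monoid functor by `listPoly`. -/
noncomputable def listPresentation : Poly.Presentation listPoly.{w} listStrength.{w} where
  shape X := ↾fun l : List X.left => (⟨l.length⟩ : ULift.{w} ℕ)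
  shape_t X := rfl
  shape_map f := by
    ext (l : List _)
    exact congrArg ULift.up (List.length_map _)
  shape_str K X := by
    ext ⟨k, (l : List X.left)⟩
    exact congrArg ULift.up (List.length_map _)
  pos X := ListPos X.left
  elt X := ↾fun p => p.1.1
  point X := ↾fun p => (⟨(⟨p.1.1.length⟩, p.1.2), p.2⟩ :
    {p : ULift.{w} ℕ × ULift.{w} ℕ // p.2.down < p.1.down})
  isPullback X := by
    rw [Types.isPullback_iff]
    refine ⟨rfl, fun x y h => ?_, fun l b h => ?_⟩
    · exact Subtype.ext (Prod.ext h.1 (congrArg (fun b : listPoly.{w}.B => b.1.2) h.2))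
    · have hb : b.1.2.down < b.1.1.down := b.2
      have h₁ : (⟨l.length⟩ : ULift.{w} ℕ) = b.1.1 := h
      exact ⟨⟨(l, b.1.2), by rwa [← h₁] at hb⟩, rfl, Subtype.ext (Prod.ext h₁ rfl)⟩
  entry X := ↾ListPos.entry
  entry_w X := rfl
  entry_map {X Y} f c h h' := by
    ext (p : ListPos X.left)
    have h₁ := ConcreteCategory.congr_hom h p
    have h₂ := congrArg (fun b : listPoly.{w}.B => b.1.2) (ConcreteCategory.congr_hom h' p)
    exact (ListPos.entry_eq (c p) (l := p.1.1.map f.left) h₁ h₂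
      (p.2.trans_eq (List.length_map _).symm)).trans (List.getElem_map _)
  entry_str K X c h h' := by
    ext (q : K × ListPos X.left)
    let r : ListPos (K × X.left) := c q
    have h₀ := ConcreteCategory.congr_hom h q
    have h₁ : r.1.1 = q.2.1.1.map fun x => (q.1, x) := h₀
    have h₂ : r.1.2 = q.2.1.2 :=
      congrArg (fun b : listPoly.{w}.B => b.1.2) (ConcreteCategory.congr_hom h' q)
    exact (ListPos.entry_eq r h₁ h₂ (q.2.2.trans_eq (List.length_map _).symm)).trans
      (List.getElem_map _)
  build X := ↾listBuild X
  build_shape X := by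
    ext x
    exact congrArg ULift.up (listBuild_length X x)
  build_entry X c h h' := by
    ext p
    have h₀ := ConcreteCategory.congr_hom h p
    have h₁ : (c p).1.1 = listBuild X (pullback.fst (listPoly.{w}.pr X) listPoly.{w}.f p) := h₀
    have h₂ : (c p).1.2 = (pullback.snd (listPoly.{w}.pr X) listPoly.{w}.f p).1.2 :=
      congrArg (fun b : listPoly.{w}.B => b.1.2) (ConcreteCategory.congr_hom h' p)
    have h₃ : (pullback.snd (listPoly.{w}.pr X) listPoly.{w}.f p).1.2.down <
        (listBuild X (pullback.fst (listPoly.{w}.pr X) listPoly.{w}.f p)).length := by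
      rw [← h₂, ← h₁]
      exact (c p).2
    exact (ListPos.entry_eq (c p) h₁ h₂ h₃).trans (listBuild_getElem X p rfl rfl h₃)
  eq_id X l h h' := by
    have hl (x : List X.left) : (l x : List X.left).length = x.length :=
      congrArg ULift.down (ConcreteCategory.congr_hom h x)
    let c : ListPos X.left ⟶ ListPos X.left :=
      ↾fun p => ⟨(l p.1.1, p.1.2), p.2.trans_eq (hl p.1.1).symm⟩
    have hc := h' c rfl (by
      ext p
      exact Subtype.ext (Prod.ext (congrArg ULift.up (hl p.1.1)) rfl))
    ext (x : List X.left)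
    exact List.ext_getElem (hl x) fun i _ hi =>
      ConcreteCategory.congr_hom hc ⟨(x, ⟨i⟩), hi⟩

lemma listMonad_η_cartesian : IsCartesian listMonad.{w}.η := by
  intro X Y f
  apply isPullback_of_left
  rw [Types.isPullback_iff]
  refine ⟨rfl, fun x y h => ?_, fun y l h => ?_⟩
  · exact (List.cons.inj h.2).1
  · obtain ⟨x, hx, hl⟩ := List.map_eq_singleton_iff.1 (Eq.symm h)
    exact ⟨x, hl, hx.symm⟩

lemma listMonad_μ_cartesian : IsCartesian listMonad.{w}.μ := by
  intro X Y f
  apply isPullback_of_left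
  rw [Types.isPullback_iff]
  refine ⟨congrArg Over.Hom.left (listMonad.μ.naturality f), fun x y h => ?_, fun y l h => ?_⟩
  · have h₁ : List.map (List.map f.left) x = List.map (List.map f.left) y := h.1
    have h₂ (z : List (List X.left)) :
        (z.map (List.map f.left)).map List.length = z.map List.length := by
      rw [List.map_map]
      exact List.map_congr_left fun _ _ => List.length_map _
    refine List.eq_iff_flatten_eq.2 ⟨h.2, ?_⟩
    exact (h₂ x).symm.trans ((congrArg (List.map List.length) h₁).trans (h₂ y))
  · change List (List Y.left) at y
    change List X.left at l
    change y.flatten = l.map f.left at h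
    change ∃ x : List (List X.left), x.map (List.map f.left) = y ∧ x.flatten = l
    induction y generalizing l with
    | nil => exact ⟨[], rfl, (List.map_eq_nil_iff.1 h.symm).symm⟩
    | cons a y ih =>
      obtain ⟨l₁, l₂, rfl, rfl, h₂⟩ := List.map_eq_append_iff.1 h.symm
      obtain ⟨x, hx, rfl⟩ := ih l₂ h₂.symm
      exact ⟨l₁ :: x, congrArg _ hx, rfl⟩

/-- The free-monoid monad is polynomial. -/
theorem isPolynomialMonad_listMonad : IsPolynomialMonad listMonad.{w} listStrength.{w} where
  isPolynomialFunctor := listPresentation.{w}.isPolynomialFunctor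
  η_cartesian := listMonad_η_cartesian
  μ_cartesian := listMonad_μ_cartesian
  η_strong K X := by
    ext ⟨k, x⟩
    rfl
  μ_strong K X := by
    ext ⟨k, (l : List (List X.left))⟩
    change ((l.map fun x => (k, x)).map fun p => p.2.map fun x => (p.1, x)).flatten =
      l.flatten.map fun x => (k, x)
    rw [List.map_flatten, List.map_map]
    rfl

end ListMonad

/-! ### Multicategories relative to a monad on types, in terms of elements -/

section Elements

variable {S : Type w} {A B C : Over S} (f : A ⟶ C) (g : B ⟶ C)

lemma isPullback_over_left :
    IsPullback (pullback.fst f g).left (pullback.snd f g).left f.left g.left :=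
  (IsPullback.of_hasPullback f g).map (Over.forget S)

lemma exists_pullback_mk (x : A.left) (y : B.left) (h : f.left x = g.left y) :
    ∃ p : (pullback f g).left, (pullback.fst f g).left p = x ∧ (pullback.snd f g).left p = y :=
  Types.exists_of_isPullback (isPullback_over_left f g) x y h

/-- The element `(x, y)` of the pullback of two maps in a slice of the category of types. -/
noncomputable def pbMk (x : A.left) (y : B.left) (h : f.left x = g.left y) : (pullback f g).left :=
  (exists_pullback_mk f g x y h).choose

variable {f g}

lemma fst_pbMk (x : A.left) (y : B.left) (h : f.left x = g.left y) :
    (pullback.fst f g).left (pbMk f g x y h) = x :=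
  (exists_pullback_mk f g x y h).choose_spec.1

lemma snd_pbMk (x : A.left) (y : B.left) (h : f.left x = g.left y) :
    (pullback.snd f g).left (pbMk f g x y h) = y :=
  (exists_pullback_mk f g x y h).choose_spec.2

lemma pullback_left_ext {p q : (pullback f g).left}
    (h₁ : (pullback.fst f g).left p = (pullback.fst f g).left q)
    (h₂ : (pullback.snd f g).left p = (pullback.snd f g).left q) : p = q :=
  Types.ext_of_isPullback (isPullback_over_left f g) h₁ h₂

lemma pullback_condition_apply (p : (pullback f g).left) :
    f.left ((pullback.fst f g).left p) = g.left ((pullback.snd f g).left p) :=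
  ConcreteCategory.congr_hom (congrArg Over.Hom.left (pullback.condition (f := f) (g := g))) p

lemma eq_pbMk (p : (pullback f g).left) :
    p = pbMk f g _ _ (pullback_condition_apply p) :=
  pullback_left_ext (fst_pbMk ..).symm (snd_pbMk ..).symm

lemma lift_left_apply {D : Over S} (a : D ⟶ A) (b : D ⟶ B) (e : a ≫ f = b ≫ g) (z : D.left) :
    (pullback.lift a b e).left z = pbMk f g (a.left z) (b.left z)
      (ConcreteCategory.congr_hom (congrArg Over.Hom.left e) z) := by
  apply pullback_left_ext
  · exact (ConcreteCategory.congr_hom (congrArg Over.Hom.left (pullback.lift_fst a b e)) z).trans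
      (fst_pbMk ..).symm
  · exact (ConcreteCategory.congr_hom (congrArg Over.Hom.left (pullback.lift_snd a b e)) z).trans
      (snd_pbMk ..).symm

end Elements

namespace PMulticatData

variable {S : Type w} {T : Monad (Over S)} (X : PMulticatData T)

/-- The composite of the operation `y` with the operations parametrized by `x`. -/
noncomputable def mulEl (x : (T.obj X.arr).left) (y : X.arr.left)
    (h : (T.map X.cod).left x = X.dom.left y) : X.arr.left :=
  X.mult.left (pbMk (T.map X.cod) X.dom x y h)

lemma mulEl_congr {x x' : (T.obj X.arr).left} {y y' : X.arr.left} (hx : x = x') (hy : y = y')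
    (h : (T.map X.cod).left x = X.dom.left y) (h' : (T.map X.cod).left x' = X.dom.left y') :
    X.mulEl x y h = X.mulEl x' y' h' := by
  subst hx hy
  rfl

lemma mult_left_apply (p : (pullback (T.map X.cod) X.dom).left) :
    X.mult.left p = X.mulEl _ _ (pullback_condition_apply p) :=
  congrArg X.mult.left (eq_pbMk p)

/-- The condition for `mult` to be preserved by a morphism of endospans, on elements. -/
lemma map_mult_iff {X Y : PMulticatData T} (fobj : X.obj ⟶ Y.obj) (farr : X.arr ⟶ Y.arr)
    (hdom : X.dom ≫ T.map fobj = farr ≫ Y.dom) (hcod : X.cod ≫ fobj = farr ≫ Y.cod) :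
    X.mult ≫ farr = compMap X Y fobj farr hdom hcod ≫ Y.mult ↔
      ∀ x y h h', farr.left (X.mulEl x y h) = Y.mulEl ((T.map farr).left x) (farr.left y) h' := by
  have key (p : (pullback (T.map X.cod) X.dom).left) (h') :
      (compMap X Y fobj farr hdom hcod ≫ Y.mult).left p =
        Y.mulEl ((T.map farr).left ((pullback.fst (T.map X.cod) X.dom).left p))
          (farr.left ((pullback.snd (T.map X.cod) X.dom).left p)) h' := by
    refine congrArg Y.mult.left (pullback_left_ext ?_ ?_)
    · exact (ConcreteCategory.congr_hom (congrArg Over.Hom.left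
        (compMap_fst X Y fobj farr hdom hcod)) p).trans (fst_pbMk ..).symm
    · exact (ConcreteCategory.congr_hom (congrArg Over.Hom.left
        (compMap_snd X Y fobj farr hdom hcod)) p).trans (snd_pbMk ..).symm
  constructor
  · intro H x y h h'
    have h₁ := ConcreteCategory.congr_hom (congrArg Over.Hom.left H) (pbMk _ _ x y h)
    have e₁ : (T.map farr).left ((pullback.fst (T.map X.cod) X.dom).left (pbMk _ _ x y h)) =
      (T.map farr).left x := congrArg _ (fst_pbMk ..)
    have e₂ : farr.left ((pullback.snd (T.map X.cod) X.dom).left (pbMk _ _ x y h)) =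
      farr.left y := congrArg _ (snd_pbMk ..)
    exact h₁.trans ((key _ (by rw [e₁, e₂]; exact h')).trans (Y.mulEl_congr e₁ e₂ _ _))
  · intro H
    ext p
    have h₀ := pullback_condition_apply p
    have h₁ := ConcreteCategory.congr_hom (congrArg Over.Hom.left
      (compMap X Y fobj farr hdom hcod ≫= pullback.condition)) p
    have e₁ := ConcreteCategory.congr_hom (congrArg Over.Hom.left
        (compMap_fst X Y fobj farr hdom hcod)) p
    have e₂ := ConcreteCategory.congr_hom (congrArg Over.Hom.left
        (compMap_snd X Y fobj farr hdom hcod)) p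
    have h' : (T.map Y.cod).left ((T.map farr).left ((pullback.fst (T.map X.cod) X.dom).left p)) =
        Y.dom.left (farr.left ((pullback.snd (T.map X.cod) X.dom).left p)) :=
      (congrArg (T.map Y.cod).left e₁).symm.trans (h₁.trans (congrArg Y.dom.left e₂))
    exact (congrArg farr.left (X.mult_left_apply p)).trans ((H _ _ h₀ h').trans (key p h').symm)

/-- The axioms of a multicategory relative to a monad on a slice of the category of types, in terms
of elements. -/
structure ElementLaws : Prop where
  unit_dom (a : X.obj.left) : X.dom.left (X.unit.left a) = (T.η.app X.obj).left a
  unit_cod (a : X.obj.left) : X.cod.left (X.unit.left a) = a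
  mult_dom (x : (T.obj X.arr).left) (y : X.arr.left) (h : (T.map X.cod).left x = X.dom.left y) :
    X.dom.left (X.mulEl x y h) = (T.μ.app X.obj).left ((T.map X.dom).left x)
  mult_cod (x : (T.obj X.arr).left) (y : X.arr.left) (h : (T.map X.cod).left x = X.dom.left y) :
    X.cod.left (X.mulEl x y h) = X.cod.left y
  mult_unit (y : X.arr.left) (h) :
    X.mulEl ((T.η.app X.arr).left y) (X.unit.left (X.cod.left y)) h = y
  unit_mult (y : X.arr.left) (h) : X.mulEl ((T.map X.unit).left (X.dom.left y)) y h = y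
  mult_assoc (z : (T.obj (pullback (T.map X.cod) X.dom)).left) (y : X.arr.left)
    (_ : (T.map (pullback.snd (T.map X.cod) X.dom ≫ X.cod)).left z = X.dom.left y) (h₁ h₂ h₃) :
    X.mulEl ((T.map X.mult).left z) y h₁ =
      X.mulEl ((T.μ.app X.arr).left ((T.map (pullback.fst (T.map X.cod) X.dom)).left z))
        (X.mulEl ((T.map (pullback.snd (T.map X.cod) X.dom)).left z) y h₂) h₃

variable {X} in
/-- The associativity law, together with the fact that the composites in it are defined. -/
lemma ElementLaws.exists_mult_assoc (H : ElementLaws X)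
    (z : (T.obj (pullback (T.map X.cod) X.dom)).left) (y : X.arr.left)
    (h : (T.map (pullback.snd (T.map X.cod) X.dom ≫ X.cod)).left z = X.dom.left y) :
    ∃ h₁ h₂ h₃, X.mulEl ((T.map X.mult).left z) y h₁ =
      X.mulEl ((T.μ.app X.arr).left ((T.map (pullback.fst (T.map X.cod) X.dom)).left z))
        (X.mulEl ((T.map (pullback.snd (T.map X.cod) X.dom)).left z) y h₂) h₃ := by
  have mult_cod : X.mult ≫ X.cod = pullback.snd (T.map X.cod) X.dom ≫ X.cod := by
    ext p
    exact (congrArg X.cod.left (X.mult_left_apply p)).trans (H.mult_cod _ _ _)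
  have e₁ : T.map X.mult ≫ T.map X.cod = T.map (pullback.snd (T.map X.cod) X.dom ≫ X.cod) := by
    rw [← T.map_comp, mult_cod]
  have e₃ : T.map (pullback.fst (T.map X.cod) X.dom) ≫ T.map (T.map X.cod) =
      T.map (pullback.snd (T.map X.cod) X.dom) ≫ T.map X.dom := by
    rw [← T.map_comp, ← T.map_comp, pullback.condition]
  have h₁ := (ConcreteCategory.congr_hom (congrArg Over.Hom.left e₁) z).trans h
  have h₂ := (ConcreteCategory.congr_hom (congrArg Over.Hom.left
    (T.map_comp (pullback.snd (T.map X.cod) X.dom) X.cod)) z).symm.trans h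
  have h₃ := (ConcreteCategory.congr_hom (congrArg Over.Hom.left (T.μ.naturality X.cod))
    ((T.map (pullback.fst (T.map X.cod) X.dom)).left z)).symm.trans
    ((congrArg (T.μ.app X.obj).left
      (ConcreteCategory.congr_hom (congrArg Over.Hom.left e₃) z)).trans (H.mult_dom _ _ h₂).symm)
  exact ⟨h₁, h₂, h₃, H.mult_assoc z y h h₁ h₂ h₃⟩

lemma elementLaws_iff : ElementLaws X ↔ IsPMulticategory X := by
  constructor
  · intro H
    have mult_dom : X.mult ≫ X.dom =
        pullback.fst (T.map X.cod) X.dom ≫ T.map X.dom ≫ T.μ.app X.obj := by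
      ext p
      exact (congrArg X.dom.left (X.mult_left_apply p)).trans (H.mult_dom _ _ _)
    have mult_cod : X.mult ≫ X.cod = pullback.snd (T.map X.cod) X.dom ≫ X.cod := by
      ext p
      exact (congrArg X.cod.left (X.mult_left_apply p)).trans (H.mult_cod _ _ _)
    refine ⟨?_, ?_, mult_dom, mult_cod, ?_, ?_, ?_⟩
    · ext a; exact H.unit_dom a
    · ext a; exact H.unit_cod a
    · ext y
      exact (congrArg X.mult.left (lift_left_apply ..)).trans (H.mult_unit y _)
    · ext y
      exact (congrArg X.mult.left (lift_left_apply ..)).trans (H.unit_mult y _)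
    · ext p
      refine (congrArg X.mult.left (lift_left_apply ..)).trans
        (Eq.trans ?_ (congrArg X.mult.left (lift_left_apply ..)).symm)
      have e := congrArg X.mult.left (lift_left_apply
        (pullback.fst (T.map (pullback.snd (T.map X.cod) X.dom ≫ X.cod)) X.dom ≫
          T.map (pullback.snd (T.map X.cod) X.dom))
        (pullback.snd (T.map (pullback.snd (T.map X.cod) X.dom ≫ X.cod)) X.dom)
        (by rw [Category.assoc, ← T.map_comp, pullback.condition]) p)
      obtain ⟨h₁, h₂, h₃, e'⟩ := H.exists_mult_assoc _ _ (pullback_condition_apply p)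
      exact e'.trans (X.mulEl_congr rfl e.symm _ _)
  · intro H
    refine ⟨fun a => ConcreteCategory.congr_hom (congrArg Over.Hom.left H.unit_dom) a,
      fun a => ConcreteCategory.congr_hom (congrArg Over.Hom.left H.unit_cod) a, ?_, ?_, ?_, ?_, ?_⟩
    · intro x y h
      exact (ConcreteCategory.congr_hom (congrArg Over.Hom.left H.mult_dom) (pbMk _ _ x y h)).trans
        (congrArg (fun t => (T.μ.app X.obj).left ((T.map X.dom).left t)) (fst_pbMk ..))
    · intro x y h
      exact (ConcreteCategory.congr_hom (congrArg Over.Hom.left H.mult_cod) (pbMk _ _ x y h)).trans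
        (congrArg X.cod.left (snd_pbMk ..))
    · intro y h
      exact (congrArg X.mult.left (lift_left_apply ..).symm).trans
        (ConcreteCategory.congr_hom (congrArg Over.Hom.left H.mult_unit) y)
    · intro y h
      exact (congrArg X.mult.left (lift_left_apply ..).symm).trans
        (ConcreteCategory.congr_hom (congrArg Over.Hom.left H.unit_mult) y)
    · intro z y h h₁ h₂ h₃
      have e := ConcreteCategory.congr_hom (congrArg Over.Hom.left H.mult_assoc) (pbMk _ _ z y h)
      have f₁ := fst_pbMk z y h
      have f₂ := snd_pbMk z y h
      have e₁ := (congrArg X.mult.left (lift_left_apply ..)).symm.trans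
        (e.trans (congrArg X.mult.left (lift_left_apply ..)))
      have e₂ := congrArg X.mult.left (lift_left_apply
        (pullback.fst (T.map (pullback.snd (T.map X.cod) X.dom ≫ X.cod)) X.dom ≫
          T.map (pullback.snd (T.map X.cod) X.dom))
        (pullback.snd (T.map (pullback.snd (T.map X.cod) X.dom ≫ X.cod)) X.dom)
        (by rw [Category.assoc, ← T.map_comp, pullback.condition]) (pbMk _ _ z y h))
      refine Eq.trans (X.mulEl_congr ?_ ?_ _ _) (e₁.trans (X.mulEl_congr ?_ ?_ _ _))
      · exact (congrArg (T.map X.mult).left f₁).symm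
      · exact f₂.symm
      · exact congrArg (fun t => (T.μ.app X.arr).left
          ((T.map (pullback.fst (T.map X.cod) X.dom)).left t)) f₁
      · refine e₂.trans (X.mulEl_congr ?_ f₂ _ _)
        exact congrArg (T.map (pullback.snd (T.map X.cod) X.dom)).left f₁

end PMulticatData

/-! ### Multicategories as endospans for the free-monoid monad -/

namespace Multicategory

lemma data_mulEl (X : Multicategory.{w}) (gs : List X.Op) (f : X.Op)
    (h : gs.map X.cod = X.dom f) : X.data.mulEl gs f h = X.comp f gs h :=
  X.data_mult _ _ _ (snd_pbMk (A := listMonad.obj X.data.arr) (B := X.data.arr) gs f h)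
    (fst_pbMk (A := listMonad.obj X.data.arr) (B := X.data.arr) gs f h) h

instance : toData.{w}.Faithful where
  map_injective {X Y F G} h := by
    refine Hom.ext (funext fun a => ?_) (funext fun f => ?_)
    · exact ConcreteCategory.congr_hom
        (congrArg (fun k : PMulticatData.Hom X.data Y.data => k.obj.left) h) a
    · exact ConcreteCategory.congr_hom
        (congrArg (fun k : PMulticatData.Hom X.data Y.data => k.arr.left) h) f

/-- The functor between multicategories which underlies a morphism of endospans. -/
noncomputable def homOfData {X Y : Multicategory.{w}} (F : PMulticatData.Hom X.data Y.data) :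
    Hom X Y where
  obj a := F.obj.left a
  op f := F.arr.left f
  dom f := (ConcreteCategory.congr_hom (congrArg Over.Hom.left F.dom) f).symm
  cod f := (ConcreteCategory.congr_hom (congrArg Over.Hom.left F.cod) f).symm
  id a := ConcreteCategory.congr_hom (congrArg Over.Hom.left F.unit) a
  comp f gs h := by
    have h' : (gs.map F.arr.left).map Y.cod = Y.dom (F.arr.left f) := by
      have h₁ : ∀ g : X.Op, Y.cod (F.arr.left g) = F.obj.left (X.cod g) := fun g =>
        (ConcreteCategory.congr_hom (congrArg Over.Hom.left F.cod) g).symm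
      have h₂ : (X.dom f).map F.obj.left = Y.dom (F.arr.left f) :=
        ConcreteCategory.congr_hom (congrArg Over.Hom.left F.dom) f
      refine Eq.trans ?_ ((congrArg (List.map F.obj.left) h).trans h₂)
      exact (List.map_map ..).trans
        ((congrArg (fun k => gs.map k) (funext h₁)).trans (List.map_map ..).symm)
    have key := (PMulticatData.map_mult_iff F.obj F.arr F.dom F.cod).1 F.mult gs f h h'
    exact (congrArg F.arr.left (X.data_mulEl gs f h)).symm.trans
      (key.trans (Y.data_mulEl _ _ h'))

instance : toData.{w}.Full where
  map_surjective F := ⟨homOfData F, rfl⟩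

lemma isPMulticategory_data (X : Multicategory.{w}) : IsPMulticategory X.data := by
  refine X.data.elementLaws_iff.1 ⟨X.dom_id, X.cod_id, ?_, ?_, ?_, ?_, ?_⟩
  · intro x y h
    exact (congrArg X.dom (X.data_mulEl x y h)).trans (X.dom_comp y x h)
  · intro x y h
    exact (congrArg X.cod (X.data_mulEl x y h)).trans (X.cod_comp y x h)
  · intro y h
    exact (X.data_mulEl _ _ h).trans (X.id_comp y)
  · intro y h
    exact (X.data_mulEl _ _ h).trans (X.comp_id y)
  · intro z y h h₁ h₂ h₃
    change List (pullback (listMonad.map X.data.cod) X.data.dom).left at z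
    let L : List {p : X.Op × List X.Op // p.2.map X.cod = X.dom p.1} :=
      z.map fun p => ⟨⟨(pullback.snd (listMonad.map X.data.cod) X.data.dom).left p,
        (pullback.fst (listMonad.map X.data.cod) X.data.dom).left p⟩, pullback_condition_apply p⟩
    have hL₁ : (L.map fun p => X.comp p.1.1 p.1.2 p.2) = z.map X.data.mult.left :=
      List.map_map ..
    have hL₂ : (L.map fun p => p.1.1) =
      z.map (pullback.snd (listMonad.map X.data.cod) X.data.dom).left := List.map_map ..
    have hL₃ : (L.flatMap fun p => p.1.2) =
      (z.map (pullback.fst (listMonad.map X.data.cod) X.data.dom).left).flatten :=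
      List.flatMap_map ..
    have hL : (L.map fun p => p.1.1).map X.cod = X.dom y := by
      rw [hL₂]
      exact h₂
    refine (X.data_mulEl _ _ h₁).trans (Eq.trans ?_ (X.data_mulEl _ _ h₃).symm)
    refine (X.comp_congr rfl hL₁.symm _ _).trans ((X.assoc y L hL).trans ?_)
    exact X.comp_congr ((X.comp_congr rfl hL₂ _ h₂).trans (X.data_mulEl _ _ h₂).symm) hL₃ _ _

/-- The multicategory with the elements of a multicategory relative to the free-monoid monad. -/
noncomputable def ofData {Z : PMulticatData listMonad.{w}} (H : Z.ElementLaws) :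
    Multicategory.{w} where
  Obj := Z.obj.left
  Op := Z.arr.left
  dom f := Z.dom.left f
  cod f := Z.cod.left f
  id a := Z.unit.left a
  comp f gs h := Z.mulEl gs f h
  dom_id := H.unit_dom
  cod_id := H.unit_cod
  dom_comp f gs h := H.mult_dom gs f h
  cod_comp f gs h := H.mult_cod gs f h
  id_comp f := H.mult_unit f _
  comp_id f := H.unit_mult f _
  assoc f L h := by
    let z : List (pullback (listMonad.map Z.cod) Z.dom).left :=
      L.map fun p => pbMk (listMonad.map Z.cod) Z.dom p.1.2 p.1.1 p.2
    have hz₁ : z.map Z.mult.left = L.map fun p => Z.mulEl p.1.2 p.1.1 p.2 := List.map_map ..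
    have hz₂ : z.map (pullback.snd (listMonad.map Z.cod) Z.dom).left = L.map fun p => p.1.1 :=
      (List.map_map ..).trans (congrArg (fun k => L.map k) (funext fun p => snd_pbMk ..))
    have hz₃ : (z.map (pullback.fst (listMonad.map Z.cod) Z.dom).left).flatten =
        L.flatMap fun p => p.1.2 :=
      congrArg List.flatten ((List.map_map ..).trans
        (congrArg (fun k => L.map k) (funext fun p => fst_pbMk ..)))
    have h₂ : (z.map (pullback.snd (listMonad.map Z.cod) Z.dom).left).map Z.cod.left =
        Z.dom.left f := (congrArg (List.map Z.cod.left) hz₂).trans h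
    have hz : z.map (pullback.snd (listMonad.map Z.cod) Z.dom ≫ Z.cod).left = Z.dom.left f :=
      (List.map_map (f := (pullback.snd (listMonad.map Z.cod) Z.dom).left)
        (g := Z.cod.left)).symm.trans h₂
    obtain ⟨h₁, h₂, h₃, e⟩ := H.exists_mult_assoc z f hz
    exact (Z.mulEl_congr hz₁.symm rfl _ h₁).trans
      (e.trans (Z.mulEl_congr hz₃ (Z.mulEl_congr hz₂ rfl _ _) _ _))

lemma exists_iso_of_isPMulticategory {Z : PMulticatData listMonad.{w}} (H : IsPMulticategory Z) :
    ∃ X : Multicategory.{w}, Nonempty (toData.obj X ≅ Z) := by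
  let X := ofData (Z.elementLaws_iff.2 H)
  let f : PMulticatData.Hom X.data Z :=
    { obj := Over.homMk (U := X.data.obj) (𝟙 Z.obj.left)
      arr := Over.homMk (U := X.data.arr) (𝟙 Z.arr.left)
      dom := by ext f; exact List.map_id _
      cod := rfl
      unit := rfl
      mult := by
        refine (PMulticatData.map_mult_iff (X := X.data) (Y := Z) _ _ _ _).2 fun x y h h' => ?_
        refine (X.data_mulEl x y h).trans (Z.mulEl_congr ?_ rfl _ _)
        exact (List.map_id x).symm }
  have : IsIso ((Over.forget _).map f.obj) := inferInstanceAs (IsIso (𝟙 Z.obj.left))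
  have : IsIso ((Over.forget _).map f.arr) := inferInstanceAs (IsIso (𝟙 Z.arr.left))
  have : IsIso f.obj := isIso_of_reflects_iso (f.obj : X.data.obj ⟶ Z.obj) (Over.forget PUnit)
  have : IsIso f.arr := isIso_of_reflects_iso (f.arr : X.data.arr ⟶ Z.arr) (Over.forget PUnit)
  exact ⟨X, ⟨PMulticatData.isoOfHom (X := X.data) f⟩⟩

end Multicategory

/-! ### Plain operads as endospans for the free-monoid monad -/

lemma list_eq_of_length_eq {α : Type*} [Subsingleton α] {l l' : List α}
    (h : l.length = l'.length) : l = l' :=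
  List.ext_getElem h fun _ _ _ => Subsingleton.elim _ _

lemma subsingleton_left_of_isTerminal {S : Over PUnit.{w + 1}} (h : IsTerminal S) :
    Subsingleton S.left :=
  ⟨fun a b => by
    have e : (Over.homMk (↾fun _ => a) : Over.mk (𝟙 PUnit.{w + 1}) ⟶ S) =
      Over.homMk (↾fun _ => b) := h.hom_ext _ _
    exact ConcreteCategory.congr_hom (congrArg Over.Hom.left e) PUnit.unit⟩

/-- The element of a terminal object of the slice over the one-point type. -/
noncomputable def elementOfIsTerminal {S : Over PUnit.{w + 1}} (h : IsTerminal S) : S.left :=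
  (h.from (Over.mk (𝟙 PUnit.{w + 1}))).left PUnit.unit

namespace PlainOperad

lemma data_cond (X : PlainOperad.{w}) {gs : List (Σ n, X.Op n)} {f : Σ n, X.Op n}
    (h : (listMonad.map X.data.cod).left gs = X.data.dom.left f) : gs.length = f.1 :=
  (List.length_map (f := fun _ : Σ n, X.Op n => PUnit.unit.{w + 1})).symm.trans
    ((congrArg List.length h).trans List.length_replicate)

/-- A family of operations of the right length is composable, since there is only one object. -/
lemma data_cond_of_length (X : PlainOperad.{w}) {gs : List (Σ n, X.Op n)} {f : Σ n, X.Op n}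
    (h : gs.length = f.1) : (listMonad.map X.data.cod).left gs = X.data.dom.left f :=
  list_eq_of_length_eq (α := PUnit.{w + 1}) ((List.length_map ..).trans
    (h.trans List.length_replicate.symm))

lemma data_mulEl (X : PlainOperad.{w}) (gs : List (Σ n, X.Op n)) (f : Σ n, X.Op n)
    (h : (listMonad.map X.data.cod).left gs = X.data.dom.left f) :
    X.data.mulEl gs f h = X.compTotal f gs (X.data_cond h) :=
  X.data_mult _ _ _ (snd_pbMk (A := listMonad.obj X.data.arr) (B := X.data.arr) gs f h)
    (fst_pbMk (A := listMonad.obj X.data.arr) (B := X.data.arr) gs f h) _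

instance : toData.{w}.Faithful where
  map_injective {X Y} (F G : Hom X Y) h := by
    refine Hom.ext (funext fun n => funext fun x => ?_)
    have e : mapTotal F.op ⟨n, x⟩ = mapTotal G.op ⟨n, x⟩ := ConcreteCategory.congr_hom
        (congrArg (fun k : PMulticatData.Hom X.data Y.data => k.arr.left) h) ⟨n, x⟩
    exact eq_of_heq (Sigma.mk.inj e).2

lemma arity_map {X Y : PlainOperad.{w}} (F : PMulticatData.Hom X.data Y.data) (f : Σ n, X.Op n) :
    (F.arr.left f : Σ n, Y.Op n).1 = f.1 := by
  have h : (List.replicate f.1 PUnit.unit).map F.obj.left =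
      List.replicate (F.arr.left f : Σ n, Y.Op n).1 PUnit.unit :=
    ConcreteCategory.congr_hom (congrArg Over.Hom.left F.dom) f
  exact (List.length_replicate.symm.trans ((congrArg List.length h).symm.trans
    (List.length_map ..))).trans List.length_replicate

/-- The action on `n`-ary operations of a morphism of endospans. -/
noncomputable def opOfData {X Y : PlainOperad.{w}} (F : PMulticatData.Hom X.data Y.data) (n : ℕ)
    (x : X.Op n) : Y.Op n :=
  cast (congrArg Y.Op (arity_map F ⟨n, x⟩)) (F.arr.left ⟨n, x⟩ : Σ n, Y.Op n).2

lemma mapTotal_opOfData {X Y : PlainOperad.{w}} (F : PMulticatData.Hom X.data Y.data)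
    (f : Σ n, X.Op n) : mapTotal (opOfData F) f = F.arr.left f :=
  Sigma.ext (arity_map F f).symm (cast_heq _ _)

/-- The morphism of operads which underlies a morphism of endospans. -/
noncomputable def homOfData {X Y : PlainOperad.{w}} (F : PMulticatData.Hom X.data Y.data) :
    Hom X Y where
  op := opOfData F
  one := by
    have h : (F.arr.left (⟨1, X.one⟩ : Σ n, X.Op n)) = (⟨1, Y.one⟩ : Σ n, Y.Op n) :=
      ConcreteCategory.congr_hom (congrArg Over.Hom.left F.unit) PUnit.unit
    exact eq_of_heq (Sigma.mk.inj ((mapTotal_opOfData F ⟨1, X.one⟩).trans h)).2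
  comp {n} f gs h := by
    have h₀ := X.data_cond_of_length (gs := gs) (f := ⟨n, f⟩) h
    have e : gs.map (mapTotal (opOfData F)) = gs.map F.arr.left :=
      congrArg (fun k => gs.map k) (funext (mapTotal_opOfData F))
    have h₁ : (gs.map F.arr.left).length = (F.arr.left ⟨n, f⟩ : Σ n, Y.Op n).1 :=
      (List.length_map ..).trans (h.trans (arity_map F ⟨n, f⟩).symm)
    have h' := Y.data_cond_of_length h₁
    have key := (PMulticatData.map_mult_iff F.obj F.arr F.dom F.cod).1 F.mult gs ⟨n, f⟩ h₀ h'
    refine (mapTotal_opOfData F ⟨_, X.comp f gs h⟩).trans ?_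
    refine (congrArg F.arr.left (X.data_mulEl gs ⟨n, f⟩ h₀)).symm.trans
      (key.trans ((Y.data_mulEl _ _ h').trans ?_))
    exact Y.compTotal_congr (f' := ⟨n, opOfData F n f⟩) (mapTotal_opOfData F ⟨n, f⟩).symm e.symm _ _

instance : toData.{w}.Full where
  map_surjective {X Y} F := by
    refine ⟨homOfData F, PMulticatData.Hom.ext ?_ ?_⟩
    · exact Over.mkIdTerminal.hom_ext _ _
    · ext f
      exact mapTotal_opOfData F f

lemma isPMulticategory_data (X : PlainOperad.{w}) : IsPMulticategory X.data := by
  refine X.data.elementLaws_iff.1 ⟨fun _ => rfl, fun _ => rfl, ?_, fun _ _ _ => rfl, ?_, ?_, ?_⟩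
  · intro x y h
    change List (Σ n, X.Op n) at x
    refine list_eq_of_length_eq (α := PUnit.{w + 1}) ?_
    have h₁ : X.data.dom.left (X.data.mulEl x y h) =
        List.replicate (x.map Sigma.fst).sum PUnit.unit :=
      congrArg X.data.dom.left (X.data_mulEl x y h)
    refine (congrArg List.length h₁).trans (List.length_replicate.trans ?_)
    have h₂ : (x.map fun f => List.replicate f.1 PUnit.unit.{w + 1}).flatten.length =
        (x.map Sigma.fst).sum := by
      simp [List.length_flatten, Function.comp_def]
    exact h₂.symm
  · intro y h
    exact (X.data_mulEl _ _ h).trans (X.one_comp y)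
  · intro y h
    refine (X.data_mulEl _ _ h).trans (Eq.trans ?_ (X.comp_one y.2))
    exact X.compTotal_congr (f' := ⟨y.1, y.2⟩) rfl List.map_replicate _ _
  · intro z y h h₁ h₂ h₃
    change List (pullback (listMonad.map X.data.cod) X.data.dom).left at z
    let L : List (Σ k, {p : X.Op k × List (Σ j, X.Op j) // p.2.length = k}) :=
      z.map fun p => ⟨_, ⟨((pullback.snd (listMonad.map X.data.cod) X.data.dom).left p :
          Σ n, X.Op n).2, (pullback.fst (listMonad.map X.data.cod) X.data.dom).left p⟩,
        X.data_cond (pullback_condition_apply p)⟩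
    have hL₁ : (L.map fun p => (⟨_, X.comp p.2.1.1 p.2.1.2 p.2.2⟩ : Σ n, X.Op n)) =
      z.map X.data.mult.left := List.map_map ..
    have hL₂ : (L.map fun p => (⟨p.1, p.2.1.1⟩ : Σ n, X.Op n)) =
      z.map (pullback.snd (listMonad.map X.data.cod) X.data.dom).left := List.map_map ..
    have hL₃ : (L.flatMap fun p => p.2.1.2) =
      (z.map (pullback.fst (listMonad.map X.data.cod) X.data.dom).left).flatten :=
      List.flatMap_map ..
    have hL : L.length = (y : Σ n, X.Op n).1 := by
      exact (List.length_map ..).symm.trans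
        ((congrArg List.length hL₂).trans (X.data_cond (f := y) h₂))
    refine (X.data_mulEl _ _ h₁).trans (Eq.trans ?_ (X.data_mulEl _ _ h₃).symm)
    refine (X.compTotal_congr (f := y) rfl hL₁.symm _ ((List.length_map ..).trans hL)).trans
      ((X.assoc y.2 L hL).trans ?_)
    refine X.compTotal_congr (f := X.compTotal y _ ((List.length_map ..).trans hL)) ?_ hL₃ _ _
    exact (X.compTotal_congr (f := y) rfl hL₂ _ (X.data_cond (f := y) h₂)).trans
      (X.data_mulEl _ _ h₂).symm

section OfData

variable {Z : PMulticatData listMonad.{w}} (H : Z.ElementLaws) (hZ : IsTerminal Z.obj)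

/-- The number of inputs of an operation. -/
def arity (Z : PMulticatData listMonad.{w}) (x : Z.arr.left) : ℕ :=
  (Z.dom.left x : List Z.obj.left).length

/-- The operations with a given number of inputs. -/
def OpOfArity (Z : PMulticatData listMonad.{w}) (n : ℕ) : Type w :=
  {x : Z.arr.left // arity Z x = n}

lemma total_ext {p q : Σ n, OpOfArity Z n} (h : p.2.1 = q.2.1) : p = q := by
  obtain ⟨n, x, rfl⟩ := p
  obtain ⟨m, y, rfl⟩ := q
  obtain rfl : x = y := h
  rfl

/-- The operations which underlie a list of operations with given numbers of inputs. -/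
def underlying (gs : List (Σ n, OpOfArity Z n)) : List Z.arr.left :=
  gs.map fun g => g.2.1

lemma underlying_map_fst (gs : List (Σ n, OpOfArity Z n)) :
    gs.map Sigma.fst = (underlying gs).map (arity Z) :=
  (congrArg (fun k => gs.map k) (funext fun g => g.2.2.symm)).trans
    (List.map_map (f := fun g : Σ n, OpOfArity Z n => g.2.1) (g := arity Z)).symm

lemma underlying_map {β : Type*} (k : β → Σ n, OpOfArity Z n) (l : List β) :
    underlying (l.map k) = l.map fun b => (k b).2.1 :=
  List.map_map ..

lemma mulEl_cond (hZ : IsTerminal Z.obj) {gs : List Z.arr.left} {x : Z.arr.left}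
    (h : gs.length = arity Z x) : (listMonad.map Z.cod).left gs = Z.dom.left x :=
  have := subsingleton_left_of_isTerminal hZ
  list_eq_of_length_eq (α := Z.obj.left) ((List.length_map ..).trans h)

lemma arity_mulEl (H : Z.ElementLaws) {gs : List Z.arr.left} {x : Z.arr.left}
    (h : (listMonad.map Z.cod).left gs = Z.dom.left x) :
    arity Z (Z.mulEl gs x h) = (gs.map (arity Z)).sum :=
  (congrArg List.length (H.mult_dom gs x h)).trans
    (List.length_flatten.trans (congrArg List.sum (List.map_map ..)))

/-- The plain operad with the elements of an operad relative to the free-monoid monad. -/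
noncomputable def ofData : PlainOperad.{w} where
  Op := OpOfArity Z
  one := ⟨Z.unit.left (elementOfIsTerminal hZ),
    congrArg List.length (H.unit_dom (elementOfIsTerminal hZ))⟩
  comp f gs h := ⟨Z.mulEl (underlying gs) f.1 (mulEl_cond hZ ((List.length_map ..).trans
    (h.trans f.2.symm))), (arity_mulEl H _).trans (congrArg List.sum (underlying_map_fst gs).symm)⟩
  one_comp f := by
    have := subsingleton_left_of_isTerminal hZ
    refine total_ext (Eq.trans ?_ (H.mult_unit f.2.1 (mulEl_cond hZ
      (congrArg List.length (H.unit_dom (Z.cod.left f.2.1))).symm)))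
    exact Z.mulEl_congr rfl (congrArg Z.unit.left (Subsingleton.elim _ _)) _ _
  comp_one {n} f := by
    have := subsingleton_left_of_isTerminal hZ
    have e : underlying (List.replicate n ⟨1, ⟨Z.unit.left (elementOfIsTerminal hZ),
        congrArg List.length (H.unit_dom (elementOfIsTerminal hZ))⟩⟩) =
        (listMonad.map Z.unit).left (Z.dom.left f.1) := by
      have h₁ : (Z.dom.left f.1 : List Z.obj.left) =
          List.replicate n (elementOfIsTerminal hZ) :=
        list_eq_of_length_eq (f.2.trans List.length_replicate.symm)
      have h₂ : (List.replicate n (elementOfIsTerminal hZ)).map Z.unit.left =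
        List.replicate n (Z.unit.left (elementOfIsTerminal hZ)) := List.map_replicate
      exact List.map_replicate.trans
        (h₂.symm.trans (congrArg (List.map Z.unit.left) h₁.symm))
    have h₂ := (mulEl_cond hZ (gs := (listMonad.map Z.unit).left (Z.dom.left f.1)) (x := f.1)
      (List.length_map ..))
    exact total_ext ((Z.mulEl_congr e rfl _ h₂).trans (H.unit_mult f.1 h₂))
  assoc {n} f L h := by
    let z : List (pullback (listMonad.map Z.cod) Z.dom).left :=
      L.map fun p => pbMk (listMonad.map Z.cod) Z.dom (underlying p.2.1.2) p.2.1.1.1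
        (mulEl_cond hZ ((List.length_map ..).trans (p.2.2.trans p.2.1.1.2.symm)))
    have hz₁ : z.map Z.mult.left = _ := List.map_map ..
    have hz₂ : z.map (pullback.snd (listMonad.map Z.cod) Z.dom).left =
        L.map fun p => p.2.1.1.1 :=
      (List.map_map ..).trans (congrArg (fun k => L.map k) (funext fun p => snd_pbMk ..))
    have hz₃' : z.map (pullback.fst (listMonad.map Z.cod) Z.dom).left =
        L.map fun p => underlying p.2.1.2 :=
      (List.map_map ..).trans (congrArg (fun k => L.map k) (funext fun p => fst_pbMk ..))
    have hz₃ : (z.map (pullback.fst (listMonad.map Z.cod) Z.dom).left).flatten =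
        underlying (L.flatMap fun p => p.2.1.2) :=
      (congrArg List.flatten hz₃').trans
        (List.map_flatMap (f := fun g : Σ n, OpOfArity Z n => g.2.1)).symm
    have hz : (listMonad.map (pullback.snd (listMonad.map Z.cod) Z.dom ≫ Z.cod)).left z =
        Z.dom.left f.1 :=
      have := subsingleton_left_of_isTerminal hZ
      list_eq_of_length_eq (α := Z.obj.left)
        ((List.length_map ..).trans ((List.length_map ..).trans (h.trans f.2.symm)))
    obtain ⟨h₁, h₂, h₃, e⟩ := H.exists_mult_assoc z f.1 hz
    refine total_ext (Eq.trans ?_ (e.trans (Z.mulEl_congr hz₃ ?_ _ _)))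
    · exact Z.mulEl_congr ((underlying_map _ L).trans hz₁.symm) rfl _ h₁
    · exact Z.mulEl_congr (hz₂.trans (underlying_map
        (fun p => (⟨p.1, p.2.1.1⟩ : Σ n, OpOfArity Z n)) L).symm) rfl _ _

lemma exists_iso_of_isPMulticategory {Z : PMulticatData listMonad.{w}} (H : IsPMulticategory Z)
    (hZ : IsTerminal Z.obj) : ∃ X : PlainOperad.{w}, Nonempty (toData.obj X ≅ Z) := by
  have H' := Z.elementLaws_iff.2 H
  have hs := subsingleton_left_of_isTerminal hZ
  let X := ofData H' hZ
  let f : PMulticatData.Hom X.data Z :=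
    { obj := (Over.mkIdTerminal.uniqueUpToIso hZ).hom
      arr := Over.homMk (U := X.data.arr) (↾fun p : Σ n, OpOfArity Z n => p.2.1)
      dom := by
        ext p
        exact list_eq_of_length_eq (α := Z.obj.left) ((List.length_map ..).trans
          (List.length_replicate.trans (p : Σ n, OpOfArity Z n).2.2.symm))
      cod := hZ.hom_ext _ _
      unit := by
        ext p
        exact congrArg Z.unit.left (Subsingleton.elim _ _)
      mult := by
        refine (PMulticatData.map_mult_iff (X := X.data) (Y := Z) _ _ _ _).2 fun x y h h' => ?_
        exact congrArg (fun p : Σ n, OpOfArity Z n => p.2.1) (X.data_mulEl x y h) }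
  have : IsIso ((Over.forget _).map f.arr) := by
    refine (isIso_iff_bijective _).2 ⟨fun p q h => total_ext h, fun x => ⟨⟨_, ⟨x, rfl⟩⟩, rfl⟩⟩
  have : IsIso f.obj := inferInstanceAs (IsIso (Over.mkIdTerminal.uniqueUpToIso hZ).hom)
  have : IsIso f.arr :=
    isIso_of_reflects_iso (f.arr : X.data.arr ⟶ Z.arr) (Over.forget PUnit)
  exact ⟨X, ⟨PMulticatData.isoOfHom (X := X.data) f⟩⟩

end OfData

end PlainOperad

/-! ### Small categories as endospans for the identity monad -/

section Cat

variable {C D : Type w} [Category.{w} C] [Category.{w} D]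

lemma catData_mulEl (f g : Σ p : C × C, p.1 ⟶ p.2) (h : f.1.2 = g.1.1) :
    (catData C).mulEl f g h = compArrow f g h :=
  catData_mult C _ _ _ (fst_pbMk (A := idMonad.obj (catData C).arr) (B := (catData C).arr) f g h)
    (snd_pbMk (A := idMonad.obj (catData C).arr) (B := (catData C).arr) f g h) h

/-- An arrow with source equal to `a` and target equal to `b`, as a morphism `a ⟶ b`. -/
def arrowHom (e : Σ p : C × C, p.1 ⟶ p.2) {a b : C} (ha : e.1.1 = a) (hb : e.1.2 = b) : a ⟶ b :=
  eqToHom ha.symm ≫ e.2 ≫ eqToHom hb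

/-- The conversion of an arrow with prescribed source and target to a morphism does not change the
arrow. -/
lemma mk_arrowHom (e : Σ p : C × C, p.1 ⟶ p.2) {a b : C} (ha : e.1.1 = a) (hb : e.1.2 = b) :
    (⟨(a, b), arrowHom e ha hb⟩ : Σ p : C × C, p.1 ⟶ p.2) = e := by
  subst ha hb
  obtain ⟨⟨a, b⟩, t⟩ := e
  simp [arrowHom]

lemma source_map (F : PMulticatData.Hom (catData C) (catData D)) (f : Σ p : C × C, p.1 ⟶ p.2) :
    (F.arr.left f : Σ p : D × D, p.1 ⟶ p.2).1.1 = F.obj.left f.1.1 := by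
  have h := ConcreteCategory.congr_hom (congrArg Over.Hom.left F.dom) f
  exact h.symm

lemma target_map (F : PMulticatData.Hom (catData C) (catData D)) (f : Σ p : C × C, p.1 ⟶ p.2) :
    (F.arr.left f : Σ p : D × D, p.1 ⟶ p.2).1.2 = F.obj.left f.1.2 := by
  have h := ConcreteCategory.congr_hom (congrArg Over.Hom.left F.cod) f
  exact h.symm

lemma compArrow_mk {a b c : C} (s : a ⟶ b) (t : b ⟶ c) :
    compArrow (⟨(a, b), s⟩ : Σ p : C × C, p.1 ⟶ p.2) ⟨(b, c), t⟩ rfl = ⟨(a, c), s ≫ t⟩ := by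
  simp [compArrow]

/-- The functor which underlies a morphism of endospans. -/
noncomputable def functorOfData (F : PMulticatData.Hom (catData C) (catData D)) : C ⥤ D where
  obj a := F.obj.left a
  map {a b} t := arrowHom (F.arr.left (⟨(a, b), t⟩ : Σ p : C × C, p.1 ⟶ p.2))
    (source_map F ⟨(a, b), t⟩) (target_map F ⟨(a, b), t⟩)
  map_id a := by
    have e := mk_arrowHom (F.arr.left (⟨(a, a), 𝟙 a⟩ : Σ p : C × C, p.1 ⟶ p.2))
      (source_map F ⟨(a, a), 𝟙 a⟩) (target_map F ⟨(a, a), 𝟙 a⟩)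
    have e' := ConcreteCategory.congr_hom (congrArg Over.Hom.left F.unit) a
    exact eq_of_heq (Sigma.mk.inj (e.trans e')).2
  map_comp {a b c} s t := by
    have key := (PMulticatData.map_mult_iff F.obj F.arr F.dom F.cod).1 F.mult
      (⟨(a, b), s⟩ : Σ p : C × C, p.1 ⟶ p.2) (⟨(b, c), t⟩ : Σ p : C × C, p.1 ⟶ p.2) rfl
      ((target_map F ⟨(a, b), s⟩).trans (source_map F ⟨(b, c), t⟩).symm)
    have h₂ := (congrArg F.arr.left ((catData_mulEl _ _ rfl).trans (compArrow_mk s t))).symm.trans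
      (key.trans (catData_mulEl _ _ _))
    have h₃ := (mk_arrowHom (F.arr.left (⟨(a, c), s ≫ t⟩ : Σ p : C × C, p.1 ⟶ p.2))
      (source_map F ⟨(a, c), s ≫ t⟩) (target_map F ⟨(a, c), s ≫ t⟩)).trans
      (h₂.trans ((compArrow_congr
        (mk_arrowHom _ (source_map F ⟨(a, b), s⟩) (target_map F ⟨(a, b), s⟩)).symm
        (mk_arrowHom _ (source_map F ⟨(b, c), t⟩) (target_map F ⟨(b, c), t⟩)).symm _ rfl).trans
        (compArrow_mk _ _)))
    exact eq_of_heq (Sigma.mk.inj h₃).2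

lemma mapArrow_functorOfData (F : PMulticatData.Hom (catData C) (catData D))
    (f : Σ p : C × C, p.1 ⟶ p.2) : mapArrow (functorOfData F) f = F.arr.left f :=
  mk_arrowHom _ (source_map F f) (target_map F f)

lemma compArrow_assoc {f g h : Σ p : C × C, p.1 ⟶ p.2} (hfg : f.1.2 = g.1.1)
    (hgh : g.1.2 = h.1.1) :
    compArrow (compArrow f g hfg) h hgh = compArrow f (compArrow g h hgh) hfg := by
  simp [compArrow]

instance : catToData.{w}.Faithful where
  map_injective {X Y} F G h := by
    refine Cat.Hom.ext (Functor.hext (fun a => ?_) fun a b t => ?_)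
    · exact ConcreteCategory.congr_hom
        (congrArg (fun k : PMulticatData.Hom (catData X) (catData Y) => k.obj.left) h) a
    · have e : mapArrow F.toFunctor ⟨(a, b), t⟩ = mapArrow G.toFunctor ⟨(a, b), t⟩ :=
        ConcreteCategory.congr_hom
          (congrArg (fun k : PMulticatData.Hom (catData X) (catData Y) => k.arr.left) h)
          ⟨(a, b), t⟩
      exact (Sigma.mk.inj e).2

instance : catToData.{w}.Full where
  map_surjective {X Y} F := by
    refine ⟨(functorOfData F).toCatHom, PMulticatData.Hom.ext rfl ?_⟩
    ext f
    exact mapArrow_functorOfData F f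

lemma isPMulticategory_catData (C : Type w) [Category.{w} C] : IsPMulticategory (catData C) := by
  refine (catData C).elementLaws_iff.1 ⟨fun _ => rfl, fun _ => rfl, ?_, ?_, ?_, ?_, ?_⟩
  · intro x y h
    have e := congrArg (fun f : Σ p : C × C, p.1 ⟶ p.2 => f.1.1) (catData_mulEl (C := C) x y h)
    exact e
  · intro x y h
    have e := congrArg (fun f : Σ p : C × C, p.1 ⟶ p.2 => f.1.2) (catData_mulEl (C := C) x y h)
    exact e
  · intro (y : Σ p : C × C, p.1 ⟶ p.2) h
    exact (catData_mulEl (C := C) _ _ h).trans ((compArrow_mk y.2 (𝟙 _)).trans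
      (congrArg (Sigma.mk y.1) (Category.comp_id _)))
  · intro (y : Σ p : C × C, p.1 ⟶ p.2) h
    exact (catData_mulEl (C := C) _ _ h).trans ((compArrow_mk (𝟙 _) y.2).trans
      (congrArg (Sigma.mk y.1) (Category.id_comp _)))
  · intro z y h h₁ h₂ h₃
    have e := ((catData C).mult_left_apply z).trans
      (catData_mulEl (C := C) _ _ (pullback_condition_apply z))
    refine (catData_mulEl (C := C) _ _ h₁).trans (Eq.trans ?_ (catData_mulEl (C := C) _ _ h₃).symm)
    exact (compArrow_congr (C := C) e rfl _ h₂).trans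
      ((compArrow_assoc (C := C) (pullback_condition_apply z) h₂).trans
        (compArrow_congr (C := C) rfl (catData_mulEl (C := C) _ _ h₂).symm _ _))

/-- The category with the elements of a multicategory relative to the identity monad. -/
noncomputable abbrev categoryOfData {Z : PMulticatData idMonad.{w}} (H : Z.ElementLaws) :
    Category.{w} Z.obj.left where
  Hom a b := {x : Z.arr.left // Z.dom.left x = a ∧ Z.cod.left x = b}
  id a := ⟨Z.unit.left a, H.unit_dom a, H.unit_cod a⟩
  comp f g := ⟨Z.mulEl f.1 g.1 (f.2.2.trans g.2.1.symm),
    (H.mult_dom _ _ _).trans f.2.1, (H.mult_cod _ _ _).trans g.2.2⟩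
  id_comp {a b} f := by
    have h₁ : Z.unit.left a = Z.unit.left (Z.dom.left f.1) := congrArg Z.unit.left f.2.1.symm
    refine Subtype.ext ((Z.mulEl_congr h₁ rfl _ ?_).trans (H.unit_mult f.1 ?_))
    all_goals exact H.unit_cod _
  comp_id {a b} f := by
    have h₁ : Z.unit.left b = Z.unit.left (Z.cod.left f.1) := congrArg Z.unit.left f.2.2.symm
    refine Subtype.ext ((Z.mulEl_congr rfl h₁ _ ?_).trans (H.mult_unit f.1 ?_))
    all_goals exact (H.unit_dom _).symm
  assoc {a b c d} f g h := by
    have hfg : Z.cod.left f.1 = Z.dom.left g.1 := f.2.2.trans g.2.1.symm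
    have hgh : Z.cod.left g.1 = Z.dom.left h.1 := g.2.2.trans h.2.1.symm
    have e₁ := fst_pbMk (f := idMonad.map Z.cod) (g := Z.dom) f.1 g.1 hfg
    have e₂ := snd_pbMk (f := idMonad.map Z.cod) (g := Z.dom) f.1 g.1 hfg
    obtain ⟨h₁, h₂, h₃, e⟩ := H.exists_mult_assoc (pbMk (idMonad.map Z.cod) Z.dom f.1 g.1 hfg) h.1
      ((congrArg Z.cod.left e₂).trans hgh)
    exact Subtype.ext (e.trans (Z.mulEl_congr e₁ (Z.mulEl_congr e₂ rfl h₂ hgh) _ _))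

lemma exists_iso_catToData {Z : PMulticatData idMonad.{w}} (H : IsPMulticategory Z) :
    ∃ X : Cat.{w, w}, Nonempty (catToData.obj X ≅ Z) := by
  let _ := categoryOfData (Z.elementLaws_iff.2 H)
  let C : Type w := Z.obj.left
  let f : PMulticatData.Hom (catData C) Z :=
    { obj := Over.homMk (U := (catData C).obj) (𝟙 Z.obj.left)
      arr := Over.homMk (U := (catData C).arr) (↾fun p : Σ p : C × C, p.1 ⟶ p.2 => p.2.1)
      dom := by ext p; exact (p : Σ p : C × C, p.1 ⟶ p.2).2.2.1.symm
      cod := by ext p; exact (p : Σ p : C × C, p.1 ⟶ p.2).2.2.2.symm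
      unit := rfl
      mult := by
        refine (PMulticatData.map_mult_iff (X := catData C) (Y := Z) _ _ _ _).2 fun x y h h' => ?_
        refine (congrArg (fun p : Σ p : C × C, p.1 ⟶ p.2 => p.2.1) (catData_mulEl x y h)).trans ?_
        obtain ⟨⟨a, b⟩, s⟩ := (x : Σ p : C × C, p.1 ⟶ p.2)
        obtain ⟨⟨b', c⟩, t⟩ := (y : Σ p : C × C, p.1 ⟶ p.2)
        obtain rfl : b = b' := h
        exact congrArg (fun p : Σ p : C × C, p.1 ⟶ p.2 => p.2.1) (compArrow_mk s t) }
  have : IsIso ((Over.forget _).map f.obj) := inferInstanceAs (IsIso (𝟙 Z.obj.left))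
  have arrow_ext {p q : Σ p : C × C, p.1 ⟶ p.2} (h : p.2.1 = q.2.1) : p = q := by
    obtain ⟨⟨a, b⟩, x, hx₁, hx₂⟩ := p
    obtain ⟨⟨a', b'⟩, x', hx₁', hx₂'⟩ := q
    obtain rfl : x = x' := h
    obtain rfl : a = a' := hx₁.symm.trans hx₁'
    obtain rfl : b = b' := hx₂.symm.trans hx₂'
    rfl
  have : IsIso ((Over.forget _).map f.arr) := by
    refine (isIso_iff_bijective _).2 ⟨fun p q h => ?_, fun x => ⟨⟨(_, _), ⟨x, rfl, rfl⟩⟩, rfl⟩⟩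
    exact arrow_ext h
  have : IsIso f.obj := isIso_of_reflects_iso (f.obj : (catData C).obj ⟶ Z.obj) (Over.forget PUnit)
  have : IsIso f.arr := isIso_of_reflects_iso (f.arr : (catData C).arr ⟶ Z.arr) (Over.forget PUnit)
  exact ⟨Cat.of C, ⟨PMulticatData.isoOfHom (X := catData C) f⟩⟩

end Cat

/-! ### Monoids as endospans for the identity monad -/

section Mon

lemma monData_mulEl {M : Type w} [Monoid M] (x y : M)
    (h : (idMonad.map (monData M).cod).left x = (monData M).dom.left y) :
    (monData M).mulEl x y h = y * x :=
  congrArg₂ (fun x y : M => mulOp x y)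
    (fst_pbMk (A := idMonad.obj (monData M).arr) (B := (monData M).arr) x y h)
    (snd_pbMk (A := idMonad.obj (monData M).arr) (B := (monData M).arr) x y h)

instance : monToData.{w}.Faithful where
  map_injective {X Y} F G h := by
    refine MonCat.hom_ext (MonoidHom.ext fun a => ?_)
    exact ConcreteCategory.congr_hom
      (congrArg (fun k : PMulticatData.Hom (monData X) (monData Y) => k.arr.left) h) a

/-- The homomorphism which underlies a morphism of endospans. -/
noncomputable def monoidHomOfData {M N : Type w} [Monoid M] [Monoid N]
    (F : PMulticatData.Hom (monData M) (monData N)) : M →* N where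
  toFun x := F.arr.left x
  map_one' := ConcreteCategory.congr_hom (congrArg Over.Hom.left F.unit) PUnit.unit
  map_mul' x y := by
    have key := (PMulticatData.map_mult_iff F.obj F.arr F.dom F.cod).1 F.mult y x rfl rfl
    exact (congrArg F.arr.left (monData_mulEl y x rfl)).symm.trans
      (key.trans (monData_mulEl _ _ _))

instance : monToData.{w}.Full where
  map_surjective {X Y} F := by
    refine ⟨MonCat.ofHom (monoidHomOfData F), PMulticatData.Hom.ext ?_ rfl⟩
    exact Over.mkIdTerminal.hom_ext _ _

lemma isPMulticategory_monData (M : Type w) [Monoid M] : IsPMulticategory (monData M) := by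
  refine (monData M).elementLaws_iff.1 ⟨fun _ => rfl, fun _ => rfl, fun _ _ _ => rfl,
    fun _ _ _ => rfl, ?_, ?_, ?_⟩
  · intro y h
    exact (monData_mulEl (M := M) _ _ h).trans (one_mul (M := M) y)
  · intro y h
    exact (monData_mulEl (M := M) _ _ h).trans (mul_one (M := M) y)
  · intro z y h h₁ h₂ h₃
    have e₁ := (monData M).mult_left_apply z
    have e₂ := e₁.trans (monData_mulEl (M := M) _ _ _)
    refine (monData_mulEl (M := M) _ _ h₁).trans (Eq.trans ?_ (monData_mulEl (M := M) _ _ h₃).symm)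
    refine (congrArg (HMul.hMul (α := M) (β := M) (γ := M) y) e₂).trans
      ((mul_assoc (G := M) _ _ _).symm.trans ?_)
    exact congrArg (fun t : M => t * _) (monData_mulEl (M := M) _ _ h₂).symm

/-- The monoid with the elements of an operad relative to the identity monad. -/
noncomputable abbrev monoidOfData {Z : PMulticatData idMonad.{w}} (H : Z.ElementLaws)
    (hZ : IsTerminal Z.obj) : Monoid Z.arr.left :=
  have hs := subsingleton_left_of_isTerminal hZ
  -- The first argument of `mulEl` is the arrow which is performed first, and the product `x * y` of
  -- a monoid, regarded as a one-object category, performs `y` first.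
  { mul x y := Z.mulEl y x (Subsingleton.elim (α := Z.obj.left) _ _)
    one := Z.unit.left (elementOfIsTerminal hZ)
    one_mul x := (Z.mulEl_congr rfl (congrArg Z.unit.left (Subsingleton.elim _ _)) _ _).trans
      (H.mult_unit x (Subsingleton.elim (α := Z.obj.left) _ _))
    mul_one x := (Z.mulEl_congr
        (congrArg Z.unit.left (Subsingleton.elim (α := Z.obj.left) _ _)) rfl _ _).trans
      (H.unit_mult x (Subsingleton.elim (α := Z.obj.left) _ _))
    mul_assoc x y z := by
      have hzy : Z.cod.left z = Z.dom.left y := Subsingleton.elim (α := Z.obj.left) _ _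
      have hyx : Z.cod.left y = Z.dom.left x := Subsingleton.elim (α := Z.obj.left) _ _
      have e₁ := fst_pbMk (f := idMonad.map Z.cod) (g := Z.dom) z y hzy
      have e₂ := snd_pbMk (f := idMonad.map Z.cod) (g := Z.dom) z y hzy
      obtain ⟨h₁, h₂, h₃, e⟩ := H.exists_mult_assoc (pbMk (idMonad.map Z.cod) Z.dom z y hzy) x
        (Subsingleton.elim (α := Z.obj.left) _ _)
      exact (e.trans (Z.mulEl_congr e₁ (Z.mulEl_congr e₂ rfl h₂ hyx) _ _)).symm }

lemma exists_iso_monToData {Z : PMulticatData idMonad.{w}} (H : IsPMulticategory Z)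
    (hZ : IsTerminal Z.obj) : ∃ X : MonCat.{w}, Nonempty (monToData.obj X ≅ Z) := by
  have hs := subsingleton_left_of_isTerminal hZ
  let _ := monoidOfData (Z.elementLaws_iff.2 H) hZ
  let M : Type w := Z.arr.left
  let f : PMulticatData.Hom (monData M) Z :=
    { obj := (Over.mkIdTerminal.uniqueUpToIso hZ).hom
      arr := Over.homMk (U := (monData M).arr) (𝟙 Z.arr.left)
      dom := hZ.hom_ext _ _
      cod := hZ.hom_ext _ _
      unit := by
        ext p
        exact congrArg Z.unit.left (Subsingleton.elim _ _)
      mult := by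
        refine (PMulticatData.map_mult_iff (X := monData M) (Y := Z) _ _ _ _).2 fun x y h h' => ?_
        exact monData_mulEl (M := M) x y h }
  have : IsIso f.obj := inferInstanceAs (IsIso (Over.mkIdTerminal.uniqueUpToIso hZ).hom)
  have : IsIso ((Over.forget _).map f.arr) := inferInstanceAs (IsIso (𝟙 Z.arr.left))
  have : IsIso f.arr := isIso_of_reflects_iso (f.arr : (monData M).arr ⟶ Z.arr) (Over.forget PUnit)
  exact ⟨MonCat.of M, ⟨PMulticatData.isoOfHom (X := monData M) f⟩⟩

end Mon

/-! ### The equivalences for the free-monoid monad and the identity monad -/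

section Equivalences

variable {I : Type w} (P : PolynomialMonad I)

/-- If the essential image of a fully faithful functor consists of the multicategories relative to
`P`, then its source is equivalent to the category of polynomial monads over `P`. -/
lemma exists_equivalence_over {𝒜 : Type*} [Category* 𝒜] (G : 𝒜 ⥤ PMulticatData P.toMonad)
    [G.Full] [G.Faithful] (hG : ∀ A, IsPMulticategory (G.obj A))
    (hG' : ∀ Z, IsPMulticategory Z → ∃ A, Nonempty (G.obj A ≅ Z)) :
    ∃ e : 𝒜 ≌ Over (⟨I, P⟩ : PolyMnd (Type w)),
      Nonempty (e.functor ⋙ multicatData ⟨I, P⟩ ≅ G) :=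
  exists_equivalence_of_fullyFaithful G (multicatData ⟨I, P⟩)
    (fun A => (hG A).exists_over) fun _ => hG' _ (isPMulticategory_multicatObj _)

/-- If the essential image of a fully faithful functor consists of the operads relative to `P`,
then its source is equivalent to the category of polynomial monads over `P` with the same object of
colours. -/
lemma exists_equivalence_fibre_over {𝒜 : Type*} [Category* 𝒜] (G : 𝒜 ⥤ PMulticatData P.toMonad)
    [G.Full] [G.Faithful] (hG : ∀ A, IsPMulticategory (G.obj A))
    (hG₁ : ∀ A, Nonempty (IsTerminal (G.obj A).obj))
    (hG' : ∀ Z, IsPMulticategory Z → IsTerminal Z.obj → ∃ A, Nonempty (G.obj A ≅ Z)) :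
    ∃ e : 𝒜 ≌ Over P,
      Nonempty (e.functor ⋙ Over.post (PolyMnd.fibreInclusion I) ⋙ multicatData ⟨I, P⟩ ≅ G) :=
  exists_equivalence_of_fullyFaithful G (operadData P)
    (fun A => (hG A).exists_over_of_isTerminal (hG₁ A).some) fun Q =>
      hG' _ (isPMulticategory_multicatObj _) (isTerminal_operadData_obj Q).some

end Equivalences

end PolyMonads

theorem mainTheorem7 :
    (∀ (E : Type u) [Category.{v} E] [CartesianMonoidalCategory E] [HasPullbacks E]
      [PolyMonads.LocallyCartesianClosed E] (I : E) (P : PolyMonads.PolynomialMonad I),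
      (∃ e : PolyMonads.PMulticat P.toMonad ≌ Over (⟨I, P⟩ : PolyMonads.PolyMnd E),
        Nonempty (e.inverse ⋙ PolyMonads.PMulticat.toData P.toMonad ≅
          PolyMonads.multicatData ⟨I, P⟩)) ∧
      (∃ e : PolyMonads.POperad P.toMonad ≌ Over P,
        Nonempty (e.inverse ⋙ PolyMonads.POperad.toData P.toMonad ≅
          Over.post (PolyMonads.PolyMnd.fibreInclusion I) ⋙ PolyMonads.multicatData ⟨I, P⟩))) ∧
    (∃ h : PolyMonads.IsPolynomialMonad PolyMonads.listMonad.{w} PolyMonads.listStrength.{w},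
      (∃ e : PolyMonads.Multicategory.{w} ≌
          Over (⟨PUnit.{w + 1}, ⟨PolyMonads.listMonad, PolyMonads.listStrength, h⟩⟩ :
            PolyMonads.PolyMnd (Type w)),
        Nonempty (e.functor ⋙ PolyMonads.multicatData _ ≅ PolyMonads.Multicategory.toData)) ∧
      (∃ e : PolyMonads.PlainOperad.{w} ≌
          Over (⟨PolyMonads.listMonad, PolyMonads.listStrength, h⟩ :
            PolyMonads.PolynomialMonad PUnit.{w + 1}),
        Nonempty (e.functor ⋙ Over.post (PolyMonads.PolyMnd.fibreInclusion PUnit.{w + 1}) ⋙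
          PolyMonads.multicatData _ ≅ PolyMonads.PlainOperad.toData))) ∧
    (∃ h : PolyMonads.IsPolynomialMonad PolyMonads.idMonad.{w} (PolyMonads.Strength.id _),
      (∃ e : Cat.{w, w} ≌
          Over (⟨PUnit.{w + 1}, ⟨PolyMonads.idMonad, PolyMonads.Strength.id _, h⟩⟩ :
            PolyMonads.PolyMnd (Type w)),
        Nonempty (e.functor ⋙ PolyMonads.multicatData _ ≅ PolyMonads.catToData)) ∧
      (∃ e : MonCat.{w} ≌
          Over (⟨PolyMonads.idMonad, PolyMonads.Strength.id _, h⟩ :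
            PolyMonads.PolynomialMonad PUnit.{w + 1}),
        Nonempty (e.functor ⋙ Over.post (PolyMonads.PolyMnd.fibreInclusion PUnit.{w + 1}) ⋙
          PolyMonads.multicatData _ ≅ PolyMonads.monToData))) :=
  ⟨fun _ _ _ _ _ _ P => ⟨PolyMonads.exists_pMulticat_equivalence P,
      PolyMonads.exists_pOperad_equivalence P⟩,
    ⟨PolyMonads.isPolynomialMonad_listMonad.{w},
      PolyMonads.exists_equivalence_over ⟨_, _, PolyMonads.isPolynomialMonad_listMonad.{w}⟩
        PolyMonads.Multicategory.toData.{w} PolyMonads.Multicategory.isPMulticategory_data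
        fun _ H => PolyMonads.Multicategory.exists_iso_of_isPMulticategory H,
      PolyMonads.exists_equivalence_fibre_over ⟨_, _, PolyMonads.isPolynomialMonad_listMonad.{w}⟩
        PolyMonads.PlainOperad.toData.{w} PolyMonads.PlainOperad.isPMulticategory_data
        (fun _ => ⟨Over.mkIdTerminal⟩)
        fun _ H hZ => PolyMonads.PlainOperad.exists_iso_of_isPMulticategory H hZ⟩,
    ⟨PolyMonads.isPolynomialMonad_id PUnit.{w + 1},
      PolyMonads.exists_equivalence_over ⟨_, _, PolyMonads.isPolynomialMonad_id PUnit.{w + 1}⟩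
        PolyMonads.catToData.{w} (fun C => PolyMonads.isPMulticategory_catData C)
        fun _ H => PolyMonads.exists_iso_catToData H,
      PolyMonads.exists_equivalence_fibre_over ⟨_, _, PolyMonads.isPolynomialMonad_id PUnit.{w + 1}⟩
        PolyMonads.monToData.{w} (fun M => PolyMonads.isPMulticategory_monData M)
        (fun _ => ⟨Over.mkIdTerminal⟩)
        fun _ H hZ => PolyMonads.exists_iso_monToData H hZ⟩⟩
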